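/- Let $n\ge 1$. Let $\mathrm{Cvx}_n$ be the set of convex, lower semicontinuous functions $\phi:\mathbb{R}^n\to(-\infty,\infty]$ with $0<\int_{\mathbb{R}^n}e^{-\phi}\,dx<\infty$, and let $\mathrm{LC}_n=\{e^{-\phi}:\phi\in\mathrm{Cvx}_n\}$. For $f=e^{-\phi}\in\mathrm{LC}_n$ let $\operatorname{supp}(f)=\overline{\{x:f(x)>0\}}$, let $n_{\operatorname{supp}(f)}:\partial\operatorname{supp}(f)\to S^{n-1}$ be the $\mathcal{H}^{n-1}$-almost everywhere defined outer unit normal (Gauss map), where $\mathcal{H}^{n-1}$ is the $(n-1)$-dimensional Hausdorff measure with the Euclidean normalization, and define the surface area measures of $f$ as the push-forwards $$\mu_f=(\nabla\phi)_\sharp\big(f\,dx\big)\ \text{ on }\mathbb{R}^n,\qquad \nu_f=(n_{\operatorname{supp}(f)})_\sharp\big(f\,d\mathcal{H}^{n-1}|_{\partial\operatorname{supp}(f)}\big)\ \text{ on }S^{n-1}.$$ A function $\xi:\mathbb{R}^n\to\mathbb{R}$ is called cosmically continuous if it is continuous and the finite limit $\overline{\xi}(\theta)=\lim_{\lambda\to\infty}\xi(\lambda\theta)/\lambda$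 exists uniformly in $\theta\in S^{n-1}$. **Theorem.** Let $f_1,f_2,\ldots$ and $f$ belong to $\mathrm{LC}_n$, and suppose that $\phi_k=-\log f_k$ epi-converges to $\phi=-\log f$, that is, for every $x\in\mathbb{R}^n$: 1. $\liminf_{k\to\infty}\phi_k(x_k)\ge\phi(x)$ for every sequence $x_k\to x$; 2. there is a sequence $x_k\to x$ with $\limsup_{k\to\infty}\phi_k(x_k)\le\phi(x)$. Then $(\mu_{f_k},\nu_{f_k})\to(\mu_f,\nu_f)$ cosmically. That is, all these measures are finite, and for every cosmically continuous $\xi:\mathbb{R}^n\to\mathbb{R}$ the functions $\xi$ and $\overline{\xi}$ are integrable with respect to $\mu_{f_k},\mu_f$ and $\nu_{f_k},\nu_f$ respectively, and $$\int_{\mathbb{R}^n}\xi\,d\mu_{f_k}+\int_{S^{n-1}}\overline{\xi}\,d\nu_{f_k}\ \xrightarrow[k\to\infty]{}\ \int_{\mathbb{R}^n}\xi\,d\mu_f+\int_{S^{n-1}}\overline{\xi}\,d\nu_f .$$ -/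

import Mathlib

open MeasureTheory Filter Topology

noncomputable section

/-- `ℝⁿ` with its Euclidean norm. -/
abbrev Rn (n : ℕ) : Type := EuclideanSpace ℝ (Fin n)

/-- The unit sphere `Sⁿ⁻¹` of `ℝⁿ`. -/
abbrev UnitSphere (n : ℕ) : Type := Metric.sphere (0 : Rn n) 1

/-- The class `Cvxₙ`: convex (that is, with convex epigraph) lower semicontinuous functions
`φ : ℝⁿ → (-∞, ∞]` such that `0 < ∫ exp (-φ) < ∞`. -/
structure IsCvx {n : ℕ} (φ : Rn n → EReal) : Prop where
  ne_bot : ∀ x, φ x ≠ ⊥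
  convex_epigraph : Convex ℝ {p : Rn n × ℝ | φ p.1 ≤ (p.2 : EReal)}
  lowerSemicontinuous : LowerSemicontinuous φ
  integral_pos : 0 < ∫⁻ x, EReal.exp (-φ x)
  integral_lt_top : ∫⁻ x, EReal.exp (-φ x) < ⊤

/-- The class `LCₙ` of log-concave functions `f = exp (-φ)` with `φ` in `Cvxₙ`. -/
def LC (n : ℕ) : Set (Rn n → ℝ) :=
  {f | ∃ φ : Rn n → EReal, IsCvx φ ∧ ∀ x, f x = (EReal.exp (-φ x)).toReal}

/-- The function `-log f : ℝⁿ → (-∞, ∞]` of a nonnegative function `f`, with `-log 0 = ∞`. -/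
def negLog {n : ℕ} (f : Rn n → ℝ) (x : Rn n) : EReal :=
  -ENNReal.log (ENNReal.ofReal (f x))

/-- Epi-convergence of `φ k` to `φ`. -/
def EpiTendsto {n : ℕ} (φk : ℕ → Rn n → EReal) (φ : Rn n → EReal) : Prop :=
  (∀ (x : Rn n) (xk : ℕ → Rn n), Tendsto xk atTop (𝓝 x) →
      φ x ≤ liminf (fun k => φk k (xk k)) atTop) ∧
  (∀ x : Rn n, ∃ xk : ℕ → Rn n, Tendsto xk atTop (𝓝 x) ∧
      limsup (fun k => φk k (xk k)) atTop ≤ φ x)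

/-- The closed support of a nonnegative function. -/
def supp {n : ℕ} (f : Rn n → ℝ) : Set (Rn n) := closure {x | 0 < f x}

/-- `θ` is an outer unit normal to `K` at `x`. -/
def IsOuterUnitNormal {n : ℕ} (K : Set (Rn n)) (x : Rn n) (θ : UnitSphere n) : Prop :=
  ∀ y ∈ K, inner ℝ (y - x) (θ : Rn n) ≤ 0

open Classical in
/-- The Gauss map of `K`: the outer unit normal at `x` where it is unique (which, for `K` closed
convex with non-empty interior, is the case at `ℋⁿ⁻¹`-almost every boundary point), and an
arbitrary fixed unit vector at all other points. -/
def gaussMap {n : ℕ} [NeZero n] (K : Set (Rn n)) (x : Rn n) : UnitSphere n :=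
  if h : ∃! θ : UnitSphere n, IsOuterUnitNormal K x θ then h.choose
  else ⟨EuclideanSpace.single 0 1, by simp⟩

/-- The surface area measure `μ_f = (∇φ)_♯ (f dx)` on `ℝⁿ`, where `φ = -log f`. Only the points
with `f x > 0` carry mass, and almost all of them are interior to `{f > 0}`. -/
def muMeasure {n : ℕ} (f : Rn n → ℝ) : Measure (Rn n) :=
  Measure.map (gradient fun x => -Real.log (f x))
    (volume.withDensity fun x => ENNReal.ofReal (f x))

/-- The surface area measure `ν_f = (n_{supp f})_♯ (f dℋⁿ⁻¹|_{∂ supp f})` on `Sⁿ⁻¹`. Here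
`μHE[n - 1]` is the Hausdorff measure with the usual Euclidean normalization. -/
def nuMeasure {n : ℕ} [NeZero n] (f : Rn n → ℝ) : Measure (UnitSphere n) :=
  Measure.map (gaussMap (supp f))
    (((μHE[n - 1] : Measure (Rn n)).restrict (frontier (supp f))).withDensity
      fun x => ENNReal.ofReal (f x))

/-- `ξ` is cosmically continuous, with horizon function `ξbar`: `ξ` is continuous, and
`ξ (r θ) / r → ξbar θ` as `r → ∞`, uniformly in `θ ∈ Sⁿ⁻¹`. -/
def CosmicallyContinuousWith {n : ℕ} (ξ : Rn n → ℝ) (ξbar : UnitSphere n → ℝ) : Prop :=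
  Continuous ξ ∧
    TendstoUniformly (fun (r : ℝ) (θ : UnitSphere n) => ξ (r • (θ : Rn n)) / r) ξbar atTop

/-- Cosmic convergence `(μk, νk) → (μ, ν)` of pairs of finite Borel measures. The finiteness of
the measures and the existence of all the integrals are part of the assertion. -/
def CosmicTendsto {n : ℕ} (μk : ℕ → Measure (Rn n)) (νk : ℕ → Measure (UnitSphere n))
    (μ : Measure (Rn n)) (ν : Measure (UnitSphere n)) : Prop :=
  (∀ k, IsFiniteMeasure (μk k) ∧ IsFiniteMeasure (νk k)) ∧
  IsFiniteMeasure μ ∧ IsFiniteMeasure ν ∧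
  ∀ (ξ : Rn n → ℝ) (ξbar : UnitSphere n → ℝ), CosmicallyContinuousWith ξ ξbar →
    (∀ k, Integrable ξ (μk k) ∧ Integrable ξbar (νk k)) ∧
    Integrable ξ μ ∧ Integrable ξbar ν ∧
    Tendsto (fun k => (∫ x, ξ x ∂(μk k)) + (∫ θ, ξbar θ ∂(νk k))) atTop
      (𝓝 ((∫ x, ξ x ∂μ) + (∫ θ, ξbar θ ∂ν)))

end

/-! Let h be the positively homogeneous extension of the horizon function, `homogeneousExtension`.
Then ζ = ξ - h grows sublinearly. Since h agrees with the horizon function on unit normals, the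
pairing of ξ with (μ_f, ν_f) is the integral of ζ(∇φ) f dx plus the integral of h over `gradMeasure
f`. The latter joins f∇φ dx on the interior of the support to f n dℋⁿ⁻¹ on its boundary, and
represents the distributional gradient of -f. Gradient mass can move from the bulk to the boundary
in the limit, so the two measures need not converge separately; the splitting isolates what does
converge.

Sublinear term. Hypo-converging log-concave functions share an exponential bound
(`HypoTendsto.exists_exp_bound`), converge pointwise off the boundary of the limiting support, and
their gradients converge almost everywhere inside it. Dominated convergence handles bounded ζ, and
truncation handles sublinear ζ because the total gradient mass stays bounded.

Homogeneous term. By Reshetnyak's continuity theorem (`tendsto_integral_homogeneous`) it is enough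
that the vector measures converge weakly and that their total variations converge. Weak convergence
follows from integration by parts (`IsLogConc.integral_by_parts`), which moves the derivative to the
test field. For the variation in a direction e, a log-concave function on a line rises to its
maximum and then falls, so its variation, jumps at the end points included, is twice its maximum. By
Fubini the directional variation is twice the integral of the maxima over the lines parallel to e
(`IsLogConc.lintegral_variation`). These maxima converge, and averaging over e turns directional
variations into the total one.

The link between the boundary and the lines is the projection formula `Frame.boundaryFlux_eq_map`.
It rests on the almost everywhere uniqueness of normals and on comparing small pieces of the
boundary with hyperplanes. -/

/-! ### Log-concave functions and hypo-convergence -/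

/-- An upper semicontinuous, log-concave, integrable function with positive integral. -/
structure IsLogConc {n : ℕ} (f : Rn n → ℝ) : Prop where
  nonneg : ∀ x, 0 ≤ f x
  usc : UpperSemicontinuous f
  convexOn : ConvexOn ℝ {x | 0 < f x} (fun x => -Real.log (f x))
  integrable : Integrable f
  integral_pos : 0 < ∫ x, f x

/-- Epi-convergence of `-log fk` to `-log f`, expressed through the functions themselves. -/
structure HypoTendsto {n : ℕ} (fk : ℕ → Rn n → ℝ) (f : Rn n → ℝ) : Prop where
  upper : ∀ (x : Rn n) (xk : ℕ → Rn n), Tendsto xk atTop (𝓝 x) →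
    ∀ y, 0 < y → f x < y → ∀ᶠ k in atTop, fk k (xk k) < y
  lower : ∀ x : Rn n, ∃ xk : ℕ → Rn n, Tendsto xk atTop (𝓝 x) ∧
    ∀ y, 0 < y → y < f x → ∀ᶠ k in atTop, y < fk k (xk k)

theorem toReal_exp_neg_lt_iff {a : EReal} (ha : a ≠ ⊥) {y : ℝ} (hy : 0 < y) :
    (EReal.exp (-a)).toReal < y ↔ ((-Real.log y : ℝ) : EReal) < a := by
  induction a with
  | bot => exact absurd rfl ha
  | top => simpa [hy] using EReal.coe_lt_top (-Real.log y)
  | coe r =>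
    rw [← EReal.coe_neg, EReal.exp_coe, ENNReal.toReal_ofReal (Real.exp_pos _).le,
      EReal.coe_lt_coe_iff, neg_lt, Real.lt_log_iff_exp_lt hy]

theorem toReal_exp_neg_pos_iff {a : EReal} (ha : a ≠ ⊥) {r : ℝ} :
    0 < (EReal.exp (-a)).toReal ∧ -Real.log ((EReal.exp (-a)).toReal) ≤ r ↔ a ≤ r := by
  induction a with
  | bot => exact absurd rfl ha
  | top => simp
  | coe s =>
    rw [← EReal.coe_neg, EReal.exp_coe, ENNReal.toReal_ofReal (Real.exp_pos _).le,
      Real.log_exp, EReal.coe_le_coe_iff, neg_neg]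
    simp [Real.exp_pos]

theorem isLogConc_of_mem_LC {n : ℕ} {f : Rn n → ℝ} (hf : f ∈ LC n) : IsLogConc f := by
  obtain ⟨φ, hφ, hfφ⟩ := hf
  have hfun : f = fun x => (EReal.exp (-φ x)).toReal := funext hfφ
  have hm : Measurable fun x => EReal.exp (-φ x) :=
    EReal.measurable_exp.comp hφ.lowerSemicontinuous.measurable.neg
  have hfin : ∀ x, EReal.exp (-φ x) < ⊤ := by
    intro x
    have := hφ.ne_bot x
    induction h : φ x with
    | bot => exact absurd h this
    | top => simp
    | coe r => rw [← EReal.coe_neg, EReal.exp_coe]; exact ENNReal.ofReal_lt_top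
  refine ⟨fun x => ?_, fun x y hy => ?_, ?_, ?_, ?_⟩
  · rw [hfφ]; exact ENNReal.toReal_nonneg
  · have hy0 : 0 < y := lt_of_le_of_lt (by rw [hfφ]; exact ENNReal.toReal_nonneg) hy
    replace hy : f x < y := hy
    rw [hfφ, toReal_exp_neg_lt_iff (hφ.ne_bot _) hy0] at hy
    filter_upwards [hφ.lowerSemicontinuous x _ hy] with z hz
    change f z < y
    rwa [hfφ, toReal_exp_neg_lt_iff (hφ.ne_bot _) hy0]
  · rw [convexOn_iff_convex_epigraph]
    convert hφ.convex_epigraph using 1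
    ext p
    simp only [Set.mem_ofPred_eq, hfφ]
    exact toReal_exp_neg_pos_iff (hφ.ne_bot _)
  · rw [hfun]
    exact integrable_toReal_of_lintegral_ne_top hm.aemeasurable hφ.integral_lt_top.ne
  · rw [hfun, integral_toReal hm.aemeasurable (ae_of_all _ hfin)]
    exact ENNReal.toReal_pos hφ.integral_pos.ne' hφ.integral_lt_top.ne

theorem lt_negLog_iff {n : ℕ} {f : Rn n → ℝ} {x : Rn n} {y : ℝ} (hy : 0 < y) :
    ((-Real.log y : ℝ) : EReal) < negLog f x ↔ f x < y := by
  have : ((-Real.log y : ℝ) : EReal) = -ENNReal.log (ENNReal.ofReal y) := by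
    rw [ENNReal.log_ofReal, if_neg hy.not_ge, EReal.coe_neg]
  rw [this, negLog, EReal.neg_lt_neg_iff, ENNReal.log_lt_log_iff, ENNReal.ofReal_lt_ofReal_iff hy]

theorem negLog_lt_iff {n : ℕ} {f : Rn n → ℝ} {x : Rn n} {y : ℝ} (hy : 0 < y) :
    negLog f x < ((-Real.log y : ℝ) : EReal) ↔ y < f x := by
  have : ((-Real.log y : ℝ) : EReal) = -ENNReal.log (ENNReal.ofReal y) := by
    rw [ENNReal.log_ofReal, if_neg hy.not_ge, EReal.coe_neg]
  rw [this, negLog, EReal.neg_lt_neg_iff, ENNReal.log_lt_log_iff,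
    ENNReal.ofReal_lt_ofReal_iff_of_nonneg hy.le]

theorem EpiTendsto.hypoTendsto {n : ℕ} {fk : ℕ → Rn n → ℝ} {f : Rn n → ℝ}
    (h : EpiTendsto (fun k => negLog (fk k)) (negLog f)) : HypoTendsto fk f := by
  refine ⟨fun x xk hxk y hy hfy => ?_, fun x => ?_⟩
  · filter_upwards [eventually_lt_of_lt_liminf (((lt_negLog_iff hy).2 hfy).trans_le (h.1 x xk hxk))]
      with k hk
    exact (lt_negLog_iff hy).1 hk
  · obtain ⟨xk, hxk, hle⟩ := h.2 x
    refine ⟨xk, hxk, fun y hy hfy => ?_⟩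
    filter_upwards [eventually_lt_of_limsup_lt (hle.trans_lt ((negLog_lt_iff hy).2 hfy))] with k hk
    exact (negLog_lt_iff hy).1 hk

/-- Lets bounds for a single function be read off from bounds for sequences. -/
theorem IsLogConc.hypoTendsto_const {n : ℕ} {f : Rn n → ℝ} (hf : IsLogConc f) :
    HypoTendsto (fun _ => f) f :=
  ⟨fun x _ hxk y _ hy => hxk.eventually (hf.usc x y hy),
    fun x => ⟨fun _ => x, tendsto_const_nhds, fun _ _ hy => Eventually.of_forall fun _ => hy⟩⟩

/-! ### Superlevel sets, and regularity inside the support -/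

section basics
variable {n : ℕ} {f : Rn n → ℝ}

/-- The rpow form of log-concavity. -/
theorem IsLogConc.log_concave (hf : IsLogConc f) {x y : Rn n} (hx : 0 < f x) (hy : 0 < f y)
    {a b : ℝ} (ha : 0 ≤ a) (hb : 0 ≤ b) (hab : a + b = 1) :
    0 < f (a • x + b • y) ∧
      a * Real.log (f x) + b * Real.log (f y) ≤ Real.log (f (a • x + b • y)) := by
  have h1 := hf.convexOn.1 hx hy ha hb hab
  have h2 := hf.convexOn.2 hx hy ha hb hab
  refine ⟨h1, ?_⟩
  simp only [smul_eq_mul] at h2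
  linarith

theorem IsLogConc.convex_superlevel (hf : IsLogConc f) {c : ℝ} (hc : 0 < c) :
    Convex ℝ {x | c ≤ f x} := by
  intro x hx y hy a b ha hb hab
  have hx0 : 0 < f x := hc.trans_le hx
  have hy0 : 0 < f y := hc.trans_le hy
  obtain ⟨h1, h2⟩ := hf.log_concave hx0 hy0 ha hb hab
  have h3 := Real.log_le_log hc hx
  have h4 := Real.log_le_log hc hy
  refine (Real.log_le_log_iff hc h1).1 (le_trans ?_ h2)
  calc Real.log c = a * Real.log c + b * Real.log c := by rw [← add_mul, hab, one_mul]
    _ ≤ _ := by gcongr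

theorem IsLogConc.convex_pos (hf : IsLogConc f) : Convex ℝ {x | 0 < f x} := hf.convexOn.1

theorem IsLogConc.measurable (hf : IsLogConc f) : Measurable f := hf.usc.measurable

/-- A convex set without interior lies in its own frontier, which is Lebesgue null; the integral of
f would then vanish. -/
theorem IsLogConc.interior_nonempty (hf : IsLogConc f) : (interior {x | 0 < f x}).Nonempty := by
  by_contra h
  rw [Set.not_nonempty_iff_eq_empty] at h
  have h0 : volume {x | 0 < f x} = 0 := by
    refine measure_mono_null ?_ (hf.convex_pos.addHaar_frontier volume)
    intro x hx
    exact ⟨subset_closure hx, by simp [h]⟩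
  have : ∫ x, f x = 0 := by
    apply integral_eq_zero_of_ae
    rw [Filter.EventuallyEq, ae_iff]
    refine measure_mono_null (fun x hx => ?_) h0
    exact lt_of_le_of_ne (hf.nonneg x) (Ne.symm hx)
  exact hf.integral_pos.ne' this

theorem isClosed_supp (f : Rn n → ℝ) : IsClosed (supp f) := isClosed_closure

theorem IsLogConc.convex_supp (hf : IsLogConc f) : Convex ℝ (supp f) := hf.convex_pos.closure

theorem IsLogConc.interior_supp (hf : IsLogConc f) : interior (supp f) = interior {x | 0 < f x} :=
  hf.convex_pos.interior_closure_eq_interior_of_nonempty_interior hf.interior_nonempty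

theorem IsLogConc.interior_supp_nonempty (hf : IsLogConc f) : (interior (supp f)).Nonempty :=
  hf.interior_supp ▸ hf.interior_nonempty

theorem IsLogConc.pos_of_mem_interior (hf : IsLogConc f) {x : Rn n} (hx : x ∈ interior (supp f)) :
    0 < f x := by
  rw [hf.interior_supp] at hx
  have : x ∈ {x | 0 < f x} := interior_subset hx
  exact this

theorem IsLogConc.eq_zero_of_notMem (hf : IsLogConc f) {x : Rn n} (hx : x ∉ supp f) :
    f x = 0 := by
  by_contra h
  exact hx (subset_closure (lt_of_le_of_ne (hf.nonneg x) (Ne.symm h)))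

theorem IsLogConc.continuousOn_negLog (hf : IsLogConc f) :
    ContinuousOn (fun x => -Real.log (f x)) (interior (supp f)) := by
  rw [hf.interior_supp]
  exact hf.convexOn.continuousOn_interior

theorem IsLogConc.continuousOn (hf : IsLogConc f) : ContinuousOn f (interior (supp f)) := by
  refine (Real.continuous_exp.comp_continuousOn hf.continuousOn_negLog.neg).congr fun x hx => ?_
  simp [Real.exp_log (hf.pos_of_mem_interior hx)]

theorem IsLogConc.continuousAt (hf : IsLogConc f) {x : Rn n} (hx : x ∈ interior (supp f)) :
    ContinuousAt f x :=
  hf.continuousOn.continuousAt (isOpen_interior.mem_nhds hx)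

/-- Averaging the ball with a far point of C gives a ball of half the radius in C, arbitrarily far
out. If C had finite volume, its part outside large balls would have volume tending to zero, which
leaves no room for these balls. -/
theorem Convex.measure_eq_top_of_not_isBounded {C : Set (Rn n)} (hC : Convex ℝ C) {x₀ : Rn n}
    {r : ℝ} (hr : 0 < r) (hball : Metric.ball x₀ r ⊆ C) (hb : ¬ Bornology.IsBounded C) :
    volume C = ⊤ := by
  by_contra hfin
  set s : ℕ → Set (Rn n) := fun N => C \ Metric.closedBall 0 N with hs
  have hanti : Antitone s := fun i j hij =>
    Set.sdiff_subset_sdiff_right (Metric.closedBall_subset_closedBall (by exact_mod_cast hij))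
  have hnull : ∀ N, NullMeasurableSet (s N) :=
    fun N => (hC.nullMeasurableSet volume).diff Metric.isClosed_closedBall.nullMeasurableSet
  have hfin' : volume (s 0) ≠ ⊤ :=
    ne_top_of_le_ne_top hfin (measure_mono Set.sdiff_subset)
  have hlim := tendsto_measure_iInter_atTop hnull hanti ⟨0, hfin'⟩
  have hempty : ⋂ N, s N = ∅ := by
    rw [Set.eq_empty_iff_forall_notMem]
    intro x hx
    obtain ⟨N, hN⟩ := exists_nat_ge ‖x‖
    exact (Set.mem_iInter.1 hx N).2 (by simpa using hN)
  rw [hempty, measure_empty] at hlim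
  have hv : 0 < volume (Metric.ball (0 : Rn n) (r / 2)) := Metric.measure_ball_pos _ _ (by positivity)
  obtain ⟨N, hN⟩ := (hlim.eventually (gt_mem_nhds hv)).exists
  refine absurd hN (not_lt.2 ?_)
  -- The threshold makes every point within r/2 of the midpoint of x₀ and x have norm greater than
  -- N.
  have : ∃ x ∈ C, 2 * (N + r) + ‖x₀‖ < ‖x‖ := by
    by_contra! h
    exact hb (isBounded_iff_forall_norm_le.2 ⟨_, h⟩)
  obtain ⟨x, hxC, hx⟩ := this
  have hsub : Metric.ball ((1 / 2 : ℝ) • (x₀ + x)) (r / 2) ⊆ s N := by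
    intro z hz
    rw [mem_ball_iff_norm] at hz
    refine ⟨?_, ?_⟩
    · have h1 : (2 : ℝ) • z - x ∈ C := by
        apply hball
        rw [mem_ball_iff_norm]
        have : (2 : ℝ) • z - x - x₀ = (2 : ℝ) • (z - (1 / 2 : ℝ) • (x₀ + x)) := by module
        rw [this, norm_smul]
        rw [Real.norm_ofNat]
        linarith
      have := hC h1 hxC (a := 1 / 2) (b := 1 / 2) (by norm_num) (by norm_num) (by norm_num)
      convert this using 1
      module
    · simp only [Metric.mem_closedBall, dist_zero_right, not_le]
      have h1 : x = (2 : ℝ) • z - x₀ - (2 : ℝ) • (z - (1 / 2 : ℝ) • (x₀ + x)) := by module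
      have h2 : ‖x‖ ≤ 2 * ‖z‖ + ‖x₀‖ + 2 * ‖z - (1 / 2 : ℝ) • (x₀ + x)‖ := by
        conv_lhs => rw [h1]
        refine (norm_sub_le _ _).trans (add_le_add ((norm_sub_le _ _).trans ?_) ?_)
        · rw [norm_smul]; norm_num
        · rw [norm_smul]; norm_num
      linarith
  calc volume (Metric.ball (0 : Rn n) (r / 2))
      = volume (Metric.ball ((1 / 2 : ℝ) • (x₀ + x)) (r / 2)) :=
        (Measure.addHaar_ball_center _ _ _).symm
    _ ≤ _ := measure_mono hsub

/-- Lowering the level makes the superlevel set contain a ball; it is convex, and of finite volume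
by integrability, hence bounded. -/
theorem IsLogConc.isBounded_superlevel (hf : IsLogConc f) {c : ℝ} (hc : 0 < c) :
    Bornology.IsBounded {x | c ≤ f x} := by
  obtain ⟨x₀, hx₀⟩ := hf.interior_supp_nonempty
  have hpos := hf.pos_of_mem_interior hx₀
  have hev : ∀ᶠ x in 𝓝 x₀, f x₀ / 2 < f x := (hf.continuousAt hx₀).eventually_const_lt (by linarith)
  obtain ⟨r, hr, hball⟩ := Metric.eventually_nhds_iff_ball.1 hev
  have hc' : 0 < min c (f x₀ / 2) := lt_min hc (by linarith)
  have hb : Bornology.IsBounded {x | min c (f x₀ / 2) ≤ f x} := by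
    by_contra hb
    have htop := (hf.convex_superlevel hc').measure_eq_top_of_not_isBounded hr
      (fun x hx => (min_le_right _ _).trans (hball x hx).le) hb
    have := hf.integrable.measure_norm_ge_lt_top hc'
    refine absurd htop (ne_of_lt (lt_of_le_of_lt (measure_mono fun x hx => ?_) this))
    exact le_trans (Set.mem_ofPred.1 hx) (le_abs_self _)
  exact hb.subset fun x hx => (min_le_left _ _).trans (Set.mem_ofPred.1 hx)
end basics

/-! ### Uniform exponential decay and pointwise convergence -/

section convergence
variable {n : ℕ} {f : Rn n → ℝ} {fk : ℕ → Rn n → ℝ}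

/-- If this failed, points violating the bound would converge to x along a subsequence, against the
upper condition. -/
theorem HypoTendsto.eventually_nhds_lt (h : HypoTendsto fk f) {x : Rn n} {y : ℝ} (hy : 0 < y)
    (hx : f x < y) : ∃ r > 0, ∀ᶠ k in atTop, ∀ z ∈ Metric.ball x r, fk k z < y := by
  by_contra! hcon
  have hfreq : ∀ j : ℕ, ∃ᶠ k in atTop, ∃ z ∈ Metric.ball x (1 / ((j : ℝ) + 1)), y ≤ fk k z := by
    intro j
    exact hcon (1 / ((j : ℝ) + 1)) (by positivity)
  obtain ⟨ψ, hψ, hz⟩ := extraction_forall_of_frequently hfreq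
  choose z hzb hzy using hz
  -- The upper condition speaks of full sequences, so the remaining indices are filled with x
  -- itself.
  have hlim : Tendsto (Function.extend ψ z fun _ => x) atTop (𝓝 x) := by
    rw [Metric.tendsto_atTop]
    intro ε hε
    obtain ⟨N, hN⟩ := exists_nat_one_div_lt hε
    refine ⟨ψ N, fun k hk => ?_⟩
    by_cases hex : ∃ j, ψ j = k
    · obtain ⟨j, rfl⟩ := hex
      rw [hψ.injective.extend_apply]
      have hj : N ≤ j := hψ.le_iff_le.1 hk
      refine (Metric.mem_ball.1 (hzb j)).trans (lt_of_le_of_lt ?_ hN)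
      gcongr
    · rw [Function.extend_apply' _ _ _ hex, dist_self]; exact hε
  have hev := h.upper x _ hlim y hy hx
  obtain ⟨j, hj⟩ := (hψ.tendsto_atTop.eventually hev).exists
  rw [hψ.injective.extend_apply] at hj
  exact absurd hj (not_lt.2 (hzy j))

theorem HypoTendsto.eventually_forall_lt (h : HypoTendsto fk f) {S : Set (Rn n)} (hS : IsCompact S)
    {y : ℝ} (hy : 0 < y) (hx : ∀ x ∈ S, f x < y) : ∀ᶠ k in atTop, ∀ z ∈ S, fk k z < y := by
  refine hS.induction_on (p := fun S => ∀ᶠ k in atTop, ∀ z ∈ S, fk k z < y) (by simp)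
    (fun s t hst ht => ?_) (fun s t hs ht => ?_) fun x hxS => ?_
  · filter_upwards [ht] with k hk z hz using hk z (hst hz)
  · filter_upwards [hs, ht] with k hk hk' z hz
    exact hz.elim (hk z) (hk' z)
  · obtain ⟨r, hr, hev⟩ := h.eventually_nhds_lt hy (hx x hxS)
    exact ⟨_, mem_nhdsWithin_of_mem_nhds (Metric.ball_mem_nhds x hr), hev⟩

theorem exists_mem_segment_dist_eq {x₀ a b : Rn n} {R : ℝ} (ha : dist a x₀ ≤ R)
    (hb : R ≤ dist b x₀) : ∃ s ∈ Set.Icc (0 : ℝ) 1, dist ((1 - s) • a + s • b) x₀ = R := by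
  have hcont : ContinuousOn (fun s : ℝ => dist ((1 - s) • a + s • b) x₀) (Set.Icc 0 1) := by fun_prop
  have := intermediate_value_Icc (zero_le_one' ℝ) hcont
  simp only [sub_zero, one_smul, zero_smul, add_zero, sub_self, zero_add] at this
  obtain ⟨s, hs, hs'⟩ := this ⟨ha, hb⟩
  exact ⟨s, hs, hs'⟩

theorem IsLogConc.bddAbove (hf : IsLogConc f) {S : Set (Rn n)} (hS : IsCompact S) :
    ∃ M > 0, ∀ x ∈ S, f x < M := by
  rcases S.eq_empty_or_nonempty with rfl | hne
  · exact ⟨1, one_pos, by simp⟩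
  · obtain ⟨a, -, hmax⟩ := UpperSemicontinuousOn.exists_isMaxOn hne hS (hf.usc.upperSemicontinuousOn S)
    exact ⟨f a + 1, by linarith [hf.nonneg a], fun x hx => by linarith [hmax hx |> Set.mem_ofPred.1]⟩

/-- Hypo-converging log-concave functions have a common exponential upper bound. -/
theorem HypoTendsto.exists_exp_bound (h : HypoTendsto fk f) (hf : IsLogConc f)
    (hfk : ∀ k, IsLogConc (fk k)) :
    ∃ C > 0, ∃ a > 0, ∀ᶠ k in atTop, ∀ x, fk k x ≤ C * Real.exp (-(a * ‖x‖)) := by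
  obtain ⟨x₀, hx₀⟩ := hf.interior_supp_nonempty
  have hpos := hf.pos_of_mem_interior hx₀
  set c : ℝ := f x₀ / 2 with hc
  have hc0 : 0 < c := by positivity
  obtain ⟨xk, hxk, hlow⟩ := h.lower x₀
  have hev1 := hlow c hc0 (by linarith)
  obtain ⟨R₁, hR₁⟩ := (hf.isBounded_superlevel (c := c / 2) (by positivity)).subset_closedBall x₀
  set R : ℝ := max R₁ 0 + 1 with hR
  have hR0 : 0 < R := by positivity
  have hev2 : ∀ᶠ k in atTop, ∀ z ∈ Metric.sphere x₀ R, fk k z < c / 2 := by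
    refine h.eventually_forall_lt (isCompact_sphere _ _) (by positivity) fun x hx => ?_
    by_contra! hle
    have h1 := hR₁ (show x ∈ {x | c / 2 ≤ f x} from hle)
    rw [Metric.mem_closedBall] at h1
    rw [Metric.mem_sphere] at hx
    linarith [le_max_left R₁ 0]
  obtain ⟨M, hM0, hM⟩ := hf.bddAbove (isCompact_closedBall x₀ R)
  have hev3 := h.eventually_forall_lt (isCompact_closedBall x₀ R) hM0 hM
  have hev4 : ∀ᶠ k in atTop, dist (xk k) x₀ ≤ R :=
    (hxk.eventually (Metric.closedBall_mem_nhds x₀ hR0))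
  -- From `xk k`, where the value exceeds c, to the sphere of radius R, where it is below c/2, `log
  -- (fk k)` drops by at least log 2 over a distance of at most 2R. Concavity keeps at least this
  -- slope beyond the sphere.
  set a : ℝ := Real.log 2 / (2 * R) with ha
  have hlog2 : 0 < Real.log 2 := Real.log_pos (by norm_num)
  have ha0 : 0 < a := by positivity
  refine ⟨(M + c) * Real.exp (a * (‖x₀‖ + R)), by positivity, a, ha0, ?_⟩
  filter_upwards [hev1, hev2, hev3, hev4] with k h1 h2 h3 h4 x
  rw [mul_assoc, ← Real.exp_add]
  rcases le_or_gt (dist x x₀) R with hx | hx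
  · have hxn : ‖x‖ ≤ ‖x₀‖ + R := by
      have := norm_le_norm_add_norm_sub' x x₀
      rw [dist_eq_norm] at hx
      linarith
    calc fk k x ≤ M := (h3 x hx).le
      _ ≤ (M + c) * 1 := by linarith
      _ ≤ _ := by
        gcongr
        rw [Real.one_le_exp_iff]
        nlinarith
  · rcases (hfk k).nonneg x |>.eq_or_lt with h0 | h0
    · rw [← h0]; positivity
    obtain ⟨s, hs, hsR⟩ := exists_mem_segment_dist_eq h4 hx.le
    have hz := h2 _ hsR
    obtain ⟨hz0, hzlog⟩ := (hfk k).log_concave (hc0.trans h1) h0 (sub_nonneg.2 hs.2) hs.1 (by ring)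
    have hl1 : Real.log c < Real.log (fk k (xk k)) := Real.log_lt_log hc0 h1
    have hl2 : Real.log (fk k ((1 - s) • xk k + s • x)) < Real.log c - Real.log 2 := by
      rw [← Real.log_div hc0.ne' (by norm_num)]
      exact Real.log_lt_log hz0 hz
    have hs0 : 0 < s := by
      rcases hs.1.eq_or_lt with h' | h'
      · exfalso
        subst h'
        rw [show (1 - 0 : ℝ) • xk k + (0 : ℝ) • x = xk k by simp] at hl2
        linarith
      · exact h'
    have hdist : s * dist x (xk k) ≤ 2 * R := by
      have : s * dist x (xk k) = dist ((1 - s) • xk k + s • x) (xk k) := by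
        rw [dist_eq_norm, dist_eq_norm]
        have : (1 - s) • xk k + s • x - xk k = s • (x - xk k) := by module
        rw [this, norm_smul, Real.norm_of_nonneg hs.1]
      rw [this]
      have := dist_triangle_right ((1 - s) • xk k + s • x) (xk k) x₀
      linarith
    have hxn : ‖x‖ - ‖x₀‖ - R ≤ dist x (xk k) := by
      have e1 := norm_le_norm_add_norm_sub' x x₀
      have e2 := dist_triangle x (xk k) x₀
      rw [← dist_eq_norm] at e1
      linarith
    have key : Real.log (fk k x) ≤ Real.log c - a * dist x (xk k) := by
      have e1 : s * Real.log (fk k x) ≤ s * Real.log c - Real.log 2 := by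
        have := mul_le_mul_of_nonneg_left hl1.le (sub_nonneg.2 hs.2)
        linarith
      have e2 : s * (a * dist x (xk k)) ≤ Real.log 2 := by
        calc s * (a * dist x (xk k)) = a * (s * dist x (xk k)) := by ring
          _ ≤ a * (2 * R) := by gcongr
          _ = Real.log 2 := by rw [ha]; field_simp
      by_contra! hlt
      have := mul_lt_mul_of_pos_left hlt hs0
      linarith
    have key2 : Real.log (fk k x) ≤ Real.log c + (a * (‖x₀‖ + R) + -(a * ‖x‖)) := by
      have := mul_le_mul_of_nonneg_left hxn ha0.le
      linarith
    calc fk k x = Real.exp (Real.log (fk k x)) := (Real.exp_log h0).symm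
      _ ≤ Real.exp (Real.log c + (a * (‖x₀‖ + R) + -(a * ‖x‖))) := Real.exp_le_exp.2 key2
      _ = c * Real.exp (a * (‖x₀‖ + R) + -(a * ‖x‖)) := by rw [Real.exp_add, Real.exp_log hc0]
      _ ≤ _ := by gcongr; linarith

theorem IsLogConc.exists_exp_bound (hf : IsLogConc f) :
    ∃ C > 0, ∃ a > 0, ∀ x, f x ≤ C * Real.exp (-(a * ‖x‖)) := by
  obtain ⟨C, hC, a, ha, hev⟩ := hf.hypoTendsto_const.exists_exp_bound hf fun _ => hf
  obtain ⟨_, hk⟩ := hev.exists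
  exact ⟨C, hC, a, ha, hk⟩

/-- Otherwise a vector θ separates x strictly from all the points. Some coordinate satisfies |θ i| ≥
‖θ‖/n, and the vertex of the cross on the opposite side of that axis has product -δ|θ i| with θ,
which an error of size δ/n cannot make positive. -/
theorem mem_convexHull_of_near_cross [NeZero n] {x : Rn n} {δ : ℝ} {p : Fin n × Bool → Rn n}
    (hp : ∀ i b, ‖p (i, b) - (x + EuclideanSpace.single i (if b then δ else -δ))‖ ≤ δ / n)
    (hδ : 0 < δ) : x ∈ convexHull ℝ (Set.range p) := by
  by_contra hx
  obtain ⟨l, u, hlu, hl⟩ := geometric_hahn_banach_point_closed (convex_convexHull ℝ _)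
    ((Set.finite_range p).isClosed_convexHull ℝ) hx
  set θ : Rn n := (InnerProductSpace.toDual ℝ (Rn n)).symm l with hθ
  have hin : ∀ v, l v = inner ℝ θ v := fun v => by simp [hθ]
  have hlt : ∀ q, 0 < inner ℝ θ (p q - x) := by
    intro q
    have := hl _ (subset_convexHull ℝ _ (Set.mem_range_self q))
    rw [inner_sub_right, ← hin, ← hin]
    linarith
  have hn : (0 : ℝ) < n := by exact_mod_cast NeZero.pos n
  obtain ⟨i, hi⟩ : ∃ i, ‖θ‖ / n ≤ |θ i| := by
    by_contra! hall
    have h0 : (Finset.univ : Finset (Fin n)).Nonempty := Finset.univ_nonempty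
    have h1 : ‖θ‖ ≤ ∑ i, |θ i| := by
      have : θ = ∑ i, θ i • EuclideanSpace.single i (1 : ℝ) := by
        simpa using ((EuclideanSpace.basisFun (Fin n) ℝ).sum_repr θ).symm
      conv_lhs => rw [this]
      refine (norm_sum_le _ _).trans (Finset.sum_le_sum fun i _ => ?_)
      rw [norm_smul]; simp
    have h2 : ∑ i, |θ i| < ∑ _i : Fin n, ‖θ‖ / n := Finset.sum_lt_sum_of_nonempty h0 fun i _ => hall i
    rw [Finset.sum_const, Finset.card_univ, Fintype.card_fin, nsmul_eq_mul,
      mul_div_cancel₀ _ hn.ne'] at h2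
    linarith
  set b : Bool := decide (θ i < 0) with hb
  have hsgn : (if b then δ else -δ) * θ i = -(δ * |θ i|) := by
    by_cases h0 : θ i < 0
    · simp [hb, h0, abs_of_neg h0]
    · simp [hb, h0, abs_of_nonneg (not_lt.1 h0)]
  have h1 : inner ℝ θ (p (i, b) - x) =
      inner ℝ θ (p (i, b) - (x + EuclideanSpace.single i (if b then δ else -δ))) - δ * |θ i| := by
    have : p (i, b) - x = (p (i, b) - (x + EuclideanSpace.single i (if b then δ else -δ)))
        + EuclideanSpace.single i (if b then δ else -δ) := by abel
    rw [this, inner_add_right, EuclideanSpace.inner_single_right]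
    simp only [conj_trivial]
    rw [hsgn]
    ring
  have h2 := (real_inner_le_norm θ _).trans (mul_le_mul_of_nonneg_left (hp i b) (norm_nonneg θ))
  have h3 : ‖θ‖ * (δ / n) ≤ δ * |θ i| := by
    calc ‖θ‖ * (δ / n) = δ * (‖θ‖ / n) := by ring
      _ ≤ _ := by gcongr
  have := hlt (i, b)
  linarith

/-- Only the lower bound needs an argument. Recovery sequences at the vertices of a small cross
around x eventually have values above y', and their hull contains x; convexity of the superlevel set
transfers the bound to x. -/
theorem HypoTendsto.tendsto_of_mem_interior [NeZero n] (h : HypoTendsto fk f) (hf : IsLogConc f)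
    (hfk : ∀ k, IsLogConc (fk k)) {x : Rn n} (hx : x ∈ interior (supp f)) :
    Tendsto (fun k => fk k x) atTop (𝓝 (f x)) := by
  have hpos := hf.pos_of_mem_interior hx
  refine tendsto_order.2 ⟨fun y hy => ?_, fun y hy =>
    h.upper x (fun _ => x) tendsto_const_nhds y (hpos.trans hy) hy⟩
  obtain ⟨y', hyy', hy'⟩ := exists_between (max_lt hy hpos)
  have hy'0 : 0 < y' := (le_max_right _ _).trans_lt hyy'
  obtain ⟨r, hr, hball⟩ := Metric.eventually_nhds_iff_ball.1 ((hf.continuousAt hx).eventually_const_lt hy')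
  set δ := r / 2 with hδ
  have hδ0 : 0 < δ := by positivity
  have hn : (0 : ℝ) < n := by exact_mod_cast NeZero.pos n
  choose xk hxk hlow using h.lower
  set v : Fin n × Bool → Rn n := fun q => x + EuclideanSpace.single q.1 (if q.2 then δ else -δ) with hv
  have hvf : ∀ q, y' < f (v q) := by
    intro q
    apply hball
    rw [mem_ball_iff_norm, hv]
    simp only [add_sub_cancel_left, PiLp.norm_single]
    rcases q.2 <;> simp [abs_of_pos hδ0] <;> linarith
  have hev1 : ∀ᶠ k in atTop, ∀ q, y' < fk k (xk (v q) k) :=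
    eventually_all.2 fun q => hlow (v q) y' hy'0 (hvf q)
  have hev2 : ∀ᶠ k in atTop, ∀ q, dist (xk (v q) k) (v q) ≤ δ / n :=
    eventually_all.2 fun q => (hxk (v q)).eventually (Metric.closedBall_mem_nhds _ (by positivity))
  filter_upwards [hev1, hev2] with k h1 h2
  have hmem : x ∈ convexHull ℝ (Set.range fun q => xk (v q) k) :=
    mem_convexHull_of_near_cross (fun i b => by rw [← dist_eq_norm]; exact h2 (i, b)) hδ0
  have hsub : convexHull ℝ (Set.range fun q => xk (v q) k) ⊆ {z | y' ≤ fk k z} := by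
    refine convexHull_min ?_ ((hfk k).convex_superlevel hy'0)
    rintro _ ⟨q, rfl⟩
    exact (h1 q).le
  exact (le_max_left _ _).trans_lt (hyy'.trans_le (hsub hmem))

theorem HypoTendsto.tendsto_of_notMem (h : HypoTendsto fk f) (hf : IsLogConc f)
    (hfk : ∀ k, IsLogConc (fk k)) {x : Rn n} (hx : x ∉ supp f) :
    Tendsto (fun k => fk k x) atTop (𝓝 (f x)) := by
  have h0 := hf.eq_zero_of_notMem hx
  rw [h0]
  refine tendsto_order.2 ⟨fun y hy => Eventually.of_forall fun k => hy.trans_le ((hfk k).nonneg x),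
    fun y hy => h.upper x (fun _ => x) tendsto_const_nhds y hy (h0 ▸ hy)⟩

theorem HypoTendsto.ae_tendsto [NeZero n] (h : HypoTendsto fk f) (hf : IsLogConc f)
    (hfk : ∀ k, IsLogConc (fk k)) : ∀ᵐ x, Tendsto (fun k => fk k x) atTop (𝓝 (f x)) := by
  have : ∀ᵐ x, x ∉ frontier (supp f) := measure_eq_zero_iff_ae_notMem.1
    (hf.convex_supp.addHaar_frontier volume)
  filter_upwards [this] with x hx
  by_cases hx' : x ∈ interior (supp f)
  · exact h.tendsto_of_mem_interior hf hfk hx'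
  · exact h.tendsto_of_notMem hf hfk fun hK => hx ⟨subset_closure hK, hx'⟩

end convergence

/-! ### Almost everywhere convergence of gradients -/

theorem LocallyLipschitzOn.ae_differentiableAt {E F : Type*} [NormedAddCommGroup E]
    [NormedSpace ℝ E] [MeasurableSpace E] [BorelSpace E] [FiniteDimensional ℝ E]
    [NormedAddCommGroup F] [NormedSpace ℝ F] [FiniteDimensional ℝ F] (μ : Measure E)
    [μ.IsAddHaarMeasure] {U : Set E} (hU : IsOpen U) {g : E → F} (hg : LocallyLipschitzOn U g) :
    ∀ᵐ x ∂μ, x ∈ U → DifferentiableAt ℝ g x := by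
  rw [ae_iff]
  refine measure_null_of_locally_null _ fun x hx => ?_
  simp only [Classical.not_imp, Set.mem_ofPred_eq] at hx
  obtain ⟨K, t, ht, hK⟩ := hg hx.1
  rw [hU.nhdsWithin_eq hx.1] at ht
  refine ⟨interior t ∩ {a | ¬ (a ∈ U → DifferentiableAt ℝ g a)},
    Filter.inter_mem (mem_nhdsWithin_of_mem_nhds (interior_mem_nhds.2 ht)) self_mem_nhdsWithin, ?_⟩
  have := (hK.mono interior_subset).ae_differentiableWithinAt (μ := μ) isOpen_interior.measurableSet
  rw [ae_restrict_iff' isOpen_interior.measurableSet, ae_iff] at this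
  refine measure_mono_null (fun z hz => ?_) this
  simp only [Set.mem_inter_iff, Set.mem_ofPred_eq, Classical.not_imp] at hz ⊢
  exact ⟨hz.1, fun h => hz.2.2 (h.differentiableAt (isOpen_interior.mem_nhds hz.1))⟩

section
variable {n : ℕ} {f : Rn n → ℝ} {fk : ℕ → Rn n → ℝ}

theorem IsLogConc.ae_differentiableAt (hf : IsLogConc f) :
    ∀ᵐ x, x ∈ interior (supp f) → DifferentiableAt ℝ (fun x => -Real.log (f x)) x := by
  refine LocallyLipschitzOn.ae_differentiableAt volume isOpen_interior ?_
  rw [hf.interior_supp]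
  exact hf.convexOn.locallyLipschitzOn_interior

theorem ConvexOn.fderiv_le {D : Set (Rn n)} {φ : Rn n → ℝ} (h : ConvexOn ℝ D φ) {x v : Rn n}
    (hx : x ∈ D) (hv : x + v ∈ D) (hd : DifferentiableAt ℝ φ x) :
    fderiv ℝ φ x v ≤ φ (x + v) - φ x := by
  have hc := h.comp_affineMap (AffineMap.lineMap x (x + v) : ℝ →ᵃ[ℝ] Rn n)
  have hfun : (φ ∘ (AffineMap.lineMap x (x + v) : ℝ →ᵃ[ℝ] Rn n)) = fun t : ℝ => φ (x + t • v) := by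
    ext t
    simp [AffineMap.lineMap_apply, add_comm]
  rw [hfun] at hc
  have hd' : HasDerivAt (fun t : ℝ => φ (x + t • v)) (fderiv ℝ φ x v) 0 := by
    have h1 : HasDerivAt (fun t : ℝ => x + t • v) v 0 := by
      simpa using ((hasDerivAt_id (0 : ℝ)).smul_const v).const_add x
    have h2 : HasFDerivAt φ (fderiv ℝ φ x) (x + (0 : ℝ) • v) := by simpa using hd.hasFDerivAt
    exact h2.comp_hasDerivAt 0 h1
  have := hc.deriv_le_slope (x := 0) (y := 1) (by simpa using hx) (by simpa using hv) one_pos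
    hd'.differentiableAt
  rw [hd'.deriv] at this
  simpa [slope_def_field] using this

/-- A directional derivative of a convex function is at most the forward difference quotient. For a
fixed small step the quotients of `φk k` converge to that of φ, which is close to the derivative of
φ; this gives the upper bound. The lower bound is the upper bound in direction -v. -/
theorem tendsto_fderiv_of_convexOn {D : ℕ → Set (Rn n)} {φk : ℕ → Rn n → ℝ} {φ : Rn n → ℝ}
    {x : Rn n} (h : ∀ k, ConvexOn ℝ (D k) (φk k))
    (hD : ∀ᶠ z in 𝓝 x, (∀ᶠ k in atTop, z ∈ D k) ∧ Tendsto (fun k => φk k z) atTop (𝓝 (φ z)))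
    (hdk : ∀ k, x ∈ interior (D k) → DifferentiableAt ℝ (φk k) x)
    (hint : ∀ᶠ k in atTop, x ∈ interior (D k)) (hd : DifferentiableAt ℝ φ x) (v : Rn n) :
    Tendsto (fun k => fderiv ℝ (φk k) x v) atTop (𝓝 (fderiv ℝ φ x v)) := by
  have key : ∀ v : Rn n, ∀ y, fderiv ℝ φ x v < y → ∀ᶠ k in atTop, fderiv ℝ (φk k) x v < y := by
    intro v y hy
    have hline : HasDerivAt (fun t : ℝ => φ (x + t • v)) (fderiv ℝ φ x v) 0 := by
      have h1 : HasDerivAt (fun t : ℝ => x + t • v) v 0 := by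
        simpa using ((hasDerivAt_id (0 : ℝ)).smul_const v).const_add x
      have h2 : HasFDerivAt φ (fderiv ℝ φ x) (x + (0 : ℝ) • v) := by simpa using hd.hasFDerivAt
      exact h2.comp_hasDerivAt 0 h1
    have hs := hline.tendsto_slope_zero_right
    simp only [zero_add, zero_smul, add_zero] at hs
    have e1 := hs.eventually (gt_mem_nhds hy)
    have hc : Tendsto (fun t : ℝ => x + t • v) (𝓝[>] 0) (𝓝 x) := by
      have : Tendsto (fun t : ℝ => x + t • v) (𝓝 0) (𝓝 (x + (0 : ℝ) • v)) :=
        Continuous.tendsto (by fun_prop) 0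
      simpa using this.mono_left nhdsWithin_le_nhds
    obtain ⟨t, ⟨ht1, ht2, ht3⟩, ht0⟩ :=
      ((e1.and (hc.eventually hD)).and self_mem_nhdsWithin).exists
    have ht0 : 0 < t := ht0
    have hx := hD.self_of_nhds
    have hlim : Tendsto (fun k => t⁻¹ • (φk k (x + t • v) - φk k x)) atTop
        (𝓝 (t⁻¹ • (φ (x + t • v) - φ x))) := (ht3.sub hx.2).const_smul _
    filter_upwards [hlim.eventually (gt_mem_nhds ht1), ht2, hx.1, hint] with k h1 h2 h3 h4
    have h5 := (h k).fderiv_le h3 h2 (hdk k h4)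
    rw [map_smul, smul_eq_mul] at h5
    rw [smul_eq_mul] at h1
    refine lt_of_le_of_lt ?_ h1
    rw [inv_mul_eq_div, le_div_iff₀ ht0]
    linarith
  refine tendsto_order.2 ⟨fun y hy => ?_, key v⟩
  filter_upwards [key (-v) (-y) (by rw [map_neg]; linarith)] with k hk
  rw [map_neg] at hk
  linarith

theorem inner_gradient (φ : Rn n → ℝ) (x v : Rn n) : inner ℝ (gradient φ x) v = fderiv ℝ φ x v := by
  simp [gradient]

theorem measurable_gradient (φ : Rn n → ℝ) : Measurable (gradient φ) :=
  (InnerProductSpace.toDual ℝ (Rn n)).symm.continuous.measurable.comp (measurable_fderiv ℝ φ)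

theorem Rn.tendsto_of_inner {α : Type*} {l : Filter α} {u : α → Rn n} {w : Rn n}
    (h : ∀ v, Tendsto (fun a => inner ℝ (u a) v) l (𝓝 (inner ℝ w v))) : Tendsto u l (𝓝 w) := by
  have : ∀ z : Rn n, z = ∑ i, (inner ℝ z (EuclideanSpace.single i (1 : ℝ))) •
      (EuclideanSpace.single i (1 : ℝ) : Rn n) := by
    intro z
    simpa [EuclideanSpace.inner_single_right] using
      ((EuclideanSpace.basisFun (Fin n) ℝ).sum_repr z).symm
  rw [this w, show u = fun a => ∑ i, (inner ℝ (u a) (EuclideanSpace.single i (1 : ℝ))) •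
      (EuclideanSpace.single i (1 : ℝ) : Rn n) from funext fun a => this (u a)]
  exact tendsto_finsetSum _ fun i _ => (h _).smul_const _

/-- Convergence of the gradients at almost every interior point. -/
theorem HypoTendsto.ae_tendsto_gradient [NeZero n] (h : HypoTendsto fk f) (hf : IsLogConc f)
    (hfk : ∀ k, IsLogConc (fk k)) :
    ∀ᵐ x, x ∈ interior (supp f) → Tendsto (fun k => gradient (fun x => -Real.log (fk k x)) x) atTop
      (𝓝 (gradient (fun x => -Real.log (f x)) x)) := by
  filter_upwards [hf.ae_differentiableAt, ae_all_iff.2 fun k => (hfk k).ae_differentiableAt,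
    ae_all_iff.2 fun k => measure_eq_zero_iff_ae_notMem.1
      ((hfk k).convex_supp.addHaar_frontier volume)] with x hd hdk hfr hx
  have hpos : ∀ z ∈ interior (supp f), ∀ᶠ k in atTop, 0 < fk k z := fun z hz =>
    (h.tendsto_of_mem_interior hf hfk hz).eventually (lt_mem_nhds (hf.pos_of_mem_interior hz))
  refine Rn.tendsto_of_inner fun v => ?_
  simp only [inner_gradient]
  refine tendsto_fderiv_of_convexOn (fun k => (hfk k).convexOn) ?_ (fun k hk => ?_) ?_ (hd hx) v
  · filter_upwards [isOpen_interior.mem_nhds hx] with z hz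
    refine ⟨hpos z hz, ?_⟩
    exact ((h.tendsto_of_mem_interior hf hfk hz).log (hf.pos_of_mem_interior hz).ne').neg
  · exact hdk k ((hfk k).interior_supp ▸ hk)
  · filter_upwards [hpos x hx] with k hk
    rw [← (hfk k).interior_supp]
    by_contra hno
    exact hfr k ⟨subset_closure (subset_closure hk), hno⟩

end

/-! ### Outer normals of convex sets: measurability and almost everywhere uniqueness -/

section normals
variable {n : ℕ} {K : Set (Rn n)}

theorem closure_interior_eq_of_convex (hKc : IsClosed K) (hK : Convex ℝ K)
    (hint : (interior K).Nonempty) : closure (interior K) = K := by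
  rw [hK.closure_interior_eq_closure_of_nonempty_interior hint, hKc.closure_eq]

/-- A nonzero linear functional that is maximal on `K` at `x` gives an outer unit normal. -/
theorem exists_isOuterUnitNormal_of_functional {x : Rn n} {l : Rn n →L[ℝ] ℝ} (hl : l ≠ 0)
    (hmax : ∀ y ∈ K, l y ≤ l x) :
    ∃ θ : UnitSphere n, IsOuterUnitNormal K x θ ∧ ∃ c > 0, ∀ v, l v = c * inner ℝ v (θ : Rn n) := by
  set w : Rn n := (InnerProductSpace.toDual ℝ (Rn n)).symm l with hw
  have hin : ∀ v, l v = inner ℝ v w := fun v => by rw [real_inner_comm]; simp [hw]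
  have hw0 : w ≠ 0 := by simpa [hw] using hl
  have hn : 0 < ‖w‖ := norm_pos_iff.2 hw0
  have hv : ∀ v, l v = ‖w‖ * inner ℝ v (‖w‖⁻¹ • w) := fun v => by
    rw [inner_smul_right, hin, mul_inv_cancel_left₀ hn.ne']
  refine ⟨⟨‖w‖⁻¹ • w, by simp [norm_smul, hn.ne']⟩, fun y hy => ?_, ‖w‖, hn, hv⟩
  have h1 := hmax y hy
  have h2 := hv (y - x)
  rw [map_sub] at h2
  by_contra! hlt
  have := mul_pos hn hlt
  linarith

theorem exists_isOuterUnitNormal (hKc : IsClosed K) (hK : Convex ℝ K)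
    (hint : (interior K).Nonempty) {x : Rn n} (hx : x ∈ frontier K) :
    ∃ θ : UnitSphere n, IsOuterUnitNormal K x θ := by
  obtain ⟨l, hl⟩ := geometric_hahn_banach_open_point hK.interior isOpen_interior hx.2
  obtain ⟨a, ha⟩ := hint
  have hl0 : l ≠ 0 := by
    rintro rfl
    simpa using hl a ha
  have hsub : K ⊆ {y | l y ≤ l x} := by
    rw [← closure_interior_eq_of_convex hKc hK ⟨a, ha⟩]
    exact closure_minimal (fun y hy => (hl y hy).le) (isClosed_le l.continuous continuous_const)
  obtain ⟨θ, hθ, -⟩ := exists_isOuterUnitNormal_of_functional hl0 hsub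
  exact ⟨θ, hθ⟩

/-- The points at which the outer unit normal exists and is unique. -/
def uniqueNormalSet (K : Set (Rn n)) : Set (Rn n) := {x | ∃! θ : UnitSphere n, IsOuterUnitNormal K x θ}

theorem gaussMap_spec [NeZero n] {x : Rn n} (hx : x ∈ uniqueNormalSet K) :
    IsOuterUnitNormal K x (gaussMap K x) ∧
      ∀ θ : UnitSphere n, IsOuterUnitNormal K x θ → θ = gaussMap K x := by
  have hx' : ∃! θ : UnitSphere n, IsOuterUnitNormal K x θ := hx
  have : gaussMap K x = hx'.choose := by rw [gaussMap, dif_pos hx']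
  rw [this]
  exact hx'.choose_spec

theorem isClosed_setOf_isOuterUnitNormal :
    IsClosed {p : Rn n × UnitSphere n | IsOuterUnitNormal K p.1 p.2} := by
  have : {p : Rn n × UnitSphere n | IsOuterUnitNormal K p.1 p.2} =
      ⋂ y ∈ K, {p | inner ℝ (y - p.1) (p.2 : Rn n) ≤ 0} := by
    ext p
    simp [IsOuterUnitNormal]
  rw [this]
  refine isClosed_biInter fun y _ => isClosed_le ?_ continuous_const
  fun_prop

/-- The normal relation is closed, and projecting along the compact sphere preserves closedness. -/
theorem isClosed_setOf_exists_normal_mem {F : Set (UnitSphere n)} (hF : IsClosed F) :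
    IsClosed {x : Rn n | ∃ θ ∈ F, IsOuterUnitNormal K x θ} := by
  have h := isClosedMap_fst_of_compactSpace (X := Rn n) (Y := UnitSphere n) _
    ((isClosed_setOf_isOuterUnitNormal (K := K)).inter (hF.preimage continuous_snd))
  convert h using 1
  ext x
  simp only [Set.mem_ofPred_eq, Set.mem_image, Set.mem_inter_iff, Set.mem_preimage]
  constructor
  · rintro ⟨θ, h1, h2⟩
    exact ⟨(x, θ), ⟨h2, h1⟩, rfl⟩
  · rintro ⟨⟨_, θ⟩, ⟨h1, h2⟩, rfl⟩
    exact ⟨θ, h2, h1⟩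

/-- Non-uniqueness means two normals at distance at least 1/(m+1) for some m. For each m this is a
closed condition on x, again by compactness of the sphere. -/
theorem measurableSet_uniqueNormalSet (K : Set (Rn n)) : MeasurableSet (uniqueNormalSet K) := by
  have hcl : ∀ m : ℕ, IsClosed {x : Rn n | ∃ θ θ' : UnitSphere n, IsOuterUnitNormal K x θ ∧
      IsOuterUnitNormal K x θ' ∧ 1 / ((m : ℝ) + 1) ≤ dist θ θ'} := by
    intro m
    have h := isClosedMap_fst_of_compactSpace (X := Rn n) (Y := UnitSphere n × UnitSphere n) _
      (((isClosed_setOf_isOuterUnitNormal (K := K)).preimage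
        (f := fun p : Rn n × UnitSphere n × UnitSphere n => (p.1, p.2.1)) (by fun_prop)).inter
        (((isClosed_setOf_isOuterUnitNormal (K := K)).preimage
        (f := fun p : Rn n × UnitSphere n × UnitSphere n => (p.1, p.2.2)) (by fun_prop)).inter
        (isClosed_le (f := fun _ : Rn n × UnitSphere n × UnitSphere n => 1 / ((m : ℝ) + 1))
          (g := fun p => dist p.2.1 p.2.2) continuous_const (by fun_prop))))
    convert h using 1
    ext x
    simp only [Set.mem_ofPred_eq, Set.mem_image, Set.mem_inter_iff, Set.mem_preimage]
    constructor
    · rintro ⟨θ, θ', h1, h2, h3⟩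
      exact ⟨(x, θ, θ'), ⟨h1, h2, h3⟩, rfl⟩
    · rintro ⟨⟨_, θ, θ'⟩, ⟨h1, h2, h3⟩, rfl⟩
      exact ⟨θ, θ', h1, h2, h3⟩
  have : uniqueNormalSet K = {x : Rn n | ∃ θ ∈ (Set.univ : Set (UnitSphere n)),
      IsOuterUnitNormal K x θ} \ ⋃ m : ℕ, {x : Rn n | ∃ θ θ' : UnitSphere n,
      IsOuterUnitNormal K x θ ∧ IsOuterUnitNormal K x θ' ∧ 1 / ((m : ℝ) + 1) ≤ dist θ θ'} := by
    ext x
    simp only [uniqueNormalSet, Set.mem_ofPred_eq, Set.mem_sdiff, Set.mem_iUnion, Set.mem_univ,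
      true_and]
    constructor
    · rintro ⟨θ, h1, h2⟩
      refine ⟨⟨θ, h1⟩, ?_⟩
      rintro ⟨m, θ', θ'', h3, h4, h5⟩
      rw [h2 θ' h3, h2 θ'' h4, dist_self] at h5
      have : 0 < 1 / ((m : ℝ) + 1) := by positivity
      linarith
    · rintro ⟨⟨θ, h1⟩, h2⟩
      refine ⟨θ, h1, fun θ' h3 => ?_⟩
      by_contra hne
      obtain ⟨m, hm⟩ := exists_nat_one_div_lt (dist_pos.2 hne)
      exact h2 ⟨m, θ', θ, h3, h1, hm.le⟩
  rw [this]
  exact (isClosed_setOf_exists_normal_mem isClosed_univ).measurableSet.diff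
    (MeasurableSet.iUnion fun m => (hcl m).measurableSet)

theorem measurable_gaussMap [NeZero n] (K : Set (Rn n)) : Measurable (gaussMap K) := by
  refine measurable_of_isClosed fun F hF => ?_
  have : gaussMap K ⁻¹' F = (uniqueNormalSet K ∩ {x : Rn n | ∃ θ ∈ F, IsOuterUnitNormal K x θ}) ∪
      ((uniqueNormalSet K)ᶜ ∩ {_x : Rn n | (⟨EuclideanSpace.single 0 1, by simp⟩ : UnitSphere n) ∈ F}) := by
    ext x
    by_cases hx : x ∈ uniqueNormalSet K
    · obtain ⟨h1, h2⟩ := gaussMap_spec hx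
      simp only [Set.mem_preimage, Set.mem_union, Set.mem_inter_iff, hx, true_and, Set.mem_compl_iff,
        not_true_eq_false, false_and, or_false, Set.mem_ofPred_eq]
      exact ⟨fun h => ⟨_, h, h1⟩, fun ⟨θ, h3, h4⟩ => h2 θ h4 ▸ h3⟩
    · have hx' : ¬ ∃! θ : UnitSphere n, IsOuterUnitNormal K x θ := hx
      have : gaussMap K x = ⟨EuclideanSpace.single 0 1, by simp⟩ := by rw [gaussMap, dif_neg hx']
      simp [hx, this]
  rw [this]
  refine ((measurableSet_uniqueNormalSet K).inter
    (isClosed_setOf_exists_normal_mem hF).measurableSet).union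
    ((measurableSet_uniqueNormalSet K).compl.inter (MeasurableSet.const _))

theorem IsOuterUnitNormal.inner_lt {x y : Rn n} {θ : UnitSphere n} (h : IsOuterUnitNormal K x θ)
    (hy : y ∈ interior K) : inner ℝ (y - x) (θ : Rn n) < 0 := by
  obtain ⟨r, hr, hball⟩ := Metric.isOpen_iff.1 isOpen_interior y hy
  have hθ : ‖(θ : Rn n)‖ = 1 := by simp
  have hmem : y + (r / 2) • (θ : Rn n) ∈ K := by
    refine interior_subset (hball ?_)
    rw [mem_ball_iff_norm, add_sub_cancel_left, norm_smul, hθ, mul_one, Real.norm_eq_abs,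
      abs_of_pos (by positivity)]
    linarith
  have := h _ hmem
  rw [add_sub_right_comm, inner_add_left, real_inner_smul_left, real_inner_self_eq_norm_sq, hθ] at this
  linarith

/-- The `1`-Lipschitz metric projection onto a closed convex set. -/
theorem exists_metric_projection (hKc : IsClosed K) (hK : Convex ℝ K) (hne : K.Nonempty) :
    ∃ π : Rn n → Rn n, LipschitzWith 1 π ∧
      ∀ u, ∀ x ∈ K, (∀ w ∈ K, inner ℝ (u - x) (w - x) ≤ 0) → π u = x := by
  have hex : ∀ u : Rn n, ∃ v ∈ K, ∀ w ∈ K, inner ℝ (u - v) (w - v) ≤ 0 := by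
    intro u
    obtain ⟨v, hv, h⟩ := exists_norm_eq_iInf_of_complete_convex hne hKc.isComplete hK u
    exact ⟨v, hv, (norm_eq_iInf_iff_real_inner_le_zero hK hv).1 h⟩
  -- Adding the two variational inequalities gives ‖v - v'‖² ≤ ⟪u - u', v - v'⟫.
  have key : ∀ u u' v v' : Rn n, v ∈ K → v' ∈ K → (∀ w ∈ K, inner ℝ (u - v) (w - v) ≤ 0) →
      (∀ w ∈ K, inner ℝ (u' - v') (w - v') ≤ 0) → ‖v - v'‖ ≤ ‖u - u'‖ := by
    intro u u' v v' hv hv' h h'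
    have h1 := h v' hv'
    have h2 := h' v hv
    have h3 : ‖v - v'‖ * ‖v - v'‖ ≤ ‖u - u'‖ * ‖v - v'‖ := by
      refine le_trans (le_of_eq (real_inner_self_eq_norm_mul_norm _).symm) (le_trans ?_
        (real_inner_le_norm _ _))
      have e : inner ℝ (u - u') (v - v') - inner ℝ (v - v') (v - v') =
          -(inner ℝ (u - v) (v' - v) + inner ℝ (u' - v') (v - v')) := by
        rw [← neg_sub v v', inner_neg_right, ← inner_sub_left]
        have : u - u' - (v - v') = (u - v) - (u' - v') := by abel
        rw [this, inner_sub_left]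
        ring
      linarith
    rcases (norm_nonneg (v - v')).eq_or_lt with h0 | h0
    · rw [← h0]; exact norm_nonneg _
    · exact le_of_mul_le_mul_right h3 h0
  choose π hπK hπ using hex
  refine ⟨π, LipschitzWith.of_dist_le_mul fun u u' => ?_, fun u x hx h => ?_⟩
  · rw [dist_eq_norm, dist_eq_norm]
    simpa using key u u' _ _ (hπK u) (hπK u') (hπ u) (hπ u')
  · have := key u u _ _ (hπK u) hx (hπ u) h
    rw [sub_self, norm_zero] at this
    exact sub_eq_zero.1 (norm_le_zero_iff.1 this)

/-- If all minors vanish, the unit vectors are parallel, hence opposite; K would then lie in a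
hyperplane, which an interior point rules out. -/
theorem exists_minor_ne_zero (hint : (interior K).Nonempty) {x : Rn n} {θ θ' : UnitSphere n}
    (h : IsOuterUnitNormal K x θ) (h' : IsOuterUnitNormal K x θ') (hne : θ ≠ θ') :
    ∃ i j, (θ : Rn n) i * (θ' : Rn n) j - (θ : Rn n) j * (θ' : Rn n) i ≠ 0 := by
  by_contra! hall
  have hθ : ‖(θ : Rn n)‖ = 1 := by simp
  have hθ' : ‖(θ' : Rn n)‖ = 1 := by simp
  obtain ⟨j, hj⟩ : ∃ j, (θ' : Rn n) j ≠ 0 := by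
    by_contra! h0
    have : (θ' : Rn n) = 0 := by ext i; simpa using h0 i
    simp [this] at hθ'
  set c : ℝ := (θ : Rn n) j / (θ' : Rn n) j with hc
  have hcθ : (θ : Rn n) = c • (θ' : Rn n) := by
    ext i
    have := hall i j
    simp only [PiLp.smul_apply, smul_eq_mul, hc]
    field_simp
    linarith
  have hc1 : |c| = 1 := by
    rw [hcθ, norm_smul, hθ', mul_one] at hθ
    exact hθ
  rcases (abs_eq zero_le_one).1 hc1 with h1 | h1
  · rw [h1, one_smul] at hcθ
    exact hne (Subtype.ext hcθ)
  · obtain ⟨y, hy⟩ := hint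
    have e1 := h.inner_lt hy
    have e2 := h'.inner_lt hy
    rw [hcθ, h1, neg_smul, one_smul, inner_neg_right] at e1
    linarith

theorem hausdorffMeasure_setOf_two_coords {m : ℕ} {i j : Fin (m + 1)} (hij : i ≠ j) (p q : ℝ) :
    μH[m] {z : Rn (m + 1) | z i = p ∧ z j = q} = 0 := by
  set pi : Fin (m + 1) → Rn (m + 1) →ₗ[ℝ] ℝ := fun i =>
    (EuclideanSpace.proj i : Rn (m + 1) →L[ℝ] ℝ).toLinearMap with hpi
  set S : Submodule ℝ (Rn (m + 1)) := (pi i).ker ⊓ (pi j).ker with hS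
  have hS1 : S < (pi i).ker := by
    refine lt_of_le_of_ne inf_le_left fun h => ?_
    have : EuclideanSpace.single j (1 : ℝ) ∈ S := by
      rw [h]; simp [hpi, hij]
    have := (Submodule.mem_inf.1 this).2
    simp [hpi] at this
  have hS2 : (pi i).ker < ⊤ := by
    refine lt_of_le_of_ne le_top fun h => ?_
    have : EuclideanSpace.single i (1 : ℝ) ∈ (pi i).ker := by rw [h]; trivial
    simp [hpi] at this
  have h1 := Submodule.finrank_lt_finrank_of_lt hS1
  have h2 := Submodule.finrank_lt_finrank_of_lt hS2
  rw [finrank_top, finrank_euclideanSpace_fin] at h2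
  have h3 : Module.finrank ℝ S < m := by omega
  have h0 : μH[(m : ℝ)] (Set.univ : Set S) = 0 := by
    rw [Real.hausdorffMeasure_of_finrank_lt (by exact_mod_cast h3)]
    simp
  rcases Set.eq_empty_or_nonempty {z : Rn (m + 1) | z i = p ∧ z j = q} with he | ⟨z₀, hz₀⟩
  · rw [he, measure_empty]
  have hiso : Isometry fun s : S => z₀ + (s : Rn (m + 1)) :=
    (isometry_add_left z₀).comp isometry_subtype_coe
  have himg := hiso.hausdorffMeasure_image (d := m) (Or.inl (by positivity)) Set.univ
  rw [h0] at himg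
  refine measure_mono_null (fun z hz => ?_) himg
  simp only [Set.mem_ofPred_eq] at hz hz₀
  refine ⟨⟨z - z₀, ?_⟩, trivial, by simp⟩
  rw [hS, Submodule.mem_inf]
  simp [hpi, hz, hz₀]

/-- At almost every boundary point of a convex body the outer unit normal is unique. -/
theorem hausdorffMeasure_frontier_diff_uniqueNormalSet {m : ℕ} {K : Set (Rn (m + 1))}
    (hKc : IsClosed K) (hK : Convex ℝ K) (hint : (interior K).Nonempty) :
    μH[m] (frontier K \ uniqueNormalSet K) = 0 := by
  obtain ⟨π, hπ, hπx⟩ := exists_metric_projection hKc hK (hint.mono interior_subset)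
  -- The metric projection sends x + aθ + bθ' to x for all a, b > 0 when θ, θ' are normals at x. If
  -- they differ, this planar cone meets a codimension-two plane on which two coordinates are
  -- prescribed rationals. Thus the singular points lie in countably many 1-Lipschitz images of
  -- `μH[m]`-null planes.
  have hsub : frontier K \ uniqueNormalSet K ⊆ ⋃ (i : Fin (m + 1)) (j : Fin (m + 1)) (_ : i ≠ j)
      (r : ℚ × ℚ), π '' {z : Rn (m + 1) | z i = r.1 ∧ z j = r.2} := by
    rintro x ⟨hx, hxu⟩
    obtain ⟨θ, hθ⟩ := exists_isOuterUnitNormal hKc hK hint hx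
    obtain ⟨θ', hθ', hne⟩ : ∃ θ' : UnitSphere (m + 1), IsOuterUnitNormal K x θ' ∧ θ ≠ θ' := by
      by_contra! hall
      exact hxu ⟨θ, hθ, fun θ' h => (hall θ' h).symm⟩
    obtain ⟨i, j, hd⟩ := exists_minor_ne_zero hint hθ hθ' hne
    set t : Rn (m + 1) := (θ : Rn (m + 1)) with ht
    set t' : Rn (m + 1) := (θ' : Rn (m + 1)) with ht'
    set d := t i * t' j - t j * t' i with hdd
    have hij : i ≠ j := by
      rintro rfl
      exact hd (by rw [hdd]; ring)
    -- Cramer's rule: A and B are the coefficients a, b for which x + aθ + bθ' has i-th and j-th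
    -- coordinates r. The prescriptions with both coefficients positive form a nonempty open set, so
    -- a rational one exists.
    set A : ℝ × ℝ → ℝ := fun r => ((r.1 - x i) * t' j - (r.2 - x j) * t' i) / d with hA
    set B : ℝ × ℝ → ℝ := fun r => (t i * (r.2 - x j) - t j * (r.1 - x i)) / d with hB
    have hopen : IsOpen ({r | 0 < A r} ∩ {r | 0 < B r}) :=
      (isOpen_lt continuous_const (by fun_prop)).inter (isOpen_lt continuous_const (by fun_prop))
    have hnon : ({r | 0 < A r} ∩ {r | 0 < B r}).Nonempty := by
      refine ⟨(x i + t i + t' i, x j + t j + t' j), ?_, ?_⟩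
      · have : A (x i + t i + t' i, x j + t j + t' j) = 1 := by
          simp only [hA]
          rw [div_eq_one_iff_eq hd, hdd]; ring
        simp [this]
      · have : B (x i + t i + t' i, x j + t j + t' j) = 1 := by
          simp only [hB]
          rw [div_eq_one_iff_eq hd, hdd]; ring
        simp [this]
    have hdense : DenseRange (Prod.map ((↑) : ℚ → ℝ) ((↑) : ℚ → ℝ)) :=
      Rat.denseRange_cast.prodMap Rat.denseRange_cast
    obtain ⟨r, hrA, hrB⟩ := hdense.exists_mem_open hopen hnon
    simp only [Set.mem_ofPred_eq] at hrA hrB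
    set a := A (Prod.map (↑) (↑) r) with ha
    set b := B (Prod.map (↑) (↑) r) with hb
    simp only [Set.mem_iUnion]
    refine ⟨i, j, hij, r, x + a • t + b • t', ⟨?_, ?_⟩, ?_⟩
    · simp only [PiLp.add_apply, PiLp.smul_apply, smul_eq_mul, ha, hb, hA, hB, Prod.map_fst,
        Prod.map_snd]
      field_simp
      rw [hdd]; ring
    · simp only [PiLp.add_apply, PiLp.smul_apply, smul_eq_mul, ha, hb, hA, hB, Prod.map_fst,
        Prod.map_snd]
      field_simp
      rw [hdd]; ring
    · refine hπx _ x (hKc.frontier_subset hx) fun w hw => ?_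
      have e1 := hθ w hw
      have e2 := hθ' w hw
      rw [real_inner_comm] at e1 e2
      have : x + a • t + b • t' - x = a • t + b • t' := by abel
      rw [this, inner_add_left, real_inner_smul_left, real_inner_smul_left]
      have := mul_nonpos_of_nonneg_of_nonpos hrA.le e1
      have := mul_nonpos_of_nonneg_of_nonpos hrB.le e2
      linarith
  refine measure_mono_null hsub ?_
  refine measure_iUnion_null fun i => measure_iUnion_null fun j => measure_iUnion_null fun hij =>
    measure_iUnion_null fun r => ?_
  refine le_antisymm ((hπ.lipschitzOnWith.hausdorffMeasure_image_le (by positivity)).trans ?_)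
    zero_le
  rw [hausdorffMeasure_setOf_two_coords hij, mul_zero]

/-- If the unique outer normal at `x` has positive component along `e`, then `x` can be moved into
the interior in the direction `-e`. -/
theorem exists_sub_smul_mem_interior [NeZero n] (hKc : IsClosed K) (hK : Convex ℝ K)
    (hint : (interior K).Nonempty) {x e : Rn n} (hxK : x ∈ K) (hx : x ∈ uniqueNormalSet K)
    (he : 0 < inner ℝ (gaussMap K x : Rn n) e) : ∃ t : ℝ, 0 < t ∧ x - t • e ∈ interior K := by
  by_contra hno
  push Not at hno
  -- Suppose the ray from x in direction -e misses the interior, and separate the two by l. Then l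
  -- is maximal on K at x, so it is a positive multiple of the unique normal and l e > 0. But l does
  -- not fall below the separating value u = l x along the ray, a contradiction.
  have hconv : Convex ℝ {z : Rn n | ∃ t : ℝ, 0 < t ∧ z = x - t • e} := by
    rintro _ ⟨s, hs, rfl⟩ _ ⟨t, ht, rfl⟩ a b ha hb hab
    refine ⟨a * s + b * t, ?_, ?_⟩
    · rcases ha.eq_or_lt with h | h
      · rw [← h] at hab ⊢; simp only [zero_add] at hab; simp [hab, ht]
      · positivity
    · have : x = a • x + b • x := by rw [← add_smul, hab, one_smul]
      conv_rhs => rw [this]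
      module
  obtain ⟨l, u, hl1, hl2⟩ := geometric_hahn_banach_open hK.interior isOpen_interior hconv (by
    rw [Set.disjoint_left]
    rintro z hz ⟨t, ht, rfl⟩
    exact hno t ht hz)
  have hray : ∀ t : ℝ, 0 < t → u ≤ l x - t * l e := fun t ht => by
    have := hl2 _ ⟨t, ht, rfl⟩
    simpa using this
  have hux : u ≤ l x := by
    have hlim : Tendsto (fun t : ℝ => l x - t * l e) (𝓝[>] 0) (𝓝 (l x - 0 * l e)) :=
      (Continuous.tendsto (by fun_prop) 0).mono_left nhdsWithin_le_nhds
    rw [zero_mul, sub_zero] at hlim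
    exact ge_of_tendsto hlim (eventually_mem_nhdsWithin.mono fun t ht => hray t ht)
  have hmax : ∀ y ∈ K, l y ≤ l x := by
    have hsub : K ⊆ {y | l y ≤ u} := by
      rw [← closure_interior_eq_of_convex hKc hK hint]
      exact closure_minimal (fun y hy => (hl1 y hy).le) (isClosed_le l.continuous continuous_const)
    exact fun y hy => le_trans (Set.mem_ofPred.1 (hsub hy)) hux
  have hl0 : l ≠ 0 := by
    rintro rfl
    obtain ⟨a, ha⟩ := hint
    have h1 := hl1 a ha
    have h2 := hray 1 one_pos
    simp at h1 h2
    linarith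
  obtain ⟨θ, hθ, c, hc, hlc⟩ := exists_isOuterUnitNormal_of_functional hl0 hmax
  have hθe := (gaussMap_spec hx).2 θ hθ
  have hle : 0 < l e := by
    rw [hlc, hθe, real_inner_comm]
    exact mul_pos hc he
  have hxu : l x ≤ u := by
    have hsub : K ⊆ {y | l y ≤ u} := by
      rw [← closure_interior_eq_of_convex hKc hK hint]
      exact closure_minimal (fun y hy => (hl1 y hy).le) (isClosed_le l.continuous continuous_const)
    exact hsub hxK
  have := hray 1 one_pos
  linarith

end normals

/-! ### Orthogonal frames, and the lines over a hyperplane -/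

/-- An orthogonal splitting of `ℝᵐ⁺¹` into a hyperplane, isometric to `ℝᵐ`, and a unit normal. -/
structure Frame (m : ℕ) where
  ι : Rn m →ₗᵢ[ℝ] Rn (m + 1)
  e : Rn (m + 1)
  norm_e : ‖e‖ = 1
  orth : ∀ y, inner ℝ (ι y) e = 0

namespace Frame
variable {m : ℕ} (F : Frame m)

/-- The frame with the opposite unit normal. -/
noncomputable def neg : Frame m := ⟨F.ι, -F.e, by rw [norm_neg, F.norm_e], fun y => by simp [F.orth]⟩

theorem exists_e_eq {e : Rn (m + 1)} (he : ‖e‖ = 1) : ∃ F : Frame m, F.e = e := by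
  obtain ⟨b, hb⟩ := Orthonormal.exists_orthonormalBasis_extension_of_card_eq (𝕜 := ℝ)
    (E := Rn (m + 1)) (ι := Fin (m + 1)) (by simp) (v := fun _ => e) (s := {0}) (by
      refine ⟨fun i => by simpa [Set.domRestrict] using he, fun i j hij => ?_⟩
      exact absurd (Subsingleton.elim i j) hij)
  have hb0 : b 0 = e := hb 0 rfl
  have hon : Orthonormal ℝ fun i : Fin m => b i.succ := b.orthonormal.comp _ (Fin.succ_injective m)
  set ι : Rn m →ₗ[ℝ] Rn (m + 1) :=
    ((EuclideanSpace.basisFun (Fin m) ℝ).toBasis.constr ℝ fun i => b i.succ) with hι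
  have hιy : ∀ y, ι y = ∑ i, y i • b i.succ := by
    intro y
    rw [hι, Module.Basis.constr_apply_fintype]
    simp
  refine ⟨⟨ι.isometryOfOrthonormal (v := (EuclideanSpace.basisFun (Fin m) ℝ).toBasis) ?_ ?_, e, he, ?_⟩, rfl⟩
  · rw [OrthonormalBasis.coe_toBasis]
    exact (EuclideanSpace.basisFun (Fin m) ℝ).orthonormal
  · convert hon using 1
    ext i : 1
    simp only [Function.comp, hι, Module.Basis.constr_basis]
  · intro y
    change inner ℝ (ι y) e = 0
    rw [hιy, sum_inner]
    refine Finset.sum_eq_zero fun i _ => ?_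
    rw [real_inner_smul_left, ← hb0, b.orthonormal.2 (Fin.succ_ne_zero i), mul_zero]

/-- The point with coordinates `(y, t)`. -/
noncomputable def pt (y : Rn m) (t : ℝ) : Rn (m + 1) := F.ι y + t • F.e

theorem norm_pt_sq (y : Rn m) (t : ℝ) : ‖F.pt y t‖ ^ 2 = ‖y‖ ^ 2 + t ^ 2 := by
  rw [pt, norm_add_sq_real, real_inner_smul_right, F.orth, norm_smul, F.norm_e, F.ι.norm_map]
  simp

/-- The splitting as a linear isometry. -/
noncomputable def isom : WithLp 2 (Rn m × ℝ) →ₗᵢ[ℝ] Rn (m + 1) where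
  toFun p := F.pt p.fst p.snd
  map_add' p q := by simp only [pt, WithLp.add_fst, WithLp.add_snd, map_add]; module
  map_smul' c p := by
    simp only [pt, WithLp.smul_fst, WithLp.smul_snd, map_smul, RingHom.id_apply, smul_eq_mul]
    module
  norm_map' p := by
    have h := F.norm_pt_sq p.fst p.snd
    have h2 := WithLp.prod_norm_sq_eq_of_L2 p
    rw [Real.norm_eq_abs, sq_abs] at h2
    rw [← h2] at h
    exact (sq_eq_sq₀ (norm_nonneg _) (norm_nonneg _)).1 h

/-- The splitting as an isometric equivalence. -/
noncomputable def equiv : WithLp 2 (Rn m × ℝ) ≃ₗᵢ[ℝ] Rn (m + 1) :=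
  F.isom.toLinearIsometryEquiv (by
    rw [(WithLp.linearEquiv 2 ℝ (Rn m × ℝ)).finrank_eq]; simp)

/-- The splitting as a measurable equivalence. -/
noncomputable def mequiv : Rn m × ℝ ≃ᵐ Rn (m + 1) :=
  (MeasurableEquiv.toLp 2 (Rn m × ℝ)).trans F.equiv.toHomeomorph.toMeasurableEquiv

theorem mequiv_apply (p : Rn m × ℝ) : F.mequiv p = F.pt p.1 p.2 := rfl

theorem measurePreserving_mequiv : MeasurePreserving F.mequiv volume volume :=
  F.equiv.measurePreserving.comp (WithLp.volume_preserving_toLp (Rn m) ℝ)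

/-- The orthogonal projection onto the hyperplane, in coordinates. -/
noncomputable def proj : Rn (m + 1) →L[ℝ] Rn m := ContinuousLinearMap.adjoint F.ι.toContinuousLinearMap

theorem inner_proj_left (x : Rn (m + 1)) (y : Rn m) :
    inner ℝ (F.proj x) y = inner ℝ x (F.ι y) := by
  rw [proj, ContinuousLinearMap.adjoint_inner_left]; rfl

theorem proj_pt (y : Rn m) (t : ℝ) : F.proj (F.pt y t) = y := by
  refine ext_inner_right ℝ fun z => ?_
  rw [inner_proj_left, pt, inner_add_left, F.ι.inner_map_map, real_inner_smul_left,
    real_inner_comm (F.ι z) F.e, F.orth]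
  simp

theorem inner_pt_e (y : Rn m) (t : ℝ) : inner ℝ (F.pt y t) F.e = t := by
  rw [pt, inner_add_left, F.orth, real_inner_smul_left, real_inner_self_eq_norm_sq, F.norm_e]
  simp

theorem exists_pt_eq (x : Rn (m + 1)) : ∃ y t, F.pt y t = x :=
  ⟨(F.mequiv.symm x).1, (F.mequiv.symm x).2, by rw [← mequiv_apply]; simp⟩

theorem pt_proj (x : Rn (m + 1)) : F.pt (F.proj x) (inner ℝ x F.e) = x := by
  obtain ⟨y, t, rfl⟩ := F.exists_pt_eq x
  rw [proj_pt, inner_pt_e]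

theorem pt_sub_smul (y : Rn m) (s t : ℝ) : F.pt y s - t • F.e = F.pt y (s - t) := by
  simp only [pt]; module

theorem norm_proj_le (x : Rn (m + 1)) : ‖F.proj x‖ ≤ ‖x‖ := by
  have h := F.norm_pt_sq (F.proj x) (inner ℝ x F.e)
  rw [pt_proj] at h
  exact le_of_sq_le_sq (by nlinarith [sq_nonneg (inner ℝ x F.e)]) (norm_nonneg _)

theorem lipschitzWith_proj : LipschitzWith 1 F.proj :=
  LipschitzWith.of_dist_le_mul fun x y => by
    rw [dist_eq_norm, dist_eq_norm, ← map_sub]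
    simpa using F.norm_proj_le (x - y)

theorem continuous_pt : Continuous fun p : Rn m × ℝ => F.pt p.1 p.2 := by
  unfold pt
  exact (F.ι.continuous.comp continuous_fst).add (continuous_snd.smul continuous_const)

/-- The slice of the interior of `K` over `y`. -/
def slice (K : Set (Rn (m + 1))) (y : Rn m) : Set ℝ := {t | F.pt y t ∈ interior K}

/-- The base points over which the interior of `K` is nonempty and bounded above. -/
def topDomain (K : Set (Rn (m + 1))) : Set (Rn m) :=
  {y | (F.slice K y).Nonempty ∧ BddAbove (F.slice K y)}

/-- The highest boundary point over `y`. -/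
noncomputable def topPoint (K : Set (Rn (m + 1))) (y : Rn m) : Rn (m + 1) := F.pt y (sSup (F.slice K y))

variable {K : Set (Rn (m + 1))}

theorem isOpen_slice (y : Rn m) : IsOpen (F.slice K y) :=
  isOpen_interior.preimage (F.continuous_pt.comp (Continuous.prodMk_right y))

theorem pt_combo (y : Rn m) {a b : ℝ} (hab : a + b = 1) (s t : ℝ) :
    F.pt y (a * s + b * t) = a • F.pt y s + b • F.pt y t := by
  have h : F.ι y = a • F.ι y + b • F.ι y := by rw [← add_smul, hab, one_smul]
  simp only [pt]
  conv_lhs => rw [h]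
  module

theorem convex_slice (hK : Convex ℝ K) (y : Rn m) : Convex ℝ (F.slice K y) := by
  intro s hs t ht a b ha hb hab
  have := hK.interior hs ht ha hb hab
  rw [← F.pt_combo y hab] at this
  exact this

theorem mem_slice_of_between (hK : Convex ℝ K) {y : Rn m} {s t u : ℝ} (hs : s ∈ F.slice K y)
    (ht : F.pt y t ∈ K) (h : s ≤ u ∧ u < t ∨ t < u ∧ u ≤ s) : u ∈ F.slice K y := by
  have hst : s ≠ t := by rintro rfl; rcases h with h | h <;> linarith
  have hd : t - s ≠ 0 := sub_ne_zero.2 hst.symm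
  have hpos : 0 < (t - u) / (t - s) ∧ 0 ≤ (u - s) / (t - s) := by
    rcases h with ⟨h1, h2⟩ | ⟨h1, h2⟩
    · exact ⟨div_pos (by linarith) (by linarith), div_nonneg (by linarith) (by linarith)⟩
    · exact ⟨div_pos_of_neg_of_neg (by linarith) (by linarith),
        div_nonneg_of_nonpos (by linarith) (by linarith)⟩
  have hab : (t - u) / (t - s) + (u - s) / (t - s) = 1 := by field_simp; ring
  have := hK.combo_interior_self_mem_interior hs ht hpos.1 hpos.2 hab
  rw [← F.pt_combo y hab] at this
  have hu : (t - u) / (t - s) * s + (u - s) / (t - s) * t = u := by field_simp; ring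
  rwa [hu] at this

theorem topPoint_spec (hKc : IsClosed K) {y : Rn m} (hy : y ∈ F.topDomain K) :
    F.topPoint K y ∈ frontier K ∧ ∃ t : ℝ, 0 < t ∧ F.topPoint K y - t • F.e ∈ interior K := by
  have hnot : sSup (F.slice K y) ∉ F.slice K y := by
    intro hmem
    obtain ⟨ε, hε, hball⟩ := Metric.isOpen_iff.1 (F.isOpen_slice (K := K) y) _ hmem
    have : sSup (F.slice K y) + ε / 2 ∈ F.slice K y := hball (by
      rw [mem_ball_iff_norm, add_sub_cancel_left, Real.norm_of_nonneg (by positivity)]; linarith)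
    linarith [le_csSup hy.2 this]
  refine ⟨⟨subset_closure ?_, hnot⟩, ?_⟩
  · have hcl := csSup_mem_closure hy.1 hy.2
    have hcont : Continuous fun t => F.pt y t := F.continuous_pt.comp (Continuous.prodMk_right y)
    have := map_mem_closure hcont hcl (t := K) fun t ht => interior_subset ht
    rwa [hKc.closure_eq] at this
  · obtain ⟨s, hs⟩ := hy.1
    refine ⟨sSup (F.slice K y) - s, sub_pos.2 (lt_of_le_of_ne (le_csSup hy.2 hs) ?_), ?_⟩
    · rintro rfl; exact hnot hs
    · rw [topPoint, pt_sub_smul, sub_sub_cancel]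
      exact hs

theorem eq_topPoint (hKc : IsClosed K) (hK : Convex ℝ K) {x : Rn (m + 1)} (hx : x ∈ frontier K)
    (h : ∃ t : ℝ, 0 < t ∧ x - t • F.e ∈ interior K) :
    F.proj x ∈ F.topDomain K ∧ F.topPoint K (F.proj x) = x := by
  obtain ⟨t, ht, hmem⟩ := h
  obtain ⟨y, s, rfl⟩ := F.exists_pt_eq x
  rw [proj_pt]
  rw [pt_sub_smul] at hmem
  have hub : ∀ u ∈ F.slice K y, u ≤ s := by
    intro u hu
    by_contra! hlt
    exact hx.2 (F.mem_slice_of_between hK (s := s - t) (t := u) (u := s) hmem (interior_subset hu)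
      (Or.inl ⟨by linarith, hlt⟩))
  have hsup : sSup (F.slice K y) = s := by
    refine csSup_eq_of_forall_le_of_forall_lt_exists_gt ⟨_, hmem⟩ hub fun w hw => ?_
    refine ⟨max ((w + s) / 2) (s - t), ?_, lt_of_lt_of_le (by linarith) (le_max_left _ _)⟩
    exact F.mem_slice_of_between hK hmem (hKc.frontier_subset hx)
      (Or.inl ⟨le_max_right _ _, max_lt (by linarith) (by linarith)⟩)
  exact ⟨⟨⟨_, hmem⟩, s, hub⟩, by rw [topPoint, hsup]⟩

theorem isOpen_setOf_exists_slice_gt (c : ℝ) : IsOpen {y | ∃ t ∈ F.slice K y, c < t} := by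
  have : {y | ∃ t ∈ F.slice K y, c < t} =
      Prod.fst '' ({p : Rn m × ℝ | F.pt p.1 p.2 ∈ interior K} ∩ {p | c < p.2}) := by
    ext y
    simp only [slice, Set.mem_ofPred_eq, Set.mem_image, Set.mem_inter_iff, Prod.exists]
    constructor
    · rintro ⟨t, h1, h2⟩; exact ⟨y, t, ⟨h1, h2⟩, rfl⟩
    · rintro ⟨y', t, ⟨h1, h2⟩, rfl⟩; exact ⟨t, h1, h2⟩
  rw [this]
  exact isOpenMap_fst _ ((isOpen_interior.preimage F.continuous_pt).inter
    (isOpen_lt continuous_const continuous_snd))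

theorem isOpen_setOf_slice_nonempty : IsOpen {y | (F.slice K y).Nonempty} := by
  have : {y | (F.slice K y).Nonempty} = Prod.fst '' {p : Rn m × ℝ | F.pt p.1 p.2 ∈ interior K} := by
    ext y
    simp [slice, Set.Nonempty]
  rw [this]
  exact isOpenMap_fst _ (isOpen_interior.preimage F.continuous_pt)

/-- A slice is unbounded above exactly when it meets every half line (N, ∞), and meeting such a half
line is an open condition on y. -/
theorem measurableSet_topDomain : MeasurableSet (F.topDomain K) := by
  have : F.topDomain K = {y | (F.slice K y).Nonempty} \ ⋂ N : ℕ, {y | ∃ t ∈ F.slice K y, (N : ℝ) < t} := by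
    ext y
    simp only [topDomain, Set.mem_ofPred_eq, Set.mem_sdiff, Set.mem_iInter, not_forall]
    refine and_congr_right fun _ => ⟨fun ⟨b, hb⟩ => ?_, fun ⟨N, hN⟩ => ⟨N, fun t ht => ?_⟩⟩
    · obtain ⟨N, hN⟩ := exists_nat_ge b
      exact ⟨N, fun ⟨t, ht, h⟩ => absurd (hb ht) (not_le.2 (hN.trans_lt h))⟩
    · by_contra! hlt
      exact hN ⟨t, ht, hlt⟩
  rw [this]
  exact F.isOpen_setOf_slice_nonempty.measurableSet.diff
    (MeasurableSet.iInter fun N => (F.isOpen_setOf_exists_slice_gt N).measurableSet)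

theorem measurable_sSup_slice : Measurable fun y => sSup (F.slice K y) := by
  refine measurable_of_Ioi fun c => ?_
  have : (fun y => sSup (F.slice K y)) ⁻¹' Set.Ioi c =
      (F.topDomain K ∩ {y | ∃ t ∈ F.slice K y, c < t}) ∪ ((F.topDomain K)ᶜ ∩ {_y | c < 0}) := by
    ext y
    by_cases hy : y ∈ F.topDomain K
    · simp only [Set.mem_preimage, Set.mem_Ioi, Set.mem_union, Set.mem_inter_iff, hy, true_and,
        Set.mem_compl_iff, not_true_eq_false, false_and, or_false, Set.mem_ofPred_eq]
      exact lt_csSup_iff hy.2 hy.1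
    -- Off `topDomain` the slice is empty or unbounded above, and the real `sSup` takes its default
    -- value 0.
    · have h0 : sSup (F.slice K y) = 0 := by
        rcases Set.eq_empty_or_nonempty (F.slice K y) with h | h
        · rw [h, Real.sSup_empty]
        · exact Real.sSup_of_not_bddAbove fun hb => hy ⟨h, hb⟩
      simp [hy, h0]
  rw [this]
  exact (F.measurableSet_topDomain.inter (F.isOpen_setOf_exists_slice_gt c).measurableSet).union
    (F.measurableSet_topDomain.compl.inter (MeasurableSet.const _))

theorem measurable_topPoint : Measurable (F.topPoint K) :=
  F.continuous_pt.measurable.comp (measurable_id.prodMk F.measurable_sSup_slice)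

theorem proj_topPoint (y : Rn m) : F.proj (F.topPoint K y) = y := F.proj_pt _ _

end Frame

/-! ### Hausdorff measure under Lipschitz maps and oblique projections -/

theorem euclideanHausdorffMeasure_image_le {X Y : Type*} [MetricSpace X] [MetricSpace Y]
    [MeasurableSpace X] [BorelSpace X] [MeasurableSpace Y] [BorelSpace Y] (d : ℕ) {L : NNReal}
    {g : X → Y} {s : Set X} (hg : LipschitzOnWith L g s) : μHE[d] (g '' s) ≤ (L : ENNReal) ^ d * μHE[d] s := by
  simp only [Measure.euclideanHausdorffMeasure_def, Measure.smul_apply, ENNReal.smul_def, smul_eq_mul]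
  rw [mul_left_comm]
  gcongr
  simpa using hg.hausdorffMeasure_image_le (d := d) (by positivity)

theorem euclideanHausdorffMeasure_le_image {X Y : Type*} [MetricSpace X] [MetricSpace Y]
    [MeasurableSpace X] [BorelSpace X] [MeasurableSpace Y] [BorelSpace Y] (d : ℕ) {L : NNReal}
    {g : X → Y} {s : Set X} (hg : ∀ x ∈ s, ∀ y ∈ s, dist x y ≤ L * dist (g x) (g y)) :
    μHE[d] s ≤ (L : ENNReal) ^ d * μHE[d] (g '' s) := by
  rcases s.eq_empty_or_nonempty with rfl | ⟨x₀, hx₀⟩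
  · simp
  have : Nonempty X := ⟨x₀⟩
  have hinj : Set.InjOn g s := fun x hx y hy h => by
    have := hg x hx y hy
    rw [h, dist_self, mul_zero] at this
    exact dist_le_zero.1 this
  have hinv := hinj.leftInvOn_invFunOn
  have himg : Function.invFunOn g s '' (g '' s) = s := hinv.image_image
  have hlip : LipschitzOnWith L (Function.invFunOn g s) (g '' s) := by
    refine LipschitzOnWith.of_dist_le_mul ?_
    rintro _ ⟨x, hx, rfl⟩ _ ⟨y, hy, rfl⟩
    rw [hinv hx, hinv hy]
    exact hg x hx y hy
  have := euclideanHausdorffMeasure_image_le d hlip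
  rwa [himg] at this

theorem euclideanHausdorffMeasure_null_of_hausdorffMeasure {X : Type*} [MetricSpace X]
    [MeasurableSpace X] [BorelSpace X] {d : ℕ} {s : Set X} (h : μH[d] s = 0) : μHE[d] s = 0 := by
  simp [Measure.euclideanHausdorffMeasure_def, h]

namespace Frame
variable {m : ℕ} (F : Frame m)

/-- The map from the base hyperplane to `νᗮ` along the direction `e`. -/
noncomputable def oblique (ν : Rn (m + 1)) : Rn m →ₗ[ℝ] Rn (m + 1) where
  toFun y := F.ι y - (inner ℝ (F.ι y) ν / inner ℝ F.e ν) • F.e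
  map_add' x y := by simp only [map_add, inner_add_left, add_div]; module
  map_smul' c x := by
    simp only [map_smul, real_inner_smul_left, RingHom.id_apply, mul_div_assoc]; module

theorem oblique_apply (ν : Rn (m + 1)) (y : Rn m) :
    F.oblique ν y = F.ι y - (inner ℝ (F.ι y) ν / inner ℝ F.e ν) • F.e := rfl

/-- The Gram operator is the identity plus the rank-one map y ↦ ⟪w, y⟫ w / c², with c = ⟪e, ν⟫ and w
the projection of ν. Since ‖w‖² = 1 - c², its determinant is 1 + ‖w‖²/c² = 1/c². -/
theorem normDet_oblique {ν : Rn (m + 1)} (hν : ‖ν‖ = 1) (hc : 0 < inner ℝ F.e ν) :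
    (F.oblique ν).normDet = 1 / inner ℝ F.e ν := by
  set c := inner ℝ F.e ν with hcdef
  set w := F.proj ν with hw
  have hwι : ∀ y, inner ℝ (F.ι y) ν = inner ℝ w y := fun y => by
    rw [hw, F.inner_proj_left, real_inner_comm]
  have hww : ‖w‖ ^ 2 = 1 - c ^ 2 := by
    have h := F.norm_pt_sq (F.proj ν) (inner ℝ ν F.e)
    rw [pt_proj, hν, real_inner_comm, ← hcdef, ← hw] at h
    linarith
  have hadj : LinearMap.adjoint (F.oblique ν) ∘ₗ F.oblique ν =
      LinearMap.transvection (innerₗ (Rn m) w) ((c ^ 2)⁻¹ • w) := by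
    ext1 y
    refine ext_inner_right ℝ fun z => ?_
    rw [LinearMap.comp_apply, LinearMap.adjoint_inner_left, oblique_apply, oblique_apply]
    change _ = inner ℝ (y + inner ℝ w y • (c ^ 2)⁻¹ • w) z
    rw [hwι, hwι]
    simp only [inner_sub_left, inner_sub_right, inner_add_left, real_inner_smul_left,
      real_inner_smul_right, F.ι.inner_map_map, F.orth, real_inner_self_eq_norm_sq, F.norm_e,
      real_inner_comm F.e]
    have : inner ℝ F.e (F.ι z) = 0 := by rw [real_inner_comm, F.orth]
    simp only [this, ← hcdef]
    field_simp
    ring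
  have hsq : (F.oblique ν).normDet ^ 2 = (1 / c) ^ 2 := by
    have h := (F.oblique ν).normDet_sq
    rw [hadj, LinearMap.transvection.det] at h
    simp only [RCLike.ofReal_real_eq_id, id] at h
    rw [h]
    change 1 + inner ℝ w ((c ^ 2)⁻¹ • w) = _
    rw [real_inner_smul_right, real_inner_self_eq_norm_sq, hww]
    field_simp
    ring
  exact (sq_eq_sq₀ (LinearMap.normDet_nonneg _) (by positivity)).1 hsq

theorem euclideanHausdorffMeasure_oblique_image {ν : Rn (m + 1)} (hν : ‖ν‖ = 1)
    (hc : 0 < inner ℝ F.e ν) (S : Set (Rn m)) :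
    μHE[m] (F.oblique ν '' S) = ENNReal.ofReal (1 / inner ℝ F.e ν) * volume S := by
  have := (F.oblique ν).euclideanHausdorffMeasure_image_eq_normDet_mul_volume S
  rwa [finrank_euclideanSpace_fin, F.normDet_oblique hν hc] at this

/-- On a set that is nearly orthogonal to `ν`, the projection along `e` changes the measure by a
factor close to `⟪e, ν⟫`. -/
theorem volume_proj_image_bounds {ν : Rn (m + 1)} (hν : ‖ν‖ = 1) (hc : 0 < inner ℝ F.e ν)
    {ε : ℝ} (hε1 : ε < 1) {B : Set (Rn (m + 1))}
    (hB : ∀ x ∈ B, ∀ x' ∈ B, |inner ℝ (x - x') ν| ≤ ε * inner ℝ F.e ν * ‖x - x'‖)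
    {L : NNReal} (hL : (1 - ε)⁻¹ ≤ L) (hL' : 1 + ε ≤ L) :
    volume (F.proj '' B) ≤ ENNReal.ofReal (inner ℝ F.e ν) * ((L : ENNReal) ^ m * μHE[m] B) ∧
    μHE[m] B ≤ (L : ENNReal) ^ m * (ENNReal.ofReal (1 / inner ℝ F.e ν) * volume (F.proj '' B)) := by
  set c := inner ℝ F.e ν with hcdef
  -- Q is the projection along e onto the hyperplane orthogonal to ν. On B it changes each
  -- difference x - x' by at most ε‖x - x'‖, so it is bi-Lipschitz with constants near 1, while the
  -- measure of Q(B) is that of `F.proj '' B` divided by ⟪e, ν⟫.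
  set Q : Rn (m + 1) → Rn (m + 1) := fun x => F.oblique ν (F.proj x) with hQ
  have hQx : ∀ x, Q x = x - (inner ℝ x ν / c) • F.e := by
    intro x
    obtain ⟨y, t, rfl⟩ := F.exists_pt_eq x
    simp only [hQ]
    rw [proj_pt, oblique_apply, pt, inner_add_left, real_inner_smul_left, ← hcdef, add_div,
      mul_div_assoc, div_self hc.ne', mul_one]
    module
  have himg : Q '' B = F.oblique ν '' (F.proj '' B) := by rw [Set.image_image]
  have hdist : ∀ x ∈ B, ∀ x' ∈ B, ‖(Q x - Q x') - (x - x')‖ ≤ ε * ‖x - x'‖ := by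
    intro x hx x' hx'
    have : (Q x - Q x') - (x - x') = -((inner ℝ (x - x') ν / c) • F.e) := by
      rw [hQx, hQx, inner_sub_left, sub_div]; module
    rw [this, norm_neg, norm_smul, F.norm_e, mul_one, Real.norm_eq_abs, abs_div, abs_of_pos hc,
      div_le_iff₀ hc]
    linarith [hB x hx x' hx']
  have h1 : LipschitzOnWith L Q B := by
    refine LipschitzOnWith.of_dist_le_mul fun x hx x' hx' => ?_
    rw [dist_eq_norm, dist_eq_norm]
    calc ‖Q x - Q x'‖ = ‖((Q x - Q x') - (x - x')) + (x - x')‖ := by rw [sub_add_cancel]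
      _ ≤ ε * ‖x - x'‖ + ‖x - x'‖ := (norm_add_le _ _).trans (by gcongr; exact hdist x hx x' hx')
      _ = (1 + ε) * ‖x - x'‖ := by ring
      _ ≤ L * ‖x - x'‖ := by gcongr
  have h2 : ∀ x ∈ B, ∀ x' ∈ B, dist x x' ≤ L * dist (Q x) (Q x') := by
    intro x hx x' hx'
    rw [dist_eq_norm, dist_eq_norm]
    have e1 : ‖x - x'‖ ≤ ‖Q x - Q x'‖ + ε * ‖x - x'‖ := by
      calc ‖x - x'‖ = ‖(Q x - Q x') - ((Q x - Q x') - (x - x'))‖ := by rw [sub_sub_cancel]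
        _ ≤ _ := (norm_sub_le _ _).trans (by gcongr; exact hdist x hx x' hx')
    have h3 : 0 < 1 - ε := by linarith
    calc ‖x - x'‖ = (1 - ε)⁻¹ * ((1 - ε) * ‖x - x'‖) := by field_simp
      _ ≤ (1 - ε)⁻¹ * ‖Q x - Q x'‖ := by gcongr; linarith
      _ ≤ _ := by gcongr
  have hA : μHE[m] (Q '' B) = ENNReal.ofReal (1 / c) * volume (F.proj '' B) := by
    rw [himg, F.euclideanHausdorffMeasure_oblique_image hν hc]
  constructor
  · have := euclideanHausdorffMeasure_image_le m h1
    rw [hA] at this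
    calc volume (F.proj '' B) = ENNReal.ofReal c * (ENNReal.ofReal (1 / c) * volume (F.proj '' B)) := by
          rw [← mul_assoc, ← ENNReal.ofReal_mul hc.le, mul_one_div_cancel hc.ne']; simp
      _ ≤ _ := by gcongr
  · have := euclideanHausdorffMeasure_le_image m h2
    rwa [hA] at this

end Frame

/-! ### The projection formula for the boundary of a convex set -/

theorem measure_le_of_cover {X : Type*} [MeasurableSpace X] {μ ν : Measure X} {C : ENNReal}
    {A : ℕ → Set X} (hA : ∀ j, MeasurableSet (A j)) (hcov : μ (⋃ j, A j)ᶜ = 0)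
    (h : ∀ j, ∀ B ⊆ A j, MeasurableSet B → μ B ≤ C * ν B) {B : Set X} (hB : MeasurableSet B) :
    μ B ≤ C * ν B := by
  have hdis := disjoint_disjointed A
  have hm : ∀ j, MeasurableSet (B ∩ disjointed A j) := fun j => hB.inter (MeasurableSet.disjointed hA j)
  have hpd : Pairwise (Function.onFun Disjoint fun j => B ∩ disjointed A j) := fun i j hij =>
    (hdis hij).mono Set.inter_subset_right Set.inter_subset_right
  have h1 : μ B ≤ μ (⋃ j, B ∩ disjointed A j) := by
    rw [← Set.inter_iUnion, iUnion_disjointed]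
    calc μ B ≤ μ (B ∩ (⋃ j, A j) ∪ (⋃ j, A j)ᶜ) := measure_mono fun x hx => by
          by_cases h : x ∈ ⋃ j, A j
          · exact Or.inl ⟨hx, h⟩
          · exact Or.inr h
      _ ≤ _ := (measure_union_le _ _).trans (by rw [hcov, add_zero])
  refine h1.trans ?_
  rw [measure_iUnion hpd hm]
  calc ∑' j, μ (B ∩ disjointed A j) ≤ ∑' j, C * ν (B ∩ disjointed A j) :=
        ENNReal.tsum_le_tsum fun j => h j _ (Set.inter_subset_right.trans (disjointed_subset A j)) (hm j)
    _ = C * ν (⋃ j, B ∩ disjointed A j) := by rw [ENNReal.tsum_mul_left, measure_iUnion hpd hm]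
    _ ≤ _ := by gcongr; exact Set.iUnion_subset fun j => Set.inter_subset_left

namespace Frame
variable {m : ℕ} (F : Frame m) {K : Set (Rn (m + 1))}

/-- The surface measure of `K` weighted by the positive part of `⟪n, e⟫`. -/
noncomputable def boundaryFlux (K : Set (Rn (m + 1))) : Measure (Rn (m + 1)) :=
  ((μHE[m] : Measure (Rn (m + 1))).restrict (frontier K)).withDensity
    fun x => ENNReal.ofReal (inner ℝ (gaussMap K x : Rn (m + 1)) F.e)

/-- The regular boundary points that face the direction `e`. -/
def facing (K : Set (Rn (m + 1))) : Set (Rn (m + 1)) :=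
  {x | x ∈ frontier K ∧ x ∈ uniqueNormalSet K ∧ 0 < inner ℝ (gaussMap K x : Rn (m + 1)) F.e}

theorem measurable_inner_gaussMap :
    Measurable fun x => inner ℝ (gaussMap K x : Rn (m + 1)) F.e :=
  ((measurable_subtype_coe.comp (measurable_gaussMap K)).inner_const)

theorem measurableSet_facing : MeasurableSet (F.facing K) :=
  isClosed_frontier.measurableSet.inter ((measurableSet_uniqueNormalSet K).inter
    (measurableSet_lt measurable_const F.measurable_inner_gaussMap))

theorem boundaryFlux_compl_facing (hKc : IsClosed K) (hK : Convex ℝ K)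
    (hint : (interior K).Nonempty) : F.boundaryFlux K (F.facing K)ᶜ = 0 := by
  have hnull : (μHE[m] : Measure (Rn (m + 1))) (frontier K \ uniqueNormalSet K) = 0 :=
    euclideanHausdorffMeasure_null_of_hausdorffMeasure
      (hausdorffMeasure_frontier_diff_uniqueNormalSet hKc hK hint)
  rw [boundaryFlux, withDensity_apply _ F.measurableSet_facing.compl,
    Measure.restrict_restrict F.measurableSet_facing.compl]
  rw [lintegral_eq_zero_iff F.measurable_inner_gaussMap.ennreal_ofReal]
  rw [Filter.EventuallyEq, ae_restrict_iff' (F.measurableSet_facing.compl.inter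
    isClosed_frontier.measurableSet)]
  filter_upwards [measure_eq_zero_iff_ae_notMem.1 hnull] with x hx ⟨h1, h2⟩
  have hu : x ∈ uniqueNormalSet K := by
    by_contra h
    exact hx ⟨h2, h⟩
  simp only [Pi.zero_apply, ENNReal.ofReal_eq_zero]
  by_contra! hlt
  exact h1 ⟨h2, hu, hlt⟩

/-- The singular boundary points are null, and so is their image under the 1-Lipschitz projection.
At a regular top point the direction -e leads into the interior, which forces the normal to have
positive component along e. -/
theorem ae_topPoint_mem_facing (hKc : IsClosed K) (hK : Convex ℝ K)
    (hint : (interior K).Nonempty) :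
    ∀ᵐ y ∂(volume.restrict (F.topDomain K)), F.topPoint K y ∈ F.facing K := by
  rw [ae_restrict_iff' F.measurableSet_topDomain]
  have hnull : volume (F.proj '' (frontier K \ uniqueNormalSet K)) = 0 := by
    rw [← EuclideanSpace.euclideanHausdorffMeasure_eq_volume]
    refine le_antisymm ((euclideanHausdorffMeasure_image_le m
      F.lipschitzWith_proj.lipschitzOnWith).trans ?_) zero_le
    rw [euclideanHausdorffMeasure_null_of_hausdorffMeasure
      (hausdorffMeasure_frontier_diff_uniqueNormalSet hKc hK hint), mul_zero]
  filter_upwards [measure_eq_zero_iff_ae_notMem.1 hnull] with y hy hyd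
  obtain ⟨h1, t, ht, h2⟩ := F.topPoint_spec hKc hyd
  have hu : F.topPoint K y ∈ uniqueNormalSet K := by
    by_contra h
    exact hy ⟨_, ⟨h1, h⟩, F.proj_topPoint y⟩
  refine ⟨h1, hu, ?_⟩
  have := (gaussMap_spec hu).1.inner_lt h2
  rw [show F.topPoint K y - t • F.e - F.topPoint K y = -(t • F.e) by abel, inner_neg_left,
    real_inner_smul_left, real_inner_comm] at this
  by_contra! hle
  nlinarith

/-- On the facing points `topPoint` inverts the projection, since from each of them -e leads into
the interior. -/
theorem map_topPoint_apply (hKc : IsClosed K) (hK : Convex ℝ K) (hint : (interior K).Nonempty)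
    {B : Set (Rn (m + 1))} (hB : MeasurableSet B) (hBf : B ⊆ F.facing K) :
    (volume.restrict (F.topDomain K)).map (F.topPoint K) B = volume (F.proj '' B) := by
  rw [Measure.map_apply F.measurable_topPoint hB,
    Measure.restrict_apply (F.measurable_topPoint hB)]
  congr 1
  ext y
  constructor
  · rintro ⟨h1, -⟩
    exact ⟨_, h1, F.proj_topPoint y⟩
  · rintro ⟨x, hx, rfl⟩
    obtain ⟨h1, h2, h3⟩ := hBf hx
    obtain ⟨h4, h5⟩ := F.eq_topPoint hKc hK h1
      (exists_sub_smul_mem_interior hKc hK hint (hKc.frontier_subset h1) h2 h3)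
    exact ⟨by rw [Set.mem_preimage, h5]; exact hx, h4⟩

/-- All normals on B are close to ν, so the support inequalities at x and at x' together give |⟪x -
x', ν⟫| ≤ ε c ‖x - x'‖, and the estimate for oblique projections applies. It costs a factor L^m; the
last factor L comes from replacing the density ⟪n, e⟫ by the constant c. -/
theorem boundaryFlux_piece_bounds (hKc : IsClosed K) (hK : Convex ℝ K)
    (hint : (interior K).Nonempty) {ν : Rn (m + 1)} (hν : ‖ν‖ = 1) (hc : 0 < inner ℝ F.e ν)
    {ε : ℝ} (hε : 0 < ε) (hε1 : ε < 1) {B : Set (Rn (m + 1))} (hBm : MeasurableSet B)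
    (hBf : B ⊆ F.facing K)
    (hB : ∀ x ∈ B, ‖(gaussMap K x : Rn (m + 1)) - ν‖ ≤ ε * inner ℝ F.e ν)
    {L : NNReal} (hL : (1 - ε)⁻¹ ≤ L) :
    F.boundaryFlux K B ≤ (L : ENNReal) ^ (m + 1) *
        (volume.restrict (F.topDomain K)).map (F.topPoint K) B ∧
    (volume.restrict (F.topDomain K)).map (F.topPoint K) B ≤
      (L : ENNReal) ^ (m + 1) * F.boundaryFlux K B := by
  have hε1' : 0 < 1 - ε := by linarith
  have hL' : 1 + ε ≤ L := by
    refine le_trans ?_ hL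
    rw [← one_div, le_div_iff₀ hε1']
    nlinarith
  have hL0 : (0 : ℝ) < L := by linarith
  set c := inner ℝ F.e ν with hcdef
  have hflat : ∀ x ∈ B, ∀ x' ∈ B, inner ℝ (x - x') ν ≤ ε * c * ‖x - x'‖ := by
    intro x hx x' hx'
    have h1 := (gaussMap_spec (hBf hx').2.1).1 x (hKc.frontier_subset (hBf hx).1)
    have h2 : inner ℝ (x - x') ν = inner ℝ (x - x') (gaussMap K x' : Rn (m + 1)) -
        inner ℝ (x - x') ((gaussMap K x' : Rn (m + 1)) - ν) := by rw [inner_sub_right]; ring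
    have h3 := abs_real_inner_le_norm (x - x') ((gaussMap K x' : Rn (m + 1)) - ν)
    have h4 := mul_le_mul_of_nonneg_left (hB x' hx') (norm_nonneg (x - x'))
    have h5 := neg_abs_le (inner ℝ (x - x') ((gaussMap K x' : Rn (m + 1)) - ν))
    linarith
  have habs : ∀ x ∈ B, ∀ x' ∈ B, |inner ℝ (x - x') ν| ≤ ε * c * ‖x - x'‖ := by
    intro x hx x' hx'
    refine abs_le.2 ⟨?_, hflat x hx x' hx'⟩
    have := hflat x' hx' x hx
    rw [← neg_sub x x', inner_neg_left, norm_neg] at this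
    linarith
  obtain ⟨hv1, hv2⟩ := F.volume_proj_image_bounds hν hc hε1 habs hL hL'
  rw [F.map_topPoint_apply hKc hK hint hBm hBf]
  have hin : ∀ x ∈ B, |inner ℝ (gaussMap K x : Rn (m + 1)) F.e - c| ≤ ε * c := by
    intro x hx
    have h1 : inner ℝ (gaussMap K x : Rn (m + 1)) F.e - c =
        inner ℝ ((gaussMap K x : Rn (m + 1)) - ν) F.e := by
      rw [inner_sub_left, hcdef, real_inner_comm F.e ν]
    rw [h1]
    refine (abs_real_inner_le_norm _ _).trans ?_
    rw [F.norm_e, mul_one]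
    exact hB x hx
  have hflux : F.boundaryFlux K B = ∫⁻ x in B, ENNReal.ofReal
      (inner ℝ (gaussMap K x : Rn (m + 1)) F.e) ∂μHE[m] := by
    rw [boundaryFlux, withDensity_apply _ hBm, Measure.restrict_restrict hBm,
      Set.inter_eq_left.2 fun x hx => (hBf hx).1]
  have hf1 : F.boundaryFlux K B ≤ ENNReal.ofReal (c * L) * μHE[m] B := by
    rw [hflux, ← setLIntegral_const]
    refine setLIntegral_mono' hBm fun x hx => ENNReal.ofReal_le_ofReal ?_
    have := (abs_le.1 (hin x hx)).2
    have h6 : c * (1 + ε) ≤ c * L := by gcongr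
    linarith
  have hf2 : ENNReal.ofReal (c / L) * μHE[m] B ≤ F.boundaryFlux K B := by
    rw [hflux, ← setLIntegral_const]
    refine setLIntegral_mono' hBm fun x hx => ENNReal.ofReal_le_ofReal ?_
    have := (abs_le.1 (hin x hx)).1
    have h6 : c / L ≤ c * (1 - ε) := by
      rw [div_eq_mul_inv]
      gcongr
      rw [inv_le_comm₀ hL0 hε1']
      exact hL
    linarith
  have hLc : ENNReal.ofReal (L : ℝ) = (L : ENNReal) := ENNReal.ofReal_coe_nnreal
  constructor
  · calc F.boundaryFlux K B ≤ ENNReal.ofReal (c * L) * μHE[m] B := hf1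
      _ ≤ ENNReal.ofReal (c * L) * ((L : ENNReal) ^ m * (ENNReal.ofReal (1 / c) * volume (F.proj '' B))) := by
        gcongr
      _ = (ENNReal.ofReal (c * L) * ENNReal.ofReal (1 / c)) * (L : ENNReal) ^ m * volume (F.proj '' B) := by
        ring
      _ = (L : ENNReal) ^ (m + 1) * volume (F.proj '' B) := by
        rw [← ENNReal.ofReal_mul (by positivity), show c * L * (1 / c) = (L : ℝ) by field_simp, hLc,
          pow_succ']
  · calc volume (F.proj '' B) ≤ ENNReal.ofReal c * ((L : ENNReal) ^ m * μHE[m] B) := hv1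
      _ = (L : ENNReal) ^ m * (ENNReal.ofReal L * ENNReal.ofReal (c / L) * μHE[m] B) := by
        rw [← ENNReal.ofReal_mul hL0.le, mul_div_cancel₀ _ hL0.ne']; ring
      _ = (L : ENNReal) ^ (m + 1) * (ENNReal.ofReal (c / L) * μHE[m] B) := by
        rw [hLc, pow_succ]; ring
      _ ≤ _ := by gcongr

/-- **Projection formula**: the surface measure of a convex body weighted by `⟪n, e⟫⁺` projects
along `e` to Lebesgue measure on the hyperplane. -/
theorem boundaryFlux_eq_map (hKc : IsClosed K) (hK : Convex ℝ K) (hint : (interior K).Nonempty) :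
    F.boundaryFlux K = (volume.restrict (F.topDomain K)).map (F.topPoint K) := by
  set κ := (volume.restrict (F.topDomain K)).map (F.topPoint K) with hκ
  have hκnull : κ (F.facing K)ᶜ = 0 := by
    rw [hκ, Measure.map_apply F.measurable_topPoint F.measurableSet_facing.compl]
    exact F.ae_topPoint_mem_facing hKc hK hint
  -- The two measures are compared up to a factor L^(m+1) for each L > 1; letting L decrease to 1
  -- gives equality.
  have hbd : ∀ L : NNReal, 1 < L → ∀ B, MeasurableSet B →
      F.boundaryFlux K B ≤ (L : ENNReal) ^ (m + 1) * κ B ∧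
      κ B ≤ (L : ENNReal) ^ (m + 1) * F.boundaryFlux K B := by
    intro L hL B hBm
    have hL1 : (1 : ℝ) < L := hL
    set ε : ℝ := 1 - (L : ℝ)⁻¹ with hεdef
    have hε : 0 < ε := by have := inv_lt_one_of_one_lt₀ hL1; linarith
    have hε1 : ε < 1 := by have : 0 < (L : ℝ)⁻¹ := by positivity
                           linarith
    have hLε : (1 - ε)⁻¹ ≤ L := by simp [hεdef]
    have : Nonempty (UnitSphere (m + 1)) := ⟨⟨F.e, by simp [F.norm_e]⟩⟩
    -- Countably many reference directions suffice, because closeness of the normal to `ν j`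
    -- relative to ⟪e, ν j⟫ is an open condition that the normal itself satisfies.
    set ν : ℕ → UnitSphere (m + 1) := fun j => TopologicalSpace.denseSeq _ j with hν
    set A : ℕ → Set (Rn (m + 1)) := fun j => {x | x ∈ F.facing K ∧ 0 < inner ℝ F.e (ν j : Rn (m + 1)) ∧
      ‖(gaussMap K x : Rn (m + 1)) - ν j‖ ≤ ε * inner ℝ F.e (ν j : Rn (m + 1))} with hA
    have hAm : ∀ j, MeasurableSet (A j) := fun j => by
      refine F.measurableSet_facing.inter ((MeasurableSet.const _).inter ?_)
      exact measurableSet_le (((measurable_subtype_coe.comp (measurable_gaussMap K)).sub_const _).norm)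
        measurable_const
    have hcov : F.facing K ⊆ ⋃ j, A j := by
      intro x hx
      have hopen : IsOpen ({u : UnitSphere (m + 1) | 0 < inner ℝ F.e (u : Rn (m + 1))} ∩
          {u | ‖(gaussMap K x : Rn (m + 1)) - u‖ < ε * inner ℝ F.e (u : Rn (m + 1))}) :=
        (isOpen_lt continuous_const (by fun_prop)).inter (isOpen_lt (by fun_prop) (by fun_prop))
      have hpos : 0 < inner ℝ F.e (gaussMap K x : Rn (m + 1)) := by
        rw [real_inner_comm]; exact hx.2.2
      obtain ⟨j, hj1, hj2⟩ := (TopologicalSpace.denseRange_denseSeq (UnitSphere (m + 1))).exists_mem_open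
        hopen ⟨gaussMap K x, hpos, by simp only [Set.mem_ofPred_eq, sub_self, norm_zero]; positivity⟩
      exact Set.mem_iUnion.2 ⟨j, hx, hj1, (Set.mem_ofPred.1 hj2).le⟩
    have hpiece : ∀ j, ∀ B ⊆ A j, MeasurableSet B →
        F.boundaryFlux K B ≤ (L : ENNReal) ^ (m + 1) * κ B ∧
        κ B ≤ (L : ENNReal) ^ (m + 1) * F.boundaryFlux K B := by
      intro j B hBA hBm
      rcases B.eq_empty_or_nonempty with rfl | ⟨x, hx⟩
      · simp
      exact F.boundaryFlux_piece_bounds hKc hK hint (by simp) (hBA hx).2.1 hε hε1 hBm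
        (fun x hx => (hBA hx).1) (fun x hx => (hBA hx).2.2) hLε
    exact ⟨measure_le_of_cover hAm (measure_mono_null (Set.compl_subset_compl.2 hcov)
        (F.boundaryFlux_compl_facing hKc hK hint)) (fun j B h h' => (hpiece j B h h').1) hBm,
      measure_le_of_cover hAm (measure_mono_null (Set.compl_subset_compl.2 hcov) hκnull)
        (fun j B h h' => (hpiece j B h h').2) hBm⟩
  have hlim : ∀ b : ENNReal, Tendsto (fun L : NNReal => (L : ENNReal) ^ (m + 1) * b) (𝓝[>] 1) (𝓝 b) := by
    intro b
    have h1 : Tendsto (fun L : NNReal => (L : ENNReal) ^ (m + 1)) (𝓝[>] 1) (𝓝 1) := by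
      have : Tendsto (fun L : NNReal => ((L ^ (m + 1) : NNReal) : ENNReal)) (𝓝 1)
          (𝓝 (((1 : NNReal) ^ (m + 1) : NNReal) : ENNReal)) :=
        ENNReal.tendsto_coe.2 ((continuous_pow (m + 1)).tendsto 1)
      simpa using this.mono_left nhdsWithin_le_nhds
    simpa using ENNReal.Tendsto.mul_const h1 (b := b) (Or.inl one_ne_zero)
  ext B hB
  refine le_antisymm ?_ ?_
  · exact ge_of_tendsto (hlim _) (eventually_mem_nhdsWithin.mono fun L hL => (hbd L hL B hB).1)
  · exact ge_of_tendsto (hlim _) (eventually_mem_nhdsWithin.mono fun L hL => (hbd L hL B hB).2)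

end Frame

/-! ### Log-concave functions of one variable -/

/-- A log-concave function on the line, vanishing at infinity, together with the open interval
on which it is positive, up to end points. -/
structure IsLogConcSlice (J : Set ℝ) (p : ℝ → ℝ) : Prop where
  isOpen : IsOpen J
  convex : Convex ℝ J
  nonempty : J.Nonempty
  nonneg : ∀ t, 0 ≤ p t
  usc : UpperSemicontinuous p
  convexOn : ConvexOn ℝ {t | 0 < p t} (fun t => -Real.log (p t))
  pos : ∀ t ∈ J, 0 < p t
  supp : ∀ t, 0 < p t → t ∈ closure J
  tendsto_atTop : Tendsto p atTop (𝓝 0)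
  tendsto_atBot : Tendsto p atBot (𝓝 0)

open Classical in
/-- The value of `q` at the upper end point of `J`, or zero if there is none. -/
noncomputable def upperValue (J : Set ℝ) (q : ℝ → ℝ) : ℝ := if BddAbove J then q (sSup J) else 0

open Classical in
/-- The value of `q` at the lower end point of `J`, or zero if there is none. -/
noncomputable def lowerValue (J : Set ℝ) (q : ℝ → ℝ) : ℝ := if BddBelow J then q (sInf J) else 0

namespace IsLogConcSlice
variable {J : Set ℝ} {p : ℝ → ℝ}

theorem min_le (h : IsLogConcSlice J p) {s t u : ℝ} (hs : 0 < p s) (hu : 0 < p u) (hst : s ≤ t)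
    (htu : t ≤ u) : min (p s) (p u) ≤ p t := by
  have hseg : t ∈ segment ℝ s u := by rw [segment_eq_Icc (hst.trans htu)]; exact ⟨hst, htu⟩
  have hpos : 0 < p t := h.convexOn.1.segment_subset hs hu hseg
  have := h.convexOn.le_on_segment hs hu hseg
  rcases le_max_iff.1 this with h1 | h1
  · exact (min_le_left _ _).trans ((Real.log_le_log_iff hs hpos).1 (by linarith))
  · exact (min_le_right _ _).trans ((Real.log_le_log_iff hu hpos).1 (by linarith))

theorem locallyLipschitzOn (h : IsLogConcSlice J p) :
    LocallyLipschitzOn J (fun t => -Real.log (p t)) :=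
  (h.convexOn.subset (fun t ht => h.pos t ht) h.convex).locallyLipschitzOn h.isOpen

theorem continuousOn (h : IsLogConcSlice J p) : ContinuousOn p J := by
  refine (Real.continuous_exp.comp_continuousOn h.locallyLipschitzOn.continuousOn.neg).congr
    fun x hx => ?_
  simp [Real.exp_log (h.pos x hx)]

theorem absolutelyContinuousOnInterval (h : IsLogConcSlice J p) {a b : ℝ} (hab : a ≤ b)
    (hJ : Set.Icc a b ⊆ J) : AbsolutelyContinuousOnInterval p a b := by
  obtain ⟨C, hC⟩ := (h.locallyLipschitzOn.mono hJ).exists_lipschitzOnWith_of_compact isCompact_Icc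
  have hK : IsCompact ((fun t => -(-Real.log (p t))) '' Set.Icc a b) :=
    isCompact_Icc.image_of_continuousOn ((h.locallyLipschitzOn.continuousOn.mono hJ).neg)
  obtain ⟨D, hD⟩ := ((Real.contDiff_exp (n := 1)).locallyLipschitz.locallyLipschitzOn
    (s := (fun t => -(-Real.log (p t))) '' Set.Icc a b)).exists_lipschitzOnWith_of_compact hK
  have hcomp := hD.comp hC.neg (Set.mapsTo_image _ _)
  have : LipschitzOnWith (D * C) p (Set.uIcc a b) := by
    rw [Set.uIcc_of_le hab]
    intro x hx y hy
    have := hcomp hx hy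
    simpa [Real.exp_log (h.pos _ (hJ hx)), Real.exp_log (h.pos _ (hJ hy))] using this
  exact this.absolutelyContinuousOnInterval

theorem deriv_nonpos_of_antitoneOn {q : ℝ → ℝ} {a b x : ℝ} (hq : AntitoneOn q (Set.Icc a b))
    (hx : x ∈ Set.Ioo a b) : deriv q x ≤ 0 := by
  rw [← derivWithin_of_mem_nhds (Icc_mem_nhds hx.1 hx.2)]
  exact hq.derivWithin_nonpos

theorem deriv_nonneg_of_monotoneOn {q : ℝ → ℝ} {a b x : ℝ} (hq : MonotoneOn q (Set.Icc a b))
    (hx : x ∈ Set.Ioo a b) : 0 ≤ deriv q x := by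
  rw [← derivWithin_of_mem_nhds (Icc_mem_nhds hx.1 hx.2)]
  exact hq.derivWithin_nonneg

theorem exists_peak (h : IsLogConcSlice J p) {a b : ℝ} (hab : a ≤ b) (hJ : Set.Icc a b ⊆ J) :
    ∃ c ∈ Set.Icc a b, (∀ t ∈ Set.Icc a b, p t ≤ p c) ∧ MonotoneOn p (Set.Icc a c) ∧
      AntitoneOn p (Set.Icc c b) := by
  obtain ⟨c, hc, hmax⟩ := isCompact_Icc.exists_isMaxOn (Set.nonempty_Icc.2 hab)
    (h.continuousOn.mono hJ)
  have hmax' : ∀ t ∈ Set.Icc a b, p t ≤ p c := fun t ht => hmax ht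
  refine ⟨c, hc, hmax', fun s hs t ht hst => ?_, fun s hs t ht hst => ?_⟩
  · have hs' : s ∈ Set.Icc a b := ⟨hs.1, hs.2.trans hc.2⟩
    have := h.min_le (h.pos s (hJ hs')) (h.pos c (hJ hc)) hst ht.2
    rwa [min_eq_left (hmax' s hs')] at this
  · have ht' : t ∈ Set.Icc a b := ⟨hc.1.trans ht.1, ht.2⟩
    have := h.min_le (h.pos c (hJ hc)) (h.pos t (hJ ht')) hs.1 hst
    rwa [min_eq_right (hmax' t ht')] at this

/-- The function increases up to a peak c and decreases after it, so its derivative has one sign on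
each side. Absolute continuity allows the fundamental theorem of calculus there. -/
theorem lintegral_Icc_neg_deriv (h : IsLogConcSlice J p) {a b : ℝ} (hab : a ≤ b)
    (hJ : Set.Icc a b ⊆ J) :
    ∃ c ∈ Set.Icc a b, (∀ t ∈ Set.Icc a b, p t ≤ p c) ∧
      ∫⁻ t in Set.Icc a b, ENNReal.ofReal (-deriv p t) = ENNReal.ofReal (p c - p b) ∧
      ∫⁻ t in Set.Icc a b, ENNReal.ofReal (deriv p t) = ENNReal.ofReal (p c - p a) := by
  obtain ⟨c, hc, hmax, hmono, hanti⟩ := h.exists_peak hab hJ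
  refine ⟨c, hc, hmax, ?_⟩
  have hsplit : Set.Icc a b =ᵐ[volume] (Set.Ioo a c ∪ Set.Ioo c b : Set ℝ) := by
    have h1 : Set.Icc a b = Set.Ico a c ∪ Set.Icc c b := (Set.Ico_union_Icc_eq_Icc hc.1 hc.2).symm
    rw [h1]
    exact (Ioo_ae_eq_Ico.symm).union Ioo_ae_eq_Icc.symm
  have hdis : Disjoint (Set.Ioo a c) (Set.Ioo c b) := by
    rw [Set.disjoint_left]; intro x hx hx'; exact absurd (hx.2.trans hx'.1) (lt_irrefl _)
  have hac1 := h.absolutelyContinuousOnInterval hc.1 ((Set.Icc_subset_Icc_right hc.2).trans hJ)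
  have hac2 := h.absolutelyContinuousOnInterval hc.2 ((Set.Icc_subset_Icc_left hc.1).trans hJ)
  have hint1 : IntegrableOn (deriv p) (Set.Ioo a c) := by
    have := hac1.intervalIntegrable_deriv
    rw [intervalIntegrable_iff_integrableOn_Ioo_of_le hc.1] at this
    exact this
  have hint2 : IntegrableOn (deriv p) (Set.Ioo c b) := by
    have := hac2.intervalIntegrable_deriv
    rw [intervalIntegrable_iff_integrableOn_Ioo_of_le hc.2] at this
    exact this
  have hftc1 : ∫ t in Set.Ioo a c, deriv p t = p c - p a := by
    rw [← hac1.integral_deriv_eq_sub, intervalIntegral.integral_of_le hc.1,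
      integral_Ioc_eq_integral_Ioo]
  have hftc2 : ∫ t in Set.Ioo c b, deriv p t = p b - p c := by
    rw [← hac2.integral_deriv_eq_sub, intervalIntegral.integral_of_le hc.2,
      integral_Ioc_eq_integral_Ioo]
  have hsg1 : ∀ t ∈ Set.Ioo a c, 0 ≤ deriv p t := fun t ht => deriv_nonneg_of_monotoneOn hmono ht
  have hsg2 : ∀ t ∈ Set.Ioo c b, deriv p t ≤ 0 := fun t ht => deriv_nonpos_of_antitoneOn hanti ht
  constructor
  · rw [setLIntegral_congr hsplit, lintegral_union measurableSet_Ioo hdis,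
      setLIntegral_congr_fun measurableSet_Ioo (g := fun _ => 0) (fun t ht =>
        ENNReal.ofReal_of_nonpos (neg_nonpos.2 (hsg1 t ht))), lintegral_zero, zero_add,
      ← ofReal_integral_eq_lintegral_ofReal (f := fun t => -deriv p t) hint2.neg
        ((ae_restrict_iff' measurableSet_Ioo).2 (ae_of_all _ fun t ht => neg_nonneg.2 (hsg2 t ht)))]
    rw [integral_neg, hftc2, neg_sub]
  · rw [setLIntegral_congr hsplit, lintegral_union measurableSet_Ioo hdis,
      setLIntegral_congr_fun measurableSet_Ioo (s := Set.Ioo c b) (g := fun _ => 0) (fun t ht =>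
        ENNReal.ofReal_of_nonpos (hsg2 t ht)), lintegral_zero, add_zero,
      ← ofReal_integral_eq_lintegral_ofReal hint1
        ((ae_restrict_iff' measurableSet_Ioo).2 (ae_of_all _ fun t ht => hsg1 t ht)), hftc1]

/-- Upper semicontinuity bounds the limit from above; log-concavity on the segment towards t₀ bounds
it from below. Thus the value at an end point of J is the limit from inside. -/
theorem tendsto_toward_end (h : IsLogConcSlice J p) {t t₀ : ℝ} (ht₀ : t₀ ∈ J) {u : ℕ → ℝ}
    (hu : Tendsto u atTop (𝓝 0)) (hu0 : ∀ j, 0 ≤ u j ∧ u j ≤ 1) :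
    Tendsto (fun j => p ((1 - u j) * t + u j * t₀)) atTop (𝓝 (p t)) := by
  have hlim : Tendsto (fun j => (1 - u j) * t + u j * t₀) atTop (𝓝 t) := by
    simpa using ((tendsto_const_nhds (x := (1 : ℝ)).sub hu).mul_const t).add (hu.mul_const t₀)
  refine tendsto_order.2 ⟨fun y hy => ?_, fun y hy => hlim.eventually (h.usc t y hy)⟩
  rcases (h.nonneg t).eq_or_lt with h0 | h0
  · exact Eventually.of_forall fun j => (h0 ▸ hy).trans_le (h.nonneg _)
  have hlim2 : Tendsto (fun j => Real.exp ((1 - u j) * Real.log (p t) + u j * Real.log (p t₀)))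
      atTop (𝓝 (p t)) := by
    have : Tendsto (fun j => (1 - u j) * Real.log (p t) + u j * Real.log (p t₀)) atTop
        (𝓝 (Real.log (p t))) := by
      simpa using ((tendsto_const_nhds (x := (1 : ℝ)).sub hu).mul_const (Real.log (p t))).add
        (hu.mul_const (Real.log (p t₀)))
    have h' := (Real.continuous_exp.tendsto _).comp this
    rwa [Real.exp_log h0] at h'
  filter_upwards [hlim2.eventually (lt_mem_nhds hy)] with j hj
  refine hj.trans_le ?_
  have h1 := h.convexOn.1 h0 (h.pos t₀ ht₀) (sub_nonneg.2 (hu0 j).2) (hu0 j).1 (by ring)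
  have h2 := h.convexOn.2 h0 (h.pos t₀ ht₀) (sub_nonneg.2 (hu0 j).2) (hu0 j).1 (by ring)
  simp only [smul_eq_mul] at h1 h2
  have h1 : 0 < p ((1 - u j) * t + u j * t₀) := h1
  rw [← Real.le_log_iff_exp_le h1]
  linarith

theorem combo_mem (h : IsLogConcSlice J p) {t t₀ u : ℝ} (ht₀ : t₀ ∈ J) (ht : t ∈ closure J)
    (hu : 0 < u) (hu1 : u ≤ 1) : (1 - u) * t + u * t₀ ∈ J := by
  have := h.convex.combo_interior_closure_mem_interior (h.isOpen.interior_eq.symm ▸ ht₀) ht hu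
    (sub_nonneg.2 hu1) (by ring)
  rw [h.isOpen.interior_eq] at this
  simpa [add_comm] using this

theorem exists_mem_lt (h : IsLogConcSlice J p) {t y : ℝ} (hy0 : 0 ≤ y) (hy : y < p t) :
    ∃ s ∈ J, y < p s := by
  obtain ⟨t₀, ht₀⟩ := h.nonempty
  have ht := h.supp t (hy0.trans_lt hy)
  have hu0 : ∀ j : ℕ, 0 ≤ 1 / ((j : ℝ) + 1) ∧ 1 / ((j : ℝ) + 1) ≤ 1 := fun j =>
    ⟨by positivity, by rw [div_le_one (by positivity)]; linarith [Nat.cast_nonneg (α := ℝ) j]⟩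
  have := h.tendsto_toward_end (t := t) ht₀ tendsto_one_div_add_atTop_nhds_zero_nat hu0
  obtain ⟨j, hj⟩ := (this.eventually (lt_mem_nhds hy)).exists
  exact ⟨_, h.combo_mem ht₀ ht (by positivity) (hu0 j).2, hj⟩

/-- Exhausting sequences towards the upper end of `J`. -/
theorem exists_seq_upper (h : IsLogConcSlice J p) {t₀ : ℝ} (ht₀ : t₀ ∈ J) :
    ∃ b : ℕ → ℝ, Monotone b ∧ (∀ j, t₀ ≤ b j) ∧ (∀ j, b j ∈ J) ∧ (∀ t ∈ J, ∃ j, t ≤ b j) ∧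
      ∀ g : ℝ → ℝ, Continuous g → (∃ M, ∀ t, |g t| ≤ M) →
        Tendsto (fun j => g (b j) * p (b j)) atTop (𝓝 (upperValue J fun t => g t * p t)) := by
  by_cases hb : BddAbove J
  · set β := sSup J with hβ
    have hβc : β ∈ closure J := csSup_mem_closure h.nonempty hb
    have hle : t₀ ≤ β := le_csSup hb ht₀
    set u : ℕ → ℝ := fun j => 1 / ((j : ℝ) + 1) with hudef
    have hu0 : ∀ j : ℕ, 0 ≤ u j ∧ u j ≤ 1 := fun j =>
      ⟨by positivity, by rw [hudef, div_le_one (by positivity)]; linarith [Nat.cast_nonneg (α := ℝ) j]⟩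
    have hulim : Tendsto u atTop (𝓝 0) := tendsto_one_div_add_atTop_nhds_zero_nat
    have hlim : Tendsto (fun j => (1 - u j) * β + u j * t₀) atTop (𝓝 β) := by
      simpa using ((tendsto_const_nhds (x := (1 : ℝ)).sub hulim).mul_const β).add (hulim.mul_const t₀)
    refine ⟨fun j => (1 - u j) * β + u j * t₀, fun i j hij => ?_, fun j => ?_, fun j =>
      h.combo_mem ht₀ hβc (by positivity) (hu0 j).2, fun t ht => ?_, fun g hg _ => ?_⟩
    · have : u j ≤ u i := by simp only [hudef]; gcongr
      dsimp only
      nlinarith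
    · have := (hu0 j).2
      nlinarith
    · have hlt : t < β := by
        refine lt_of_le_of_ne (le_csSup hb ht) ?_
        rintro rfl
        obtain ⟨ε, hε, hball⟩ := Metric.isOpen_iff.1 h.isOpen _ ht
        have : β + ε / 2 ∈ J := hball (by
          rw [mem_ball_iff_norm, add_sub_cancel_left, Real.norm_of_nonneg (by positivity)]; linarith)
        linarith [le_csSup hb this]
      obtain ⟨j, hj⟩ := (hlim.eventually (lt_mem_nhds hlt)).exists
      exact ⟨j, hj.le⟩
    · rw [upperValue, if_pos hb]
      exact ((hg.tendsto β).comp hlim).mul (h.tendsto_toward_end ht₀ hulim hu0)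
  · have hge : ∀ s, t₀ ≤ s → s ∈ J := by
      intro s hs
      rw [not_bddAbove_iff] at hb
      obtain ⟨w, hw, hsw⟩ := hb s
      exact h.convex.ordConnected.out ht₀ hw ⟨hs, hsw.le⟩
    have hlim : Tendsto (fun j : ℕ => t₀ + j) atTop atTop :=
      tendsto_atTop_add_const_left _ _ tendsto_natCast_atTop_atTop
    refine ⟨fun j => t₀ + j, fun i j hij => by simpa using hij, fun j => by simp, fun j =>
      hge _ (by simp), fun t ht => ?_, fun g hg hM => ?_⟩
    · obtain ⟨j, hj⟩ := exists_nat_ge (t - t₀)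
      exact ⟨j, by linarith⟩
    -- Without an upper end point the boundary term vanishes by decay of p at infinity, in agreement
    -- with the default 0 of `upperValue`.
    · rw [upperValue, if_neg hb]
      obtain ⟨M, hM⟩ := hM
      refine squeeze_zero_norm (a := fun j : ℕ => M * p (t₀ + j)) (fun j => ?_) ?_
      · rw [norm_mul, Real.norm_eq_abs, Real.norm_of_nonneg (h.nonneg _)]
        exact mul_le_mul_of_nonneg_right (hM _) (h.nonneg _)
      · simpa using (h.tendsto_atTop.comp hlim).const_mul M

/-- Reduces every statement about the lower end to one about the upper end. -/
theorem reflect (h : IsLogConcSlice J p) : IsLogConcSlice (-J) (fun t => p (-t)) where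
  isOpen := h.isOpen.neg
  convex := h.convex.neg
  nonempty := h.nonempty.neg
  nonneg t := h.nonneg _
  usc := h.usc.comp continuous_neg
  convexOn := by
    have hneg : ∀ a b x y : ℝ, -(a • x + b • y) = a • -x + b • -y := fun a b x y => by
      simp only [smul_eq_mul]; ring
    refine ⟨fun x hx y hy a b ha hb hab => ?_, fun x hx y hy a b ha hb hab => ?_⟩
    · have := h.convexOn.1 (x := -x) hx (y := -y) hy ha hb hab
      rwa [← hneg] at this
    · have := h.convexOn.2 (x := -x) hx (y := -y) hy ha hb hab
      rwa [← hneg] at this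
  pos t ht := h.pos _ ht
  supp t ht := by
    have := h.supp _ ht
    change t ∈ closure (Homeomorph.neg ℝ ⁻¹' J)
    rw [← Homeomorph.preimage_closure]
    exact this
  tendsto_atTop := h.tendsto_atBot.comp tendsto_neg_atTop_atBot
  tendsto_atBot := h.tendsto_atTop.comp tendsto_neg_atBot_atTop

theorem exists_seq_lower (h : IsLogConcSlice J p) {t₀ : ℝ} (ht₀ : t₀ ∈ J) :
    ∃ a : ℕ → ℝ, Antitone a ∧ (∀ j, a j ≤ t₀) ∧ (∀ j, a j ∈ J) ∧ (∀ t ∈ J, ∃ j, a j ≤ t) ∧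
      ∀ g : ℝ → ℝ, Continuous g → (∃ M, ∀ t, |g t| ≤ M) →
        Tendsto (fun j => g (a j) * p (a j)) atTop (𝓝 (lowerValue J fun t => g t * p t)) := by
  obtain ⟨b, h1, h2, h3, h4, h5⟩ := h.reflect.exists_seq_upper (t₀ := -t₀) (by simpa using ht₀)
  refine ⟨fun j => -b j, fun i j hij => neg_le_neg (h1 hij), fun j => by linarith [h2 j],
    fun j => by simpa using h3 j, fun t ht => ?_, fun g hg hM => ?_⟩
  · obtain ⟨j, hj⟩ := h4 (-t) (by simpa using ht)
    exact ⟨j, by linarith⟩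
  · have := h5 (fun t => g (-t)) (hg.comp continuous_neg) (by
      obtain ⟨M, hM⟩ := hM; exact ⟨M, fun t => hM _⟩)
    convert this using 2
    by_cases hb : BddBelow J
    · rw [upperValue, lowerValue, if_pos hb, if_pos (bddAbove_neg.2 hb), Real.sSup_neg, neg_neg]
    · rw [upperValue, lowerValue, if_neg hb, if_neg (mt bddAbove_neg.1 hb)]

/-- An exhaustion of `J` by compact intervals. -/
theorem exists_exhaustion (h : IsLogConcSlice J p) :
    ∃ a b : ℕ → ℝ, (∀ j, a j ≤ b j) ∧ (∀ j, Set.Icc (a j) (b j) ⊆ J) ∧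
      Monotone (fun j => Set.Icc (a j) (b j)) ∧ ⋃ j, Set.Icc (a j) (b j) = J ∧
      (∀ g : ℝ → ℝ, Continuous g → (∃ M, ∀ t, |g t| ≤ M) →
        Tendsto (fun j => g (a j) * p (a j)) atTop (𝓝 (lowerValue J fun t => g t * p t))) ∧
      (∀ g : ℝ → ℝ, Continuous g → (∃ M, ∀ t, |g t| ≤ M) →
        Tendsto (fun j => g (b j) * p (b j)) atTop (𝓝 (upperValue J fun t => g t * p t))) := by
  obtain ⟨t₀, ht₀⟩ := h.nonempty
  obtain ⟨b, b1, b2, b3, b4, b5⟩ := h.exists_seq_upper ht₀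
  obtain ⟨a, a1, a2, a3, a4, a5⟩ := h.exists_seq_lower ht₀
  have hsub : ∀ j, Set.Icc (a j) (b j) ⊆ J := fun j => h.convex.ordConnected.out (a3 j) (b3 j)
  refine ⟨a, b, fun j => (a2 j).trans (b2 j), hsub, fun i j hij =>
    Set.Icc_subset_Icc (a1 hij) (b1 hij), Set.Subset.antisymm (Set.iUnion_subset hsub) ?_, a5, b5⟩
  intro t ht
  obtain ⟨i, hi⟩ := a4 t ht
  obtain ⟨j, hj⟩ := b4 t ht
  exact Set.mem_iUnion.2 ⟨max i j, (a1 (le_max_left i j)).trans hi, hj.trans (b1 (le_max_right i j))⟩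

theorem bddAbove_range (h : IsLogConcSlice J p) : BddAbove (Set.range p) := by
  obtain ⟨A, hA⟩ := eventually_atTop.1 (h.tendsto_atTop.eventually (gt_mem_nhds one_pos))
  obtain ⟨B, hB⟩ := eventually_atBot.1 (h.tendsto_atBot.eventually (gt_mem_nhds one_pos))
  obtain ⟨M, hM⟩ := (h.usc.upperSemicontinuousOn (Set.Icc B A)).bddAbove_of_isCompact isCompact_Icc
  refine ⟨max M 1, ?_⟩
  rintro _ ⟨t, rfl⟩
  rcases le_total A t with h1 | h1
  · exact (hA t h1).le.trans (le_max_right _ _)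
  rcases le_total t B with h2 | h2
  · exact (hB t h2).le.trans (le_max_right _ _)
  exact (hM (Set.mem_image_of_mem p ⟨h2, h1⟩)).trans (le_max_left _ _)

theorem upperValue_nonneg (h : IsLogConcSlice J p) : 0 ≤ upperValue J p := by
  rw [upperValue]; split_ifs
  · exact h.nonneg _
  · exact le_rfl

/-- The negative variation of a log-concave function is its maximum. -/
theorem lintegral_neg_deriv_add (h : IsLogConcSlice J p) :
    (∫⁻ t in J, ENNReal.ofReal (-deriv p t)) + ENNReal.ofReal (upperValue J p) =
      ENNReal.ofReal (⨆ t, p t) := by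
  obtain ⟨a, b, hab, hJ, hmono, hU, -, hb⟩ := h.exists_exhaustion
  choose c hc hmax hneg hpos using fun j => h.lintegral_Icc_neg_deriv (hab j) (hJ j)
  have hblim := hb (fun _ => 1) continuous_const ⟨1, by simp⟩
  simp only [one_mul] at hblim
  -- The peak values on the exhausting intervals reach the global supremum, since `exists_mem_lt`
  -- finds near-maximal points inside J.
  have hclim : Tendsto (fun j => p (c j)) atTop (𝓝 (⨆ t, p t)) := by
    refine tendsto_order.2 ⟨fun y hy => ?_, fun y hy => Eventually.of_forall fun j =>
      (le_ciSup h.bddAbove_range _).trans_lt hy⟩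
    rcases lt_or_ge y 0 with h0 | h0
    · exact Eventually.of_forall fun j => h0.trans_le (h.nonneg _)
    obtain ⟨t, ht⟩ := exists_lt_of_lt_ciSup hy
    obtain ⟨s, hsJ, hs⟩ := h.exists_mem_lt h0 ht
    rw [← hU, Set.mem_iUnion] at hsJ
    obtain ⟨j, hj⟩ := hsJ
    filter_upwards [eventually_ge_atTop j] with i hi
    exact hs.trans_le (hmax i s (hmono hi hj))
  have hlim1 : Tendsto (fun j => ∫⁻ t in Set.Icc (a j) (b j), ENNReal.ofReal (-deriv p t)) atTop
      (𝓝 (∫⁻ t in J, ENNReal.ofReal (-deriv p t))) := by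
    rw [← hU, setLIntegral_iUnion_of_directed _ hmono.directed_le]
    exact tendsto_atTop_iSup fun i j hij => lintegral_mono_set (hmono hij)
  have hlim2 : Tendsto (fun j => ENNReal.ofReal (p (c j) - p (b j))) atTop
      (𝓝 (ENNReal.ofReal ((⨆ t, p t) - upperValue J p))) :=
    ENNReal.tendsto_ofReal (hclim.sub hblim)
  rw [tendsto_nhds_unique (hlim1.congr hneg) hlim2, ← ENNReal.ofReal_add _ h.upperValue_nonneg,
    sub_add_cancel]
  have : upperValue J p ≤ ⨆ t, p t :=
    le_of_tendsto hblim (Eventually.of_forall fun j => le_ciSup h.bddAbove_range _)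
  linarith

theorem integrableOn_deriv (h : IsLogConcSlice J p) : IntegrableOn (deriv p) J := by
  obtain ⟨a, b, hab, hJ, hmono, hU, -, -⟩ := h.exists_exhaustion
  choose c hc hmax hneg hpos using fun j => h.lintegral_Icc_neg_deriv (hab j) (hJ j)
  refine ⟨(measurable_deriv p).aestronglyMeasurable, ?_⟩
  rw [HasFiniteIntegral]
  have hbd : ∀ j, ∫⁻ t in Set.Icc (a j) (b j), ‖deriv p t‖ₑ ≤ 2 * ENNReal.ofReal (⨆ t, p t) := by
    intro j
    have : ∀ t, ‖deriv p t‖ₑ ≤ ENNReal.ofReal (-deriv p t) + ENNReal.ofReal (deriv p t) := by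
      intro t
      rw [Real.enorm_eq_ofReal_abs]
      rcases le_total 0 (deriv p t) with h0 | h0
      · rw [abs_of_nonneg h0]; exact le_add_self
      · rw [abs_of_nonpos h0]; exact le_self_add
    refine (lintegral_mono this).trans ?_
    rw [lintegral_add_left
      (show Measurable fun t => ENNReal.ofReal (-deriv p t) from (measurable_deriv p).neg.ennreal_ofReal), hneg, hpos, two_mul]
    gcongr
    · have := le_ciSup h.bddAbove_range (c j); linarith [h.nonneg (b j)]
    · have := le_ciSup h.bddAbove_range (c j); linarith [h.nonneg (a j)]
  rw [← hU, setLIntegral_iUnion_of_directed _ hmono.directed_le]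
  exact (iSup_le hbd).trans_lt (ENNReal.mul_lt_top (by simp) ENNReal.ofReal_lt_top)

/-- Integration by parts for a log-concave function. -/
theorem integral_mul_deriv (h : IsLogConcSlice J p) (hp : Integrable p) {g : ℝ → ℝ}
    (hg : ContDiff ℝ 1 g) {M : ℝ} (hM : ∀ t, |g t| ≤ M) (hM' : ∀ t, |deriv g t| ≤ M) :
    ∫ t in J, g t * deriv p t = upperValue J (fun t => g t * p t) -
      lowerValue J (fun t => g t * p t) - ∫ t, deriv g t * p t := by
  obtain ⟨a, b, hab, hJ, hmono, hU, ha, hb⟩ := h.exists_exhaustion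
  have hgc := hg.continuous
  have hgd : Continuous (deriv g) := hg.continuous_deriv le_rfl
  have hi1 : IntegrableOn (fun t => g t * deriv p t) (⋃ j, Set.Icc (a j) (b j)) := by
    rw [hU]
    exact h.integrableOn_deriv.bdd_mul (c := M) hgc.aestronglyMeasurable (ae_of_all _ hM)
  have hi2 : Integrable (fun t => deriv g t * p t) :=
    hp.bdd_mul (c := M) hgd.aestronglyMeasurable (ae_of_all _ hM')
  have hlim1 := tendsto_setIntegral_of_monotone (fun j => measurableSet_Icc) hmono hi1
  have hlim2 := tendsto_setIntegral_of_monotone (fun j => measurableSet_Icc (a := a j) (b := b j)) hmono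
    hi2.integrableOn
  rw [hU] at hlim1 hlim2
  have hzero : ∫ t in J, deriv g t * p t = ∫ t, deriv g t * p t := by
    have hfr : ∀ᵐ t : ℝ, t ∉ frontier J := measure_eq_zero_iff_ae_notMem.1
      (h.convex.addHaar_frontier volume)
    rw [← integral_indicator h.isOpen.measurableSet]
    refine integral_congr_ae ?_
    filter_upwards [hfr] with t ht
    by_cases htJ : t ∈ J
    · rw [Set.indicator_of_mem htJ]
    · rw [Set.indicator_of_notMem htJ]
      have : p t = 0 := by
        by_contra h0
        have hc := h.supp t (lt_of_le_of_ne (h.nonneg t) (Ne.symm h0))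
        exact ht ⟨hc, by rwa [h.isOpen.interior_eq]⟩
      rw [this, mul_zero]
  rw [hzero] at hlim2
  have hpart : ∀ j, ∫ t in Set.Icc (a j) (b j), g t * deriv p t =
      g (b j) * p (b j) - g (a j) * p (a j) - ∫ t in Set.Icc (a j) (b j), deriv g t * p t := by
    intro j
    have hac := h.absolutelyContinuousOnInterval (hab j) (hJ j)
    have hgac : AbsolutelyContinuousOnInterval g (a j) (b j) :=
      hg.contDiffOn.absolutelyContinuousOnInterval
    have := hgac.integral_mul_deriv_eq_deriv_mul hac
    rwa [intervalIntegral.integral_of_le (hab j), intervalIntegral.integral_of_le (hab j),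
      ← integral_Icc_eq_integral_Ioc, ← integral_Icc_eq_integral_Ioc] at this
  exact tendsto_nhds_unique (hlim1.congr hpart)
    (((hb g hgc ⟨M, hM⟩).sub (ha g hgc ⟨M, hM⟩)).sub hlim2)

end IsLogConcSlice

/-! ### Directional variation through slicing -/

/-- The bound y^N / N! ≤ exp y with y = a(1 + ‖x‖) compares the exponential with an integrable power
of 1 + ‖x‖. -/
theorem integrable_exp_neg_mul_norm {E : Type*} [NormedAddCommGroup E] [NormedSpace ℝ E]
    [FiniteDimensional ℝ E] [MeasurableSpace E] [BorelSpace E] (μ : Measure E) [μ.IsAddHaarMeasure]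
    {a : ℝ} (ha : 0 < a) : Integrable (fun x : E => Real.exp (-(a * ‖x‖))) μ := by
  set N : ℕ := Module.finrank ℝ E + 1 with hN
  have hint : Integrable (fun x : E => (1 + ‖x‖) ^ (-(N : ℝ))) μ :=
    integrable_one_add_norm (by rw [hN]; push_cast; linarith)
  refine (hint.const_mul (N.factorial * Real.exp a / a ^ N)).mono' (by fun_prop)
    (ae_of_all _ fun x => ?_)
  rw [Real.norm_of_nonneg (Real.exp_pos _).le, Real.rpow_neg (by positivity), Real.rpow_natCast]
  have h1 := Real.pow_div_factorial_le_exp (a * (1 + ‖x‖)) (by positivity) N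
  have h2 : (0 : ℝ) < N.factorial := by exact_mod_cast N.factorial_pos
  have h3 : 0 < (1 + ‖x‖) ^ N := by positivity
  rw [Real.exp_neg, ← div_eq_mul_inv, le_div_iff₀ h3, inv_mul_le_iff₀ (Real.exp_pos _)]
  rw [div_le_iff₀ h2, mul_pow, mul_add, mul_one, Real.exp_add] at h1
  rw [← mul_div_assoc, le_div_iff₀ (by positivity)]
  linarith

section slices
variable {m : ℕ} {f : Rn (m + 1) → ℝ} (F : Frame m)

theorem Frame.abs_le_norm_pt (y : Rn m) (t : ℝ) : |t| ≤ ‖F.pt y t‖ :=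
  abs_le_of_sq_le_sq (by rw [F.norm_pt_sq]; nlinarith [sq_nonneg ‖y‖]) (norm_nonneg _)

theorem Frame.norm_le_norm_pt (y : Rn m) (t : ℝ) : ‖y‖ ≤ ‖F.pt y t‖ :=
  le_of_sq_le_sq (by rw [F.norm_pt_sq]; nlinarith [sq_nonneg t]) (norm_nonneg _)

/-- Decay in y dominates integrals over the base, decay in t controls each line; the constants do
not depend on the frame. -/
theorem IsLogConc.slice_exp_bound (hf : IsLogConc f) :
    ∃ C > 0, ∃ a > 0, ∀ (F : Frame m) y t, f (F.pt y t) ≤ C * Real.exp (-(a * ‖y‖)) ∧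
      f (F.pt y t) ≤ C * Real.exp (-(a * ‖t‖)) := by
  obtain ⟨C, hC, a, ha, h⟩ := hf.exists_exp_bound
  refine ⟨C, hC, a, ha, fun F y t => ⟨(h _).trans ?_, (h _).trans ?_⟩⟩
  · gcongr; exact F.norm_le_norm_pt y t
  · gcongr; exact F.abs_le_norm_pt y t

theorem Frame.continuous_pt_right (y : Rn m) : Continuous fun t => F.pt y t :=
  F.continuous_pt.comp (Continuous.prodMk_right y)

theorem IsLogConc.integrable_slice (hf : IsLogConc f) (y : Rn m) :
    Integrable fun t => f (F.pt y t) := by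
  obtain ⟨C, -, a, ha, h⟩ := hf.slice_exp_bound
  refine ((integrable_exp_neg_mul_norm volume ha).const_mul C).mono'
    (hf.measurable.comp (F.continuous_pt_right y).measurable).aestronglyMeasurable
    (ae_of_all _ fun t => ?_)
  rw [Real.norm_of_nonneg (hf.nonneg _)]
  exact (h F y t).2

theorem IsLogConc.isLogConcSlice (hf : IsLogConc f) {y : Rn m}
    (hy : (F.slice (supp f) y).Nonempty) :
    IsLogConcSlice (F.slice (supp f) y) (fun t => f (F.pt y t)) := by
  obtain ⟨C, hC, a, ha, hbound⟩ := hf.slice_exp_bound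
  have hexp : ∀ l : Filter ℝ, Tendsto (fun t : ℝ => ‖t‖) l atTop →
      Tendsto (fun t => f (F.pt y t)) l (𝓝 0) := by
    intro l hl
    refine squeeze_zero (fun t => hf.nonneg _) (fun t => (hbound F y t).2) ?_
    have : Tendsto (fun t : ℝ => -(a * ‖t‖)) l atBot :=
      tendsto_neg_atTop_atBot.comp (hl.const_mul_atTop ha)
    simpa using (Real.tendsto_exp_atBot.comp this).const_mul C
  refine ⟨F.isOpen_slice y, F.convex_slice hf.convex_supp y, hy, fun t => hf.nonneg _,
    hf.usc.comp (F.continuous_pt_right y), ⟨?_, ?_⟩, fun t ht => hf.pos_of_mem_interior ht,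
    fun t ht => ?_, hexp _ tendsto_norm_atTop_atTop, hexp _ tendsto_abs_atBot_atTop⟩
  · intro s hs t ht a b ha hb hab
    have := hf.convexOn.1 hs ht ha hb hab
    rw [← F.pt_combo y hab] at this
    exact this
  · intro s hs t ht a b ha hb hab
    have := hf.convexOn.2 hs ht ha hb hab
    rw [← F.pt_combo y hab] at this
    exact this
  · have htK : F.pt y t ∈ supp f := subset_closure ht
    obtain ⟨s, hs⟩ := hy
    rcases lt_trichotomy s t with h | rfl | h
    · refine closure_mono (s := Set.Ioo s t) (fun u hu => F.mem_slice_of_between hf.convex_supp hs htK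
        (Or.inl ⟨hu.1.le, hu.2⟩)) ?_
      rw [closure_Ioo h.ne]; exact Set.right_mem_Icc.2 h.le
    · exact subset_closure hs
    · refine closure_mono (s := Set.Ioo t s) (fun u hu => F.mem_slice_of_between hf.convex_supp hs htK
        (Or.inr ⟨hu.1, hu.2.le⟩)) ?_
      rw [closure_Ioo h.ne]; exact Set.left_mem_Icc.2 h.le

/-- Almost every line that misses the interior of the support misses the support. -/
theorem IsLogConc.ae_slice_nonempty_or (hf : IsLogConc f) :
    ∀ᵐ y : Rn m, (F.slice (supp f) y).Nonempty ∨ ∀ t, f (F.pt y t) = 0 := by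
  -- Ω is the projection of the convex interior, so its frontier is null. A line that misses the
  -- interior but meets the support lies over a point of that frontier.
  set Ω : Set (Rn m) := {y | (F.slice (supp f) y).Nonempty} with hΩ
  have hΩeq : Ω = F.proj '' interior (supp f) := by
    ext y
    constructor
    · rintro ⟨t, ht⟩; exact ⟨_, ht, F.proj_pt y t⟩
    · rintro ⟨x, hx, rfl⟩
      exact ⟨inner ℝ x F.e, by rw [Frame.slice, Set.mem_ofPred_eq, F.pt_proj]; exact hx⟩
  have hconv : Convex ℝ Ω := by
    rw [hΩeq]
    exact hf.convex_supp.interior.linear_image F.proj.toLinearMap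
  have hfr : ∀ᵐ y : Rn m, y ∉ frontier Ω := measure_eq_zero_iff_ae_notMem.1
    (hconv.addHaar_frontier volume)
  filter_upwards [hfr] with y hy
  by_contra! hcon
  obtain ⟨hne, t, ht⟩ := hcon
  have hK : F.pt y t ∈ supp f := by
    by_contra h
    exact ht (hf.eq_zero_of_notMem h)
  rw [← closure_interior_eq_of_convex (isClosed_supp f) hf.convex_supp hf.interior_supp_nonempty] at hK
  have hcl : y ∈ closure Ω := by
    rw [hΩeq]
    have := image_closure_subset_closure_image F.proj.continuous (Set.mem_image_of_mem F.proj hK)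
    rwa [F.proj_pt] at this
  refine hy ⟨hcl, fun h => ?_⟩
  have : y ∈ Ω := interior_subset h
  rw [hΩ, Set.mem_ofPred_eq, hne] at this
  exact Set.not_nonempty_empty this

/-- The gradient of `-log f`. -/
noncomputable def gradNegLog {n : ℕ} (f : Rn n → ℝ) : Rn n → Rn n :=
  gradient fun x => -Real.log (f x)

theorem measurable_gradNegLog {n : ℕ} (f : Rn n → ℝ) : Measurable (gradNegLog f) :=
  measurable_gradient _

theorem IsLogConc.deriv_slice (hf : IsLogConc f) {y : Rn m} {t : ℝ}
    (ht : t ∈ F.slice (supp f) y)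
    (hd : DifferentiableAt ℝ (fun x => -Real.log (f x)) (F.pt y t)) :
    -deriv (fun t => f (F.pt y t)) t = f (F.pt y t) * inner ℝ (gradNegLog f (F.pt y t)) F.e := by
  have h1 : HasDerivAt (fun t : ℝ => F.pt y t) F.e t := by
    simpa [Frame.pt] using ((hasDerivAt_id t).smul_const F.e).const_add (F.ι y)
  have h2 : HasDerivAt (fun t => -Real.log (f (F.pt y t)))
      (fderiv ℝ (fun x => -Real.log (f x)) (F.pt y t) F.e) t := hd.hasFDerivAt.comp_hasDerivAt t h1
  have h3 := h2.neg.exp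
  have hev : (fun t => f (F.pt y t)) =ᶠ[𝓝 t] fun t => Real.exp (-(-Real.log (f (F.pt y t)))) := by
    filter_upwards [(F.isOpen_slice y).mem_nhds ht] with s hs
    rw [neg_neg, Real.exp_log (hf.pos_of_mem_interior hs)]
  have h4 := h3.congr_of_eventuallyEq hev
  rw [h4.deriv, gradNegLog, inner_gradient]
  simp only [Pi.neg_apply, neg_neg]
  rw [Real.exp_log (hf.pos_of_mem_interior ht)]
  ring

theorem Frame.ae_ae_of_ae {P : Rn (m + 1) → Prop} (h : ∀ᵐ x, P x) :
    ∀ᵐ y : Rn m, ∀ᵐ t : ℝ, P (F.pt y t) :=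
  Measure.ae_ae_of_ae_prod (F.measurePreserving_mequiv.quasiMeasurePreserving.ae h)

theorem IsLogConc.ae_deriv_slice (hf : IsLogConc f) :
    ∀ᵐ y : Rn m, ∀ᵐ t : ℝ, t ∈ F.slice (supp f) y →
      -deriv (fun t => f (F.pt y t)) t = f (F.pt y t) * inner ℝ (gradNegLog f (F.pt y t)) F.e := by
  filter_upwards [F.ae_ae_of_ae hf.ae_differentiableAt] with y hy
  filter_upwards [hy] with t ht hs
  exact hf.deriv_slice F hs (ht hs)

theorem IsLogConc.ae_mem_slice_or (hf : IsLogConc f) :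
    ∀ᵐ y : Rn m, ∀ᵐ t : ℝ, t ∈ F.slice (supp f) y ∨ f (F.pt y t) = 0 := by
  have : ∀ᵐ x, x ∉ frontier (supp f) := measure_eq_zero_iff_ae_notMem.1
    (hf.convex_supp.addHaar_frontier volume)
  filter_upwards [F.ae_ae_of_ae this] with y hy
  filter_upwards [hy] with t ht
  by_contra! hcon
  exact ht ⟨subset_closure (by_contra fun h => hcon.2 (hf.eq_zero_of_notMem
    fun h' => h h')), hcon.1⟩

theorem Frame.lintegral_eq {g : Rn (m + 1) → ENNReal} (hg : Measurable g) :
    ∫⁻ x, g x = ∫⁻ y : Rn m, ∫⁻ t : ℝ, g (F.pt y t) := by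
  rw [← F.measurePreserving_mequiv.lintegral_comp hg]
  exact lintegral_prod _ (hg.comp F.mequiv.measurable).aemeasurable

theorem Frame.integral_eq {g : Rn (m + 1) → ℝ} (hg : Integrable g) :
    ∫ x, g x = ∫ y : Rn m, ∫ t : ℝ, g (F.pt y t) := by
  rw [← F.measurePreserving_mequiv.integral_comp F.mequiv.measurableEmbedding]
  exact integral_prod _ ((F.measurePreserving_mequiv.integrable_comp_emb
    F.mequiv.measurableEmbedding).2 hg)

/-- The surface measure on the boundary of the support, weighted by `f`. -/
noncomputable def boundaryMeasure (f : Rn (m + 1) → ℝ) : Measure (Rn (m + 1)) :=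
  ((μHE[m] : Measure (Rn (m + 1))).restrict (frontier (supp f))).withDensity
    fun x => ENNReal.ofReal (f x)

/-- The measure with density `f`. -/
noncomputable def bulkMeasure {n : ℕ} (f : Rn n → ℝ) : Measure (Rn n) :=
  volume.withDensity fun x => ENNReal.ofReal (f x)

/-- The projection formula, with the density f carried along: the facing part of the boundary
becomes an integral of values at the upper ends of lines. -/
theorem IsLogConc.lintegral_boundary (hf : IsLogConc f) {g : Rn (m + 1) → ENNReal}
    (hg : Measurable g) :
    ∫⁻ x, g x * ENNReal.ofReal (inner ℝ (gaussMap (supp f) x : Rn (m + 1)) F.e) ∂(boundaryMeasure f) =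
      ∫⁻ y in F.topDomain (supp f), ENNReal.ofReal (f (F.topPoint (supp f) y)) *
        g (F.topPoint (supp f) y) := by
  have hfm := hf.measurable.ennreal_ofReal
  have hnm := (F.measurable_inner_gaussMap (K := supp f)).ennreal_ofReal
  have hgn : Measurable fun x => g x *
      ENNReal.ofReal (inner ℝ (gaussMap (supp f) x : Rn (m + 1)) F.e) := hg.mul hnm
  have hfg : Measurable fun x => ENNReal.ofReal (f x) * g x := hfm.mul hg
  rw [boundaryMeasure, lintegral_withDensity_eq_lintegral_mul _ hfm hgn]
  have : (volume.restrict (F.topDomain (supp f))).map (F.topPoint (supp f)) =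
      F.boundaryFlux (supp f) :=
    (F.boundaryFlux_eq_map (isClosed_supp f) hf.convex_supp hf.interior_supp_nonempty).symm
  rw [← lintegral_map (f := fun x => ENNReal.ofReal (f x) * g x) hfg F.measurable_topPoint,
    this, Frame.boundaryFlux, lintegral_withDensity_eq_lintegral_mul _ hnm hfg]
  refine lintegral_congr fun x => ?_
  simp only [Pi.mul_apply]
  ring

/-- The positive variation of `f` in the direction `e` is the integral of the maxima of `f` along
the lines parallel to `e`. -/
theorem IsLogConc.lintegral_pos_variation (hf : IsLogConc f) :
    (∫⁻ x, ENNReal.ofReal (inner ℝ (gradNegLog f x) F.e) ∂(bulkMeasure f)) +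
      ∫⁻ x, ENNReal.ofReal (inner ℝ (gaussMap (supp f) x : Rn (m + 1)) F.e) ∂(boundaryMeasure f) =
    ∫⁻ y : Rn m, ENNReal.ofReal (⨆ t, f (F.pt y t)) := by
  have hfm := hf.measurable.ennreal_ofReal
  have hgm : Measurable fun x => ENNReal.ofReal (inner ℝ (gradNegLog f x) F.e) :=
    ((measurable_gradNegLog f).inner_const).ennreal_ofReal
  have hbm : Measurable ((F.topDomain (supp f)).indicator
      fun y => ENNReal.ofReal (f (F.topPoint (supp f) y))) :=
    (hfm.comp F.measurable_topPoint).indicator F.measurableSet_topDomain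
  have h2 := hf.lintegral_boundary F (g := fun _ => 1) measurable_const
  simp only [one_mul, mul_one] at h2
  rw [h2, bulkMeasure, lintegral_withDensity_eq_lintegral_mul _ hfm hgm, F.lintegral_eq (hfm.mul hgm),
    ← lintegral_indicator F.measurableSet_topDomain, ← lintegral_add_right _ hbm]
  refine lintegral_congr_ae ?_
  -- On almost every line the bulk term is the negative variation of the slice and the boundary term
  -- its value at the upper end; together they give the maximum.
  filter_upwards [hf.ae_deriv_slice F, hf.ae_mem_slice_or F, hf.ae_slice_nonempty_or F] with y h1 h2 h3
  rcases (F.slice (supp f) y).eq_empty_or_nonempty with he | hne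
  · have h0 : ∀ t, f (F.pt y t) = 0 := h3.resolve_left (by simp [he])
    have : y ∉ F.topDomain (supp f) := fun h => by simpa [he] using h.1
    simp [h0, this]
  · have hs := hf.isLogConcSlice F hne
    rw [← hs.lintegral_neg_deriv_add]
    congr 1
    · rw [← lintegral_indicator (F.isOpen_slice y).measurableSet]
      refine lintegral_congr_ae ?_
      filter_upwards [h1, h2] with t ht1 ht2
      by_cases htm : t ∈ F.slice (supp f) y
      · rw [Set.indicator_of_mem htm, ht1 htm, Pi.mul_apply, ENNReal.ofReal_mul (hf.nonneg _)]
      · rw [Set.indicator_of_notMem htm, Pi.mul_apply, ht2.resolve_left htm]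
        simp
    · by_cases hb : BddAbove (F.slice (supp f) y)
      · rw [Set.indicator_of_mem (show y ∈ F.topDomain (supp f) from ⟨hne, hb⟩), upperValue, if_pos hb]
        rfl
      · rw [Set.indicator_of_notMem (fun h : y ∈ F.topDomain (supp f) => hb h.2), upperValue, if_neg hb]
        simp

end slices

/-! ### Finiteness of the gradient measure and integration by parts -/

section variation
variable {m : ℕ} {f : Rn (m + 1) → ℝ} (F : Frame m)

theorem Frame.neg_pt (y : Rn m) (t : ℝ) : F.neg.pt y t = F.pt y (-t) := by
  simp [Frame.pt, Frame.neg]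

theorem Frame.neg_e : F.neg.e = -F.e := rfl

theorem Frame.neg_slice (K : Set (Rn (m + 1))) (y : Rn m) : F.neg.slice K y = -F.slice K y := by
  ext t
  simp [Frame.slice, Frame.neg_pt]

theorem Frame.neg_topPoint (K : Set (Rn (m + 1))) (y : Rn m) :
    F.neg.topPoint K y = F.pt y (sInf (F.slice K y)) := by
  rw [Frame.topPoint, Frame.neg_pt, Frame.neg_slice, Real.sSup_neg, neg_neg]

theorem IsLogConc.bddAbove_slice (hf : IsLogConc f) (y : Rn m) :
    BddAbove (Set.range fun t => f (F.pt y t)) := by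
  obtain ⟨C, hC, a, ha, h⟩ := hf.slice_exp_bound
  refine ⟨C * Real.exp (-(a * ‖y‖)), ?_⟩
  rintro _ ⟨t, rfl⟩
  exact (h F y t).1

theorem IsLogConc.lintegral_iSup_lt_top (hf : IsLogConc f) :
    ∫⁻ y : Rn m, ENNReal.ofReal (⨆ t, f (F.pt y t)) < ⊤ := by
  obtain ⟨C, hC, a, ha, h⟩ := hf.slice_exp_bound
  refine lt_of_le_of_lt (lintegral_mono fun y => ENNReal.ofReal_le_ofReal
    (ciSup_le fun t => (h F y t).1)) ?_
  exact ((integrable_exp_neg_mul_norm (E := Rn m) volume ha).const_mul C).lintegral_lt_top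

theorem Frame.iSup_neg_pt (f : Rn (m + 1) → ℝ) (y : Rn m) :
    ⨆ t, f (F.neg.pt y t) = ⨆ t, f (F.pt y t) := by
  simp only [Frame.neg_pt]
  exact (Equiv.neg ℝ).iSup_comp (g := fun t => f (F.pt y t))

/-- Both `F` and `F.neg` have the same maxima along lines, so the two signed parts are equal and add
up. The right-hand side contains neither derivatives nor the boundary, which is what allows passage
to the limit. -/
theorem IsLogConc.lintegral_variation (hf : IsLogConc f) :
    (∫⁻ x, ‖inner ℝ (gradNegLog f x) F.e‖ₑ ∂(bulkMeasure f)) +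
      ∫⁻ x, ‖inner ℝ (gaussMap (supp f) x : Rn (m + 1)) F.e‖ₑ ∂(boundaryMeasure f) =
    2 * ∫⁻ y : Rn m, ENNReal.ofReal (⨆ t, f (F.pt y t)) := by
  have h1 := hf.lintegral_pos_variation F
  have h2 := hf.lintegral_pos_variation F.neg
  simp only [Frame.neg_e, inner_neg_right, F.iSup_neg_pt] at h2
  have habs : ∀ r : ℝ, ‖r‖ₑ = ENNReal.ofReal r + ENNReal.ofReal (-r) := by
    intro r
    rw [Real.enorm_eq_ofReal_abs]
    rcases le_total 0 r with h0 | h0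
    · rw [abs_of_nonneg h0, ENNReal.ofReal_of_nonpos (neg_nonpos.2 h0), add_zero]
    · rw [abs_of_nonpos h0, ENNReal.ofReal_of_nonpos h0, zero_add]
  have hm1 : Measurable fun x => ENNReal.ofReal (inner ℝ (gradNegLog f x) F.e) :=
    ((measurable_gradNegLog f).inner_const).ennreal_ofReal
  have hm2 := (F.measurable_inner_gaussMap (K := supp f)).ennreal_ofReal
  simp only [habs]
  rw [lintegral_add_left hm1, lintegral_add_left hm2, two_mul]
  nth_rw 1 [← h1]
  rw [← h2]
  ring

theorem IsLogConc.integrable_inner_grad (hf : IsLogConc f) :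
    Integrable (fun x => inner ℝ (gradNegLog f x) F.e) (bulkMeasure f) := by
  refine ⟨((measurable_gradNegLog f).inner_const).aestronglyMeasurable, ?_⟩
  refine lt_of_le_of_lt (le_self_add.trans (hf.lintegral_variation F).le) ?_
  exact ENNReal.mul_lt_top (by simp) (hf.lintegral_iSup_lt_top F)

theorem IsLogConc.integrable_inner_normal (hf : IsLogConc f) :
    Integrable (fun x => inner ℝ (gaussMap (supp f) x : Rn (m + 1)) F.e) (boundaryMeasure f) := by
  refine ⟨F.measurable_inner_gaussMap.aestronglyMeasurable, ?_⟩
  refine lt_of_le_of_lt (le_add_self.trans (hf.lintegral_variation F).le) ?_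
  exact ENNReal.mul_lt_top (by simp) (hf.lintegral_iSup_lt_top F)

theorem IsLogConc.integral_variation (hf : IsLogConc f) :
    (∫ x, |inner ℝ (gradNegLog f x) F.e| ∂(bulkMeasure f)) +
      ∫ x, |inner ℝ (gaussMap (supp f) x : Rn (m + 1)) F.e| ∂(boundaryMeasure f) =
    (2 * ∫⁻ y : Rn m, ENNReal.ofReal (⨆ t, f (F.pt y t))).toReal := by
  rw [← hf.lintegral_variation F, ENNReal.toReal_add (hf.integrable_inner_grad F).2.ne
    (hf.integrable_inner_normal F).2.ne]
  congr 1
  · exact integral_norm_eq_lintegral_enorm (hf.integrable_inner_grad F).1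
  · exact integral_norm_eq_lintegral_enorm (hf.integrable_inner_normal F).1

theorem Rn.norm_le_sum {n : ℕ} (v : Rn n) :
    ‖v‖ ≤ ∑ i, |inner ℝ v (EuclideanSpace.single i (1 : ℝ))| := by
  have : v = ∑ i, v i • EuclideanSpace.single i (1 : ℝ) := by
    simpa using ((EuclideanSpace.basisFun (Fin n) ℝ).sum_repr v).symm
  conv_lhs => rw [this]
  refine (norm_sum_le _ _).trans (Finset.sum_le_sum fun i _ => ?_)
  rw [norm_smul, EuclideanSpace.inner_single_right]
  simp

theorem IsLogConc.integrable_norm_grad (hf : IsLogConc f) :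
    Integrable (fun x => ‖gradNegLog f x‖) (bulkMeasure f) := by
  have h : ∀ i, Integrable (fun x => |inner ℝ (gradNegLog f x) (EuclideanSpace.single i (1 : ℝ))|)
      (bulkMeasure f) := fun i => by
    obtain ⟨F, hF⟩ := Frame.exists_e_eq (e := EuclideanSpace.single i (1 : ℝ)) (by simp)
    rw [← hF]
    exact (hf.integrable_inner_grad F).abs
  refine (integrable_finsetSum Finset.univ fun i _ => h i).mono'
    (measurable_gradNegLog f).norm.aestronglyMeasurable (ae_of_all _ fun x => ?_)
  rw [norm_norm]
  exact Rn.norm_le_sum _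

/-- A unit normal has coordinates whose absolute values sum to at least 1, and each coordinate is
integrable by the variation formula. -/
theorem IsLogConc.isFiniteMeasure_boundary (hf : IsLogConc f) :
    IsFiniteMeasure (boundaryMeasure f) := by
  have h : ∀ i, Integrable (fun x => |inner ℝ (gaussMap (supp f) x : Rn (m + 1))
      (EuclideanSpace.single i (1 : ℝ))|) (boundaryMeasure f) := fun i => by
    obtain ⟨F, hF⟩ := Frame.exists_e_eq (e := EuclideanSpace.single i (1 : ℝ)) (by simp)
    rw [← hF]
    exact (hf.integrable_inner_normal F).abs
  have h1 : Integrable (fun _ : Rn (m + 1) => (1 : ℝ)) (boundaryMeasure f) := by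
    refine (integrable_finsetSum Finset.univ fun i _ => h i).mono'
      aestronglyMeasurable_const (ae_of_all _ fun x => ?_)
    have := Rn.norm_le_sum (gaussMap (supp f) x : Rn (m + 1))
    simpa using this
  rw [integrable_const_iff] at h1
  exact h1.resolve_left one_ne_zero

theorem IsLogConc.isFiniteMeasure_bulk {n : ℕ} {f : Rn n → ℝ} (hf : IsLogConc f) :
    IsFiniteMeasure (bulkMeasure f) :=
  isFiniteMeasure_withDensity hf.integrable.lintegral_lt_top.ne

theorem IsLogConc.integral_bulk {n : ℕ} {f : Rn n → ℝ} (hf : IsLogConc f) (h : Rn n → ℝ) :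
    ∫ x, h x ∂(bulkMeasure f) = ∫ x, f x * h x := by
  rw [bulkMeasure, integral_withDensity_eq_integral_toReal_smul hf.measurable.ennreal_ofReal
    (ae_of_all _ fun _ => ENNReal.ofReal_lt_top)]
  simp [ENNReal.toReal_ofReal (hf.nonneg _)]

theorem IsLogConc.integrable_bulk_iff {n : ℕ} {f : Rn n → ℝ} (hf : IsLogConc f) (h : Rn n → ℝ) :
    Integrable h (bulkMeasure f) ↔ Integrable fun x => f x * h x := by
  rw [bulkMeasure, integrable_withDensity_iff_integrable_smul' hf.measurable.ennreal_ofReal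
    (ae_of_all _ fun _ => ENNReal.ofReal_lt_top)]
  simp [ENNReal.toReal_ofReal (hf.nonneg _)]

theorem IsLogConc.integral_boundary (hf : IsLogConc f) {h : Rn (m + 1) → ℝ} (hh : Continuous h)
    {M : ℝ} (hM : ∀ x, |h x| ≤ M) :
    Integrable ((F.topDomain (supp f)).indicator fun y =>
      f (F.topPoint (supp f) y) * h (F.topPoint (supp f) y)) ∧
    ∫ x, h x * max (inner ℝ (gaussMap (supp f) x : Rn (m + 1)) F.e) 0 ∂(boundaryMeasure f) =
      ∫ y, (F.topDomain (supp f)).indicator (fun y =>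
        f (F.topPoint (supp f) y) * h (F.topPoint (supp f) y)) y := by
  have hfm := hf.measurable.ennreal_ofReal
  have hnm := (F.measurable_inner_gaussMap (K := supp f)).ennreal_ofReal
  have hμ : (boundaryMeasure f).withDensity (fun x => ENNReal.ofReal
      (inner ℝ (gaussMap (supp f) x : Rn (m + 1)) F.e)) =
      ((volume.restrict (F.topDomain (supp f))).map (F.topPoint (supp f))).withDensity
        fun x => ENNReal.ofReal (f x) := by
    rw [← F.boundaryFlux_eq_map (isClosed_supp f) hf.convex_supp hf.interior_supp_nonempty,
      Frame.boundaryFlux, boundaryMeasure, ← withDensity_mul _ hfm hnm, ← withDensity_mul _ hnm hfm,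
      mul_comm]
  have hfin : IsFiniteMeasure ((boundaryMeasure f).withDensity (fun x => ENNReal.ofReal
      (inner ℝ (gaussMap (supp f) x : Rn (m + 1)) F.e))) := by
    refine isFiniteMeasure_withDensity (ne_of_lt (lt_of_le_of_lt ?_ (hf.lintegral_iSup_lt_top F)))
    exact le_add_self.trans (hf.lintegral_pos_variation F).le
  have hint : Integrable h ((boundaryMeasure f).withDensity (fun x => ENNReal.ofReal
      (inner ℝ (gaussMap (supp f) x : Rn (m + 1)) F.e))) :=
    (integrable_const M).mono' hh.aestronglyMeasurable (ae_of_all _ hM)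
  have hmeas : Measurable fun x => f x * h x := hf.measurable.mul hh.measurable
  constructor
  · rw [hμ, integrable_withDensity_iff_integrable_smul' hfm
      (ae_of_all _ fun _ => ENNReal.ofReal_lt_top)] at hint
    simp only [ENNReal.toReal_ofReal (hf.nonneg _), smul_eq_mul] at hint
    rw [integrable_map_measure hmeas.aestronglyMeasurable F.measurable_topPoint.aemeasurable] at hint
    rw [integrable_indicator_iff F.measurableSet_topDomain]
    exact hint
  · have h1 : ∫ x, h x * max (inner ℝ (gaussMap (supp f) x : Rn (m + 1)) F.e) 0 ∂(boundaryMeasure f) =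
        ∫ x, h x ∂((boundaryMeasure f).withDensity (fun x => ENNReal.ofReal
          (inner ℝ (gaussMap (supp f) x : Rn (m + 1)) F.e))) := by
      rw [integral_withDensity_eq_integral_toReal_smul hnm
        (ae_of_all _ fun _ => ENNReal.ofReal_lt_top)]
      simp only [ENNReal.toReal_ofReal', smul_eq_mul, mul_comm]
    rw [h1, hμ, integral_withDensity_eq_integral_toReal_smul hfm
      (ae_of_all _ fun _ => ENNReal.ofReal_lt_top)]
    simp only [ENNReal.toReal_ofReal (hf.nonneg _), smul_eq_mul]
    rw [integral_map F.measurable_topPoint.aemeasurable hmeas.aestronglyMeasurable,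
      integral_indicator F.measurableSet_topDomain]

/-- Integration by parts: the pair (gradient in the bulk, normal on the boundary) represents the
distributional gradient of `f`. -/
theorem IsLogConc.integral_by_parts (hf : IsLogConc f) {g : Rn (m + 1) → ℝ} (hg : ContDiff ℝ 1 g)
    (hgc : HasCompactSupport g) :
    (∫ x, g x * inner ℝ (gradNegLog f x) F.e ∂(bulkMeasure f)) +
      ∫ x, g x * inner ℝ (gaussMap (supp f) x : Rn (m + 1)) F.e ∂(boundaryMeasure f) =
    ∫ x, fderiv ℝ g x F.e * f x := by
  have hgd : Continuous fun x => fderiv ℝ g x F.e :=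
    (hg.continuous_fderiv one_ne_zero).clm_apply continuous_const
  obtain ⟨M₁, hM₁⟩ := hgc.exists_bound_of_continuous hg.continuous
  have hgdc : HasCompactSupport fun x => fderiv ℝ g x F.e := by
    refine (hgc.fderiv (𝕜 := ℝ)).comp_left (g := fun l : Rn (m + 1) →L[ℝ] ℝ => l F.e) (by simp)
  obtain ⟨M₂, hM₂⟩ := hgdc.exists_bound_of_continuous hgd
  set M := max M₁ M₂ with hM
  have hgM : ∀ x, |g x| ≤ M := fun x => (hM₁ x).trans (le_max_left _ _)
  have hgdM : ∀ x, |fderiv ℝ g x F.e| ≤ M := fun x => (hM₂ x).trans (le_max_right _ _)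
  have hi1 : Integrable fun x => f x * (g x * inner ℝ (gradNegLog f x) F.e) := by
    rw [← hf.integrable_bulk_iff]
    exact (hf.integrable_inner_grad F).bdd_mul (c := M) hg.continuous.aestronglyMeasurable
      (ae_of_all _ hgM)
  have hi2 : Integrable fun x => fderiv ℝ g x F.e * f x :=
    hf.integrable.bdd_mul (c := M) hgd.aestronglyMeasurable (ae_of_all _ hgdM)
  obtain ⟨hB1, hB2⟩ := hf.integral_boundary F hg.continuous hgM
  obtain ⟨hC1, hC2⟩ := hf.integral_boundary F.neg hg.continuous hgM
  have hfinb := hf.isFiniteMeasure_boundary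
  have hmax : ∀ F : Frame m, Integrable (fun x => g x *
      max (inner ℝ (gaussMap (supp f) x : Rn (m + 1)) F.e) 0) (boundaryMeasure f) := fun F =>
    (hf.integrable_inner_normal F).pos_part.bdd_mul (c := M) hg.continuous.aestronglyMeasurable
      (ae_of_all _ hgM)
  -- Normals with positive component along e correspond to upper ends of lines, those with negative
  -- component to lower ends, that is, to upper ends for `F.neg`.
  have hsplit : ∫ x, g x * inner ℝ (gaussMap (supp f) x : Rn (m + 1)) F.e ∂(boundaryMeasure f) =
      (∫ x, g x * max (inner ℝ (gaussMap (supp f) x : Rn (m + 1)) F.e) 0 ∂(boundaryMeasure f)) -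
      ∫ x, g x * max (inner ℝ (gaussMap (supp f) x : Rn (m + 1)) F.neg.e) 0 ∂(boundaryMeasure f) := by
    rw [← integral_sub (hmax F) (hmax F.neg)]
    refine integral_congr_ae (ae_of_all _ fun x => ?_)
    simp only [Frame.neg_e, inner_neg_right, ← mul_sub]
    rw [max_zero_sub_eq_self]
  rw [hf.integral_bulk, F.integral_eq hi1, hsplit, hB2, hC2, F.integral_eq hi2, ← integral_sub hB1 hC1]
  have hA1 : Integrable fun y => ∫ t, f (F.pt y t) * (g (F.pt y t) *
      inner ℝ (gradNegLog f (F.pt y t)) F.e) :=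
    Integrable.integral_prod_left ((F.measurePreserving_mequiv.integrable_comp_emb
      F.mequiv.measurableEmbedding).2 hi1)
  set T := (F.topDomain (supp f)).indicator (fun y =>
    f (F.topPoint (supp f) y) * g (F.topPoint (supp f) y)) with hT
  set T' := (F.neg.topDomain (supp f)).indicator (fun y =>
    f (F.neg.topPoint (supp f) y) * g (F.neg.topPoint (supp f) y)) with hT'
  have hBC : Integrable (fun y => T y - T' y) := hB1.sub hC1
  rw [← integral_add hA1 hBC]
  refine integral_congr_ae ?_
  filter_upwards [hf.ae_deriv_slice F, hf.ae_mem_slice_or F, hf.ae_slice_nonempty_or F] with y h1 h2 h3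
  rcases (F.slice (supp f) y).eq_empty_or_nonempty with he | hne
  · have h0 : ∀ t, f (F.pt y t) = 0 := h3.resolve_left (by simp [he])
    have e1 : y ∉ F.topDomain (supp f) := fun h => by simpa [he] using h.1
    have e2 : y ∉ F.neg.topDomain (supp f) := fun h => by simpa [Frame.neg_slice, he] using h.1
    simp [h0, hT, hT', Set.indicator_of_notMem e1, Set.indicator_of_notMem e2]
  · have hs := hf.isLogConcSlice F hne
    have hline : ∀ t, HasDerivAt (fun t : ℝ => F.pt y t) F.e t := fun t => by
      simpa [Frame.pt] using ((hasDerivAt_id t).smul_const F.e).const_add (F.ι y)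
    have hgs : ContDiff ℝ 1 fun t => g (F.pt y t) := by
      refine hg.comp ?_
      unfold Frame.pt
      fun_prop
    have hgder : ∀ t, deriv (fun t => g (F.pt y t)) t = fderiv ℝ g (F.pt y t) F.e := fun t =>
      (((hg.differentiable one_ne_zero) (F.pt y t)).hasFDerivAt.comp_hasDerivAt t (hline t)).deriv
    have hparts := hs.integral_mul_deriv (hf.integrable_slice F y) hgs (M := M) (fun t => hgM _)
      (fun t => by rw [hgder]; exact hgdM _)
    have hbulk : ∫ t, f (F.pt y t) * (g (F.pt y t) * inner ℝ (gradNegLog f (F.pt y t)) F.e) =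
        -∫ t in F.slice (supp f) y, g (F.pt y t) * deriv (fun t => f (F.pt y t)) t := by
      rw [← integral_indicator (F.isOpen_slice y).measurableSet, ← integral_neg]
      refine integral_congr_ae ?_
      filter_upwards [h1, h2] with t ht1 ht2
      by_cases htm : t ∈ F.slice (supp f) y
      · rw [Set.indicator_of_mem htm, ← mul_neg, ht1 htm]; ring
      · rw [Set.indicator_of_notMem htm, ht2.resolve_left htm]; simp
    have hup : (F.topDomain (supp f)).indicator (fun y =>
        f (F.topPoint (supp f) y) * g (F.topPoint (supp f) y)) y =
        upperValue (F.slice (supp f) y) (fun t => g (F.pt y t) * f (F.pt y t)) := by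
      by_cases hb : BddAbove (F.slice (supp f) y)
      · rw [Set.indicator_of_mem (show y ∈ F.topDomain (supp f) from ⟨hne, hb⟩), upperValue, if_pos hb,
          mul_comm]
        rfl
      · rw [Set.indicator_of_notMem (fun h : y ∈ F.topDomain (supp f) => hb h.2), upperValue, if_neg hb]
    have hlow : (F.neg.topDomain (supp f)).indicator (fun y =>
        f (F.neg.topPoint (supp f) y) * g (F.neg.topPoint (supp f) y)) y =
        lowerValue (F.slice (supp f) y) (fun t => g (F.pt y t) * f (F.pt y t)) := by
      have hiff : y ∈ F.neg.topDomain (supp f) ↔ BddBelow (F.slice (supp f) y) := by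
        rw [Frame.topDomain, Set.mem_ofPred_eq, Frame.neg_slice, bddAbove_neg, Set.nonempty_neg]
        exact and_iff_right hne
      by_cases hb : BddBelow (F.slice (supp f) y)
      · rw [Set.indicator_of_mem (hiff.2 hb), lowerValue, if_pos hb, mul_comm, Frame.neg_topPoint]
      · rw [Set.indicator_of_notMem (mt hiff.1 hb), lowerValue, if_neg hb]
    simp only [hgder] at hparts
    simp only [hT, hT']
    rw [hbulk, hup, hlow, hparts]
    ring

end variation

/-! ### Convergence of directional variations -/

section mass
variable {m : ℕ} {fk : ℕ → Rn (m + 1) → ℝ} {f : Rn (m + 1) → ℝ} (F : Frame m)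

/-- For c ≥ 0 the set where the supremum exceeds c is a countable union of projections of compact
superlevel sets. -/
theorem IsLogConc.measurable_iSup_slice (hf : IsLogConc f) :
    Measurable fun y => ⨆ t, f (F.pt y t) := by
  refine measurable_of_Ioi fun c => ?_
  rcases lt_or_ge c 0 with hc | hc
  · convert MeasurableSet.univ
    rw [Set.eq_univ_iff_forall]
    intro y
    exact hc.trans_le (Real.iSup_nonneg fun t => hf.nonneg _)
  · have hset : (fun y => ⨆ t, f (F.pt y t)) ⁻¹' Set.Ioi c =
        ⋃ j : ℕ, F.proj '' {x | c + 1 / ((j : ℝ) + 1) ≤ f x} := by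
      ext y
      simp only [Set.mem_preimage, Set.mem_Ioi, Set.mem_iUnion, Set.mem_image]
      constructor
      · intro h
        obtain ⟨t, ht⟩ := exists_lt_of_lt_ciSup h
        obtain ⟨j, hj⟩ := exists_nat_one_div_lt (sub_pos.2 ht)
        exact ⟨j, F.pt y t, (show c + 1 / ((j : ℝ) + 1) ≤ f (F.pt y t) by linarith), F.proj_pt y t⟩
      · rintro ⟨j, x, hx, rfl⟩
        have hx' : c + 1 / ((j : ℝ) + 1) ≤ f x := hx
        refine lt_of_lt_of_le ?_ (le_ciSup (hf.bddAbove_slice F _) (inner ℝ x F.e))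
        rw [F.pt_proj]
        have : 0 < 1 / ((j : ℝ) + 1) := by positivity
        linarith
    rw [hset]
    refine MeasurableSet.iUnion fun j => IsCompact.measurableSet (IsCompact.image ?_ F.proj.continuous)
    have hpos : 0 < c + 1 / ((j : ℝ) + 1) := by positivity
    exact Metric.isCompact_of_isClosed_isBounded (hf.usc.isClosed_preimage _)
      (hf.isBounded_superlevel hpos)

/-- Almost every slice has converging maxima. -/
theorem HypoTendsto.ae_tendsto_iSup_slice (h : HypoTendsto fk f) (hf : IsLogConc f)
    (hfk : ∀ k, IsLogConc (fk k)) :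
    ∀ᵐ y, Tendsto (fun k => ⨆ t, fk k (F.pt y t)) atTop (𝓝 (⨆ t, f (F.pt y t))) := by
  obtain ⟨C, hC, a, ha, hb⟩ := h.exists_exp_bound hf hfk
  filter_upwards [hf.ae_slice_nonempty_or F] with y hy
  refine tendsto_order.2 ⟨fun M hM => ?_, fun M hM => ?_⟩
  · rcases lt_or_ge M 0 with hM0 | hM0
    · exact Eventually.of_forall fun k => hM0.trans_le (Real.iSup_nonneg fun t => (hfk k).nonneg _)
    · obtain ⟨t, ht⟩ := exists_lt_of_lt_ciSup hM
      have hne : (F.slice (supp f) y).Nonempty := hy.resolve_right fun h0 => by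
        rw [h0] at ht; exact absurd hM0 ht.not_ge
      obtain ⟨s, hs, hMs⟩ := (hf.isLogConcSlice F hne).exists_mem_lt hM0 ht
      filter_upwards [(h.tendsto_of_mem_interior hf hfk hs).eventually (lt_mem_nhds hMs)] with k hk
      exact hk.trans_le (le_ciSup ((hfk k).bddAbove_slice F y) s)
  · obtain ⟨M', hM1, hM2⟩ := exists_between hM
    have hM'0 : 0 < M' := (Real.iSup_nonneg fun t => hf.nonneg _).trans_lt hM1
    -- Beyond |t| = R the common exponential bound is below M'; the remaining segment is compact,
    -- where the upper condition holds uniformly.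
    have hlim : Tendsto (fun R : ℝ => C * Real.exp (-(a * R))) atTop (𝓝 0) := by
      have : Tendsto (fun R : ℝ => -(a * R)) atTop atBot :=
        tendsto_neg_atTop_atBot.comp (tendsto_id.const_mul_atTop ha)
      simpa using (Real.tendsto_exp_atBot.comp this).const_mul C
    obtain ⟨R, hR⟩ := (hlim.eventually (gt_mem_nhds hM'0)).exists
    have hcomp : IsCompact ((fun t => F.pt y t) '' Set.Icc (-R) R) :=
      isCompact_Icc.image (F.continuous_pt_right y)
    filter_upwards [hb, h.eventually_forall_lt hcomp hM'0 (by
      rintro _ ⟨t, -, rfl⟩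
      exact (le_ciSup (hf.bddAbove_slice F y) t).trans_lt hM1)] with k hk1 hk2
    refine lt_of_le_of_lt (ciSup_le fun t => ?_) hM2
    by_cases ht : t ∈ Set.Icc (-R) R
    · exact (hk2 _ ⟨t, ht, rfl⟩).le
    · have hRt : R ≤ ‖F.pt y t‖ := by
        refine le_trans ?_ (F.abs_le_norm_pt y t)
        by_contra! hlt
        exact ht ⟨(abs_lt.1 hlt).1.le, (abs_lt.1 hlt).2.le⟩
      refine (hk1 _).trans (le_trans ?_ hR.le)
      gcongr

/-- Both sides are twice the integral of line maxima, which converge almost everywhere under the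
common exponential bound. Only the sum of bulk and boundary terms is controlled. -/
theorem HypoTendsto.tendsto_integral_variation (h : HypoTendsto fk f) (hf : IsLogConc f)
    (hfk : ∀ k, IsLogConc (fk k)) :
    Tendsto (fun k => (∫ x, |inner ℝ (gradNegLog (fk k) x) F.e| ∂(bulkMeasure (fk k))) +
      ∫ x, |inner ℝ (gaussMap (supp (fk k)) x : Rn (m + 1)) F.e| ∂(boundaryMeasure (fk k))) atTop
    (𝓝 ((∫ x, |inner ℝ (gradNegLog f x) F.e| ∂(bulkMeasure f)) +
      ∫ x, |inner ℝ (gaussMap (supp f) x : Rn (m + 1)) F.e| ∂(boundaryMeasure f))) := by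
  simp only [hf.integral_variation F, fun k => (hfk k).integral_variation F]
  have hlt := hf.lintegral_iSup_lt_top F
  refine (ENNReal.tendsto_toReal (ENNReal.mul_ne_top (by simp) hlt.ne)).comp ?_
  refine ENNReal.Tendsto.const_mul ?_ (Or.inr (by simp))
  obtain ⟨C, hC, a, ha, hb⟩ := h.exists_exp_bound hf hfk
  refine tendsto_lintegral_filter_of_dominated_convergence
    (fun y => ENNReal.ofReal (C * Real.exp (-(a * ‖y‖))))
    (Eventually.of_forall fun k => ((hfk k).measurable_iSup_slice F).ennreal_ofReal) ?_
    ((integrable_exp_neg_mul_norm (E := Rn m) volume ha).const_mul C).lintegral_lt_top.ne ?_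
  · filter_upwards [hb] with k hk
    refine ae_of_all _ fun y => ENNReal.ofReal_le_ofReal (ciSup_le fun t => (hk _).trans ?_)
    gcongr
    exact F.norm_le_norm_pt y t
  · filter_upwards [h.ae_tendsto_iSup_slice F hf hfk] with y hy
    exact (ENNReal.continuous_ofReal.tendsto _).comp hy

end mass

/-! ### From directional variations to total variation -/

section averaging
variable {E : Type*} [NormedAddCommGroup E] [InnerProductSpace ℝ E] [FiniteDimensional ℝ E]
  [MeasurableSpace E] [BorelSpace E]

theorem integrableOn_ball_abs_inner (v : E) :
    IntegrableOn (fun u => |inner ℝ v u|) (Metric.ball (0 : E) 1) :=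
  ((by fun_prop : Continuous fun u : E => |inner ℝ v u|).continuousOn.integrableOn_compact
    (isCompact_closedBall 0 1)).mono_set Metric.ball_subset_closedBall

/-- Averaging `|⟨v, u⟩|` over directions gives a positive multiple of `‖v‖`. -/
theorem exists_average_abs_inner : ∃ c > 0, ∀ v : E,
    ∫ u in Metric.ball (0 : E) 1, |inner ℝ v u| = c * ‖v‖ := by
  have hinv : ∀ (L : E ≃ₗᵢ[ℝ] E) (v : E), ∫ u in Metric.ball (0 : E) 1, |inner ℝ (L v) u| =
      ∫ u in Metric.ball (0 : E) 1, |inner ℝ v u| := by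
    intro L v
    rw [← L.measurePreserving.setIntegral_preimage_emb L.toHomeomorph.measurableEmbedding]
    have : (L ⁻¹' Metric.ball (0 : E) 1) = Metric.ball 0 1 := by
      ext u; simp
    simp [this]
  by_cases hE : ∃ e : E, ‖e‖ = 1
  · obtain ⟨e, he⟩ := hE
    refine ⟨∫ u in Metric.ball (0 : E) 1, |inner ℝ e u|, ?_, fun v => ?_⟩
    · rw [gt_iff_lt, setIntegral_pos_iff_support_of_nonneg_ae (ae_of_all _ fun u => abs_nonneg _)
        (integrableOn_ball_abs_inner e)]
      refine IsOpen.measure_pos _ (IsOpen.inter ?_ Metric.isOpen_ball) ⟨(1 / 2 : ℝ) • e, ?_, ?_⟩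
      · exact (by fun_prop : Continuous fun u : E => |inner ℝ e u|).isOpen_support
      · simp [inner_smul_right, he]
      · rw [mem_ball_zero_iff, norm_smul, he]; norm_num
    · have h1 : ‖(‖v‖ • e)‖ = ‖v‖ := by simp [norm_smul, he]
      -- The average is rotation invariant; this reflection carries ‖v‖e to v, so the average
      -- depends on ‖v‖ alone.
      have h2 := hinv (ℝ ∙ (‖v‖ • e - v))ᗮ.reflection (‖v‖ • e)
      rw [Submodule.reflection_sub h1] at h2
      rw [h2]
      simp only [inner_smul_left, abs_mul, conj_trivial, abs_norm, integral_const_mul]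
      ring
  · refine ⟨1, one_pos, fun v => ?_⟩
    have : v = 0 := by
      by_contra hv
      exact hE ⟨‖v‖⁻¹ • v, by simp [norm_smul, hv]⟩
    simp [this]

/-- If all directional variations of a sequence of vector measures converge, so do the total
variations. -/
theorem tendsto_integral_norm_of_abs_inner {α : Type*} [MeasurableSpace α] {V : α → E}
    (hV : Measurable V) {ρk : ℕ → Measure α} {ρ : Measure α} [∀ k, IsFiniteMeasure (ρk k)]
    [IsFiniteMeasure ρ] (hk : ∀ k, Integrable V (ρk k)) (hρ : Integrable V ρ)
    (hlim : ∀ u : E, ‖u‖ = 1 → Tendsto (fun k => ∫ p, |inner ℝ (V p) u| ∂(ρk k)) atTop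
      (𝓝 (∫ p, |inner ℝ (V p) u| ∂ρ)))
    (hbound : ∃ B, ∀ k, ∫ p, ‖V p‖ ∂(ρk k) ≤ B) :
    Tendsto (fun k => ∫ p, ‖V p‖ ∂(ρk k)) atTop (𝓝 (∫ p, ‖V p‖ ∂ρ)) := by
  obtain ⟨c, hc, havg⟩ := exists_average_abs_inner (E := E)
  obtain ⟨B, hB⟩ := hbound
  -- By Fubini the total variation is, up to the factor c, an integral over directions u of
  -- directional variations. Convergence for each u then passes through the integral, dominated by
  -- the bound B.
  have hfub : ∀ (ν : Measure α) [IsFiniteMeasure ν], Integrable V ν →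
      c * ∫ p, ‖V p‖ ∂ν = ∫ u in Metric.ball (0 : E) 1, ∫ p, |inner ℝ (V p) u| ∂ν := by
    intro ν _ hν
    rw [← integral_const_mul]
    simp only [← havg]
    refine integral_integral_swap ?_
    have hfin : IsFiniteMeasure (volume.restrict (Metric.ball (0 : E) 1)) :=
      ⟨by simpa using measure_ball_lt_top⟩
    have hi : Integrable (fun q : α × E => ‖V q.1‖ * 1)
        (ν.prod (volume.restrict (Metric.ball (0 : E) 1))) :=
      hν.norm.mul_prod (integrable_const (1 : ℝ))
    have hmeas : Measurable fun q : α × E => |inner ℝ (V q.1) q.2| := by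
      have := (hV.comp measurable_fst).inner (𝕜 := ℝ) (measurable_snd (α := α) (β := E))
      exact this.abs
    refine hi.mono' hmeas.aestronglyMeasurable ?_
    have hball : ∀ᵐ q ∂(ν.prod (volume.restrict (Metric.ball (0 : E) 1))),
        q.2 ∈ Metric.ball (0 : E) 1 :=
      Measure.quasiMeasurePreserving_snd.ae (ae_restrict_mem Metric.isOpen_ball.measurableSet)
    filter_upwards [hball] with q hq
    rw [Function.uncurry, Real.norm_eq_abs, abs_abs]
    refine (abs_real_inner_le_norm _ _).trans ?_
    gcongr
    exact (mem_ball_zero_iff.1 hq).le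
  have hlim' : ∀ u : E, Tendsto (fun k => ∫ p, |inner ℝ (V p) u| ∂(ρk k)) atTop
      (𝓝 (∫ p, |inner ℝ (V p) u| ∂ρ)) := by
    intro u
    by_cases hu : u = 0
    · simp [hu]
    · have h1 := (hlim (‖u‖⁻¹ • u) (by simp [norm_smul, hu])).const_mul ‖u‖
      have h2 : ∀ p, |inner ℝ (V p) u| = ‖u‖ * |inner ℝ (V p) (‖u‖⁻¹ • u)| := by
        intro p
        rw [inner_smul_right, abs_mul, abs_inv, abs_norm, mul_inv_cancel_left₀ (norm_ne_zero_iff.2 hu)]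
      simp only [h2, integral_const_mul]
      exact h1
  have key : Tendsto (fun k => c * ∫ p, ‖V p‖ ∂(ρk k)) atTop (𝓝 (c * ∫ p, ‖V p‖ ∂ρ)) := by
    simp only [hfub ρ hρ, fun k => hfub (ρk k) (hk k)]
    refine tendsto_integral_of_dominated_convergence (fun u => B) (fun k => ?_) ?_ (fun k => ?_) ?_
    · have hmeas : Measurable fun q : E × α => |inner ℝ (V q.2) q.1| := by
        have := (hV.comp measurable_snd).inner (𝕜 := ℝ) (measurable_fst (α := E) (β := α))
        exact this.abs
      exact (hmeas.stronglyMeasurable.integral_prod_right).aestronglyMeasurable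
    · exact integrableOn_const measure_ball_lt_top.ne
    · filter_upwards [ae_restrict_mem Metric.isOpen_ball.measurableSet] with u hu
      rw [Real.norm_of_nonneg (integral_nonneg fun p => abs_nonneg _)]
      refine le_trans (integral_mono_of_nonneg (ae_of_all _ fun p => abs_nonneg _) (hk k).norm
        (ae_of_all _ fun p => ?_)) (hB k)
      refine (abs_real_inner_le_norm _ _).trans ?_
      have := (mem_ball_zero_iff.1 hu).le
      nlinarith [norm_nonneg (V p)]
    · exact ae_of_all _ fun u => hlim' u
  have := key.const_mul c⁻¹
  simpa [inv_mul_cancel_left₀ hc.ne'] using this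

end averaging

/-! ### Reshetnyak's continuity theorem -/

section reshetnyak
variable {E : Type*} [NormedAddCommGroup E] [InnerProductSpace ℝ E]

/-- The radial retraction onto the unit ball. -/
theorem exists_unit_ball_retraction {G : E → E} (hG : Continuous G) (hGc : HasCompactSupport G) :
    ∃ G' : E → E, Continuous G' ∧ HasCompactSupport G' ∧ (∀ x, ‖G' x‖ ≤ 1) ∧
      ∀ x s, ‖s‖ ≤ 1 → ‖s - G' x‖ ≤ 2 * ‖s - G x‖ := by
  have hpos : ∀ x, 0 < max 1 ‖G x‖ := fun x => lt_max_of_lt_left one_pos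
  refine ⟨fun x => (max 1 ‖G x‖)⁻¹ • G x, ?_, ?_, fun x => ?_, fun x s hs => ?_⟩
  · exact ((continuous_const.max hG.norm).inv₀ fun x => (hpos x).ne').smul hG
  · exact hGc.smul_left
  · rw [norm_smul, Real.norm_of_nonneg (inv_nonneg.2 (hpos x).le), inv_mul_le_one₀ (hpos x)]
    exact le_max_right _ _
  · have h1 : ‖G x - (max 1 ‖G x‖)⁻¹ • G x‖ ≤ ‖s - G x‖ := by
      rcases le_total ‖G x‖ 1 with h | h
      · simp [max_eq_left h]
      · rw [max_eq_right h]
        have hn : ‖G x‖ ≠ 0 := by linarith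
        have : G x - ‖G x‖⁻¹ • G x = (1 - ‖G x‖⁻¹) • G x := by rw [sub_smul, one_smul]
        rw [this, norm_smul, Real.norm_of_nonneg (by rw [sub_nonneg]; exact inv_le_one_of_one_le₀ h),
          sub_mul, inv_mul_cancel₀ hn, norm_sub_rev]
        have := norm_sub_norm_le (G x) s
        linarith
    have h2 : s - (max 1 ‖G x‖)⁻¹ • G x = (s - G x) + (G x - (max 1 ‖G x‖)⁻¹ • G x) := by abel
    rw [h2]
    refine (norm_add_le _ _).trans ?_
    linarith

variable [FiniteDimensional ℝ E]

theorem exists_abs_le_mul_norm_of_homogeneous {h : E → ℝ} (hc : Continuous h)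
    (hh : ∀ r : ℝ, 0 ≤ r → ∀ v, h (r • v) = r * h v) : ∃ H ≥ 0, ∀ v, |h v| ≤ H * ‖v‖ := by
  obtain ⟨H, hH⟩ := (isCompact_closedBall (0 : E) 1).exists_bound_of_continuousOn hc.continuousOn
  have hH0 : 0 ≤ H := (norm_nonneg _).trans (hH 0 (by simp))
  refine ⟨H, hH0, fun v => ?_⟩
  by_cases hv : v = 0
  · have := hh 0 le_rfl 0
    simp [hv] at this ⊢
    exact this
  · have hn := norm_ne_zero_iff.2 hv
    have h1 : h v = ‖v‖ * h (‖v‖⁻¹ • v) := by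
      rw [← hh _ (norm_nonneg v), smul_inv_smul₀ hn]
    rw [h1, abs_mul, abs_norm, mul_comm]
    gcongr
    exact hH _ (by simp [norm_smul, hn])

/-- By homogeneity v may be replaced by its direction θ. If g is within δ of θ, uniform continuity
gives ε. Otherwise 1 - ⟪θ, g⟫ ≥ δ²/2, and C = 4H/δ² outweighs the trivial bound 2H. -/
theorem exists_homogeneous_deviation_le {h : E → ℝ} (hc : Continuous h)
    (hh : ∀ r : ℝ, 0 ≤ r → ∀ v, h (r • v) = r * h v) {ε : ℝ} (hε : 0 < ε) :
    ∃ C ≥ 0, ∀ v g : E, ‖g‖ ≤ 1 →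
      |h v - ‖v‖ * h g| ≤ ε * ‖v‖ + C * (‖v‖ - inner ℝ v g) := by
  obtain ⟨H, hH0, hH⟩ := exists_abs_le_mul_norm_of_homogeneous hc hh
  have huc := (isCompact_closedBall (0 : E) 1).uniformContinuousOn_of_continuous hc.continuousOn
  obtain ⟨δ, hδ, hδ'⟩ := Metric.uniformContinuousOn_iff.1 huc ε hε
  refine ⟨4 * H / δ ^ 2, by positivity, fun v g hg => ?_⟩
  by_cases hv : v = 0
  · have h0 : h 0 = 0 := by simpa using hh 0 le_rfl 0
    simp [hv, h0]
  have hn := norm_ne_zero_iff.2 hv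
  set θ := ‖v‖⁻¹ • v with hθ
  have hθ1 : ‖θ‖ = 1 := by simp [hθ, norm_smul, hn]
  have hvθ : v = ‖v‖ • θ := (smul_inv_smul₀ hn v).symm
  have e1 : h v = ‖v‖ * h θ := by rw [← hh _ (norm_nonneg v), ← hvθ]
  have e2 : inner ℝ v g = ‖v‖ * inner ℝ θ g := by
    conv_lhs => rw [hvθ]
    rw [real_inner_smul_left]
  rw [e1, e2, ← mul_sub, abs_mul, abs_norm]
  have hin : inner ℝ θ g ≤ 1 := (real_inner_le_norm _ _).trans (by rw [hθ1]; linarith)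
  have key : |h θ - h g| ≤ ε + 4 * H / δ ^ 2 * (1 - inner ℝ θ g) := by
    by_cases hd : dist θ g < δ
    · have := hδ' θ (by simp [hθ1]) g (by simpa using hg) hd
      rw [Real.dist_eq] at this
      have : 0 ≤ 4 * H / δ ^ 2 * (1 - inner ℝ θ g) := mul_nonneg (by positivity) (by linarith)
      linarith
    · rw [not_lt, dist_eq_norm] at hd
      have h1 := norm_sub_sq_real θ g
      have h2 : δ ^ 2 ≤ ‖θ - g‖ ^ 2 := by gcongr
      have h3 : ‖g‖ ^ 2 ≤ 1 := pow_le_one₀ (norm_nonneg _) hg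
      have h4 : δ ^ 2 / 2 ≤ 1 - inner ℝ θ g := by rw [hθ1] at h1; linarith
      have h5 : |h θ - h g| ≤ 2 * H := by
        refine (abs_sub _ _).trans ?_
        have a1 := hH θ
        have a2 := hH g
        rw [hθ1] at a1
        have : H * ‖g‖ ≤ H * 1 := by gcongr
        linarith
      have h6 : 4 * H / δ ^ 2 * (δ ^ 2 / 2) ≤ 4 * H / δ ^ 2 * (1 - inner ℝ θ g) := by gcongr
      have h7 : 4 * H / δ ^ 2 * (δ ^ 2 / 2) = 2 * H := by field_simp; ring
      linarith
  have := mul_le_mul_of_nonneg_left key (norm_nonneg v)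
  linarith

variable [MeasurableSpace E] [BorelSpace E]

theorem integrable_inner_of_bounded {ρ : Measure (E × E)} (hρ : Integrable (fun p => ‖p.2‖) ρ)
    {G : E → E} (hG : Continuous G) {M : ℝ} (hM : ∀ x, ‖G x‖ ≤ M) :
    Integrable (fun p : E × E => inner ℝ p.2 (G p.1)) ρ := by
  refine (hρ.mul_const M).mono' (by fun_prop) (ae_of_all _ fun p => ?_)
  refine (norm_inner_le_norm _ _).trans ?_
  gcongr
  exact hM _

/-- A vector measure with a measurable polar factor is almost calibrated by a continuous field. -/
theorem exists_almost_calibration {ρ : Measure (E × E)} (hρ : Integrable (fun p => ‖p.2‖) ρ)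
    {σ : E → E} (hσ : Measurable σ) (hσ1 : ∀ x, ‖σ x‖ ≤ 1)
    (hpolar : ∀ᵐ p ∂ρ, p.2 = ‖p.2‖ • σ p.1) {η : ℝ} (hη : 0 < η) :
    ∃ G : E → E, Continuous G ∧ HasCompactSupport G ∧ (∀ x, ‖G x‖ ≤ 1) ∧
      ∫ p, (‖p.2‖ - inner ℝ p.2 (G p.1)) ∂ρ ≤ η := by
  have hm : Measurable fun p : E × E => ENNReal.ofReal ‖p.2‖ := by fun_prop
  -- τ is the total variation measure on positions; the polar factor is approximated by a continuous
  -- field in L¹(τ), then retracted to the unit ball at the cost of a factor 2.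
  set τ := (ρ.withDensity fun p => ENNReal.ofReal ‖p.2‖).map Prod.fst with hτ
  have hfin' : IsFiniteMeasure (ρ.withDensity fun p => ENNReal.ofReal ‖p.2‖) :=
    isFiniteMeasure_withDensity hρ.lintegral_lt_top.ne
  have hfin : IsFiniteMeasure τ := Measure.isFiniteMeasure_map _ _
  have hint : Integrable σ τ :=
    (integrable_const (1 : ℝ)).mono' hσ.aestronglyMeasurable (ae_of_all _ hσ1)
  obtain ⟨G₀, hGc, hG, hGcont, hGint⟩ := hint.exists_hasCompactSupport_integral_sub_le
    (half_pos hη)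
  obtain ⟨G, h1, h2, h3, h4⟩ := exists_unit_ball_retraction hGcont hGc
  refine ⟨G, h1, h2, h3, ?_⟩
  have hdiff : Integrable (fun x => ‖σ x - G₀ x‖) τ := (hint.sub hGint).norm
  have hsm : Measurable fun x => ‖σ x - G₀ x‖ := (hσ.sub hGcont.measurable).norm
  have e1 : ∫ x, ‖σ x - G₀ x‖ ∂τ = ∫ p, ‖p.2‖ * ‖σ p.1 - G₀ p.1‖ ∂ρ := by
    rw [hτ, integral_map measurable_fst.aemeasurable hsm.aestronglyMeasurable,
      integral_withDensity_eq_integral_toReal_smul hm (ae_of_all _ fun _ => ENNReal.ofReal_lt_top)]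
    simp
  have hi : Integrable (fun p : E × E => ‖p.2‖ * ‖σ p.1 - G₀ p.1‖) ρ := by
    rw [hτ, integrable_map_measure hsm.aestronglyMeasurable measurable_fst.aemeasurable,
      integrable_withDensity_iff_integrable_smul' hm (ae_of_all _ fun _ => ENNReal.ofReal_lt_top)]
      at hdiff
    simpa using hdiff
  have : ∫ p, (‖p.2‖ - inner ℝ p.2 (G p.1)) ∂ρ ≤ ∫ p, 2 * (‖p.2‖ * ‖σ p.1 - G₀ p.1‖) ∂ρ := by
    refine integral_mono_ae (hρ.sub (integrable_inner_of_bounded hρ h1 h3)) (hi.const_mul 2) ?_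
    filter_upwards [hpolar] with p hp
    by_cases hv : p.2 = 0
    · simp [hv]
    have hn := norm_ne_zero_iff.2 hv
    have hs1 : ‖σ p.1‖ = 1 := by
      have := congrArg norm hp
      rw [norm_smul, norm_norm] at this
      exact (mul_eq_left₀ hn).1 this.symm
    have e : ‖p.2‖ - inner ℝ p.2 (G p.1) = ‖p.2‖ * inner ℝ (σ p.1) (σ p.1 - G p.1) := by
      have e3 : inner ℝ p.2 (G p.1) = ‖p.2‖ * inner ℝ (σ p.1) (G p.1) := by
        conv_lhs => rw [hp]
        rw [real_inner_smul_left]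
      rw [e3, inner_sub_right, real_inner_self_eq_norm_sq, hs1]
      ring
    have h5 : inner ℝ (σ p.1) (σ p.1 - G p.1) ≤ 2 * ‖σ p.1 - G₀ p.1‖ := by
      refine (real_inner_le_norm _ _).trans ?_
      rw [hs1, one_mul]
      exact h4 _ _ (hσ1 _)
    show ‖p.2‖ - inner ℝ p.2 (G p.1) ≤ _
    rw [e]
    have := mul_le_mul_of_nonneg_left h5 (norm_nonneg p.2)
    linarith
  rw [integral_const_mul, ← e1] at this
  linarith

theorem Continuous.integrable_snd_of_homogeneous {h : E → ℝ} (hc : Continuous h)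
    (hh : ∀ r : ℝ, 0 ≤ r → ∀ v, h (r • v) = r * h v) {ρ : Measure (E × E)}
    (hρ : Integrable (fun p => ‖p.2‖) ρ) : Integrable (fun p : E × E => h p.2) ρ := by
  obtain ⟨H, hH0, hH⟩ := exists_abs_le_mul_norm_of_homogeneous hc hh
  exact (hρ.const_mul H).mono' (by fun_prop) (ae_of_all _ fun p => hH _)

/-- Reshetnyak's continuity theorem: weak convergence of vector measures together with convergence
of the total variations implies convergence of the integrals of positively homogeneous functions. -/
theorem tendsto_integral_homogeneous {ρk : ℕ → Measure (E × E)} {ρ : Measure (E × E)}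
    (hk : ∀ k, Integrable (fun p => ‖p.2‖) (ρk k)) (hρ : Integrable (fun p => ‖p.2‖) ρ)
    (hmass : Tendsto (fun k => ∫ p, ‖p.2‖ ∂(ρk k)) atTop (𝓝 (∫ p, ‖p.2‖ ∂ρ)))
    (hweak : ∀ G : E → E, Continuous G → HasCompactSupport G →
      Tendsto (fun k => ∫ p, inner ℝ p.2 (G p.1) ∂(ρk k)) atTop (𝓝 (∫ p, inner ℝ p.2 (G p.1) ∂ρ)))
    {σ : E → E} (hσ : Measurable σ) (hσ1 : ∀ x, ‖σ x‖ ≤ 1)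
    (hpolar : ∀ᵐ p ∂ρ, p.2 = ‖p.2‖ • σ p.1)
    {h : E → ℝ} (hc : Continuous h) (hh : ∀ r : ℝ, 0 ≤ r → ∀ v, h (r • v) = r * h v) :
    Tendsto (fun k => ∫ p, h p.2 ∂(ρk k)) atTop (𝓝 (∫ p, h p.2 ∂ρ)) := by
  obtain ⟨H, hH0, hH⟩ := exists_abs_le_mul_norm_of_homogeneous hc hh
  set M := ∫ p, ‖p.2‖ ∂ρ with hM
  have hM0 : 0 ≤ M := integral_nonneg fun p => norm_nonneg _
  rw [Metric.tendsto_atTop']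
  intro e he
  set ε := e / (8 * (M + 1)) with hε
  have hε0 : 0 < ε := by positivity
  obtain ⟨C, hC0, hC⟩ := exists_homogeneous_deviation_le hc hh hε0
  set η := e / (16 * (C + H + 1)) with hη
  have hη0 : 0 < η := by positivity
  obtain ⟨G, hG, hGc, hG1, hGη⟩ := exists_almost_calibration hρ hσ hσ1 hpolar hη0
  -- Testing against h(G) G linearises h along G: where v points in the direction of a unit vector
  -- g, h v = ⟪v, h(g) g⟫, and in general the error is governed by the defect ‖v‖ - ⟪v, g⟫.
  have hwG : Continuous fun x => h (G x) • G x := (hc.comp hG).smul hG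
  have hwGb : ∀ x, ‖h (G x) • G x‖ ≤ H := by
    intro x
    rw [norm_smul, Real.norm_eq_abs]
    have h1 := (hH (G x)).trans (mul_le_mul_of_nonneg_left (hG1 x) hH0)
    rw [mul_one] at h1
    calc |h (G x)| * ‖G x‖ ≤ H * 1 := mul_le_mul h1 (hG1 x) (norm_nonneg _) hH0
      _ = H := mul_one H
  have hest : ∀ v g : E, ‖g‖ ≤ 1 → |h v - inner ℝ v (h g • g)| ≤
      ε * ‖v‖ + (C + H) * (‖v‖ - inner ℝ v g) := by
    intro v g hg
    have h1 := hC v g hg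
    have h2 : inner ℝ v g ≤ ‖v‖ := (real_inner_le_norm _ _).trans
      (mul_le_of_le_one_right (norm_nonneg _) hg)
    have h3 : |h g| ≤ H := (hH g).trans (mul_le_of_le_one_right hH0 hg)
    have h4 : h v - inner ℝ v (h g • g) = (h v - ‖v‖ * h g) + h g * (‖v‖ - inner ℝ v g) := by
      rw [inner_smul_right]; ring
    rw [h4]
    refine (abs_add_le _ _).trans ?_
    have h5 : |h g * (‖v‖ - inner ℝ v g)| ≤ H * (‖v‖ - inner ℝ v g) := by
      rw [abs_mul, abs_of_nonneg (sub_nonneg.2 h2)]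
      exact mul_le_mul_of_nonneg_right h3 (sub_nonneg.2 h2)
    linarith
  have hcomp : ∀ ν : Measure (E × E), Integrable (fun p => ‖p.2‖) ν →
      |∫ p, h p.2 ∂ν - ∫ p, inner ℝ p.2 (h (G p.1) • G p.1) ∂ν| ≤
        ε * ∫ p, ‖p.2‖ ∂ν + (C + H) * (∫ p, ‖p.2‖ ∂ν - ∫ p, inner ℝ p.2 (G p.1) ∂ν) := by
    intro ν hν
    have i1 := hc.integrable_snd_of_homogeneous hh hν
    have i2 := integrable_inner_of_bounded hν hwG hwGb
    have i3 := integrable_inner_of_bounded hν hG hG1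
    have i4 : Integrable (fun p : E × E => ‖p.2‖ - inner ℝ p.2 (G p.1)) ν := hν.sub i3
    rw [← integral_sub i1 i2, ← integral_sub hν i3, ← integral_const_mul, ← integral_const_mul,
      ← integral_add (hν.const_mul _) (i4.const_mul _)]
    refine (abs_integral_le_integral_abs).trans (integral_mono (i1.sub i2).abs
      ((hν.const_mul _).add (i4.const_mul _)) fun p => hest _ _ (hG1 _))
  have hdef : M - ∫ p, inner ℝ p.2 (G p.1) ∂ρ ≤ η := by
    rw [hM, ← integral_sub hρ (integrable_inner_of_bounded hρ hG hG1)]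
    exact hGη
  have ev1 : ∀ᶠ k in atTop, ∫ p, ‖p.2‖ ∂(ρk k) < M + 1 := hmass.eventually (gt_mem_nhds (by linarith))
  -- The defect is a total variation minus a linear test integral, so it converges by the two
  -- hypotheses and stays small along the sequence.
  have ev2 : ∀ᶠ k in atTop, ∫ p, ‖p.2‖ ∂(ρk k) - ∫ p, inner ℝ p.2 (G p.1) ∂(ρk k) < 2 * η :=
    (hmass.sub (hweak G hG hGc)).eventually (gt_mem_nhds (by linarith))
  have ev3 := (hweak _ hwG hGc.smul_left).eventually (Metric.ball_mem_nhds _ (show 0 < e / 4 by positivity))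
  refine eventually_atTop.1 ?_ |>.imp fun N hN k hk => hN k hk.le
  filter_upwards [ev1, ev2, ev3] with k hk1 hk2 hk3
  have c1 := hcomp (ρk k) (hk k)
  have c2 := hcomp ρ hρ
  have hεM : ε * (M + 1) = e / 8 := by rw [hε]; field_simp
  have hηC : (C + H + 1) * η = e / 16 := by rw [hη]; field_simp
  have b1 : ε * ∫ p, ‖p.2‖ ∂(ρk k) ≤ e / 8 := hεM ▸ mul_le_mul_of_nonneg_left hk1.le hε0.le
  have b2 : ε * M ≤ e / 8 := hεM ▸ mul_le_mul_of_nonneg_left (by linarith) hε0.le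
  have b3 : (C + H) * (∫ p, ‖p.2‖ ∂(ρk k) - ∫ p, inner ℝ p.2 (G p.1) ∂(ρk k)) ≤ (C + H) * (2 * η) :=
    mul_le_mul_of_nonneg_left hk2.le (by linarith)
  have b4 : (C + H) * (M - ∫ p, inner ℝ p.2 (G p.1) ∂ρ) ≤ (C + H) * η :=
    mul_le_mul_of_nonneg_left hdef (by linarith)
  rw [Real.dist_eq] at hk3
  rw [Real.dist_eq]
  rw [abs_le] at c1 c2
  rw [abs_lt] at hk3 ⊢
  have hb : (C + H) * η < e / 16 := by linarith
  constructor <;> linarith [c1.1, c1.2, c2.1, c2.2, hk3.1, hk3.2]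

end reshetnyak

theorem tendsto_of_approx {a : ℕ → ℝ} {A : ℝ}
    (h : ∀ ε > 0, ∃ (b : ℕ → ℝ) (B : ℝ), Tendsto b atTop (𝓝 B) ∧ (∀ k, |a k - b k| ≤ ε) ∧
      |A - B| ≤ ε) : Tendsto a atTop (𝓝 A) := by
  rw [Metric.tendsto_atTop]
  intro e he
  obtain ⟨b, B, hb, hab, hAB⟩ := h (e / 4) (by positivity)
  obtain ⟨N, hN⟩ := Metric.tendsto_atTop.1 hb (e / 4) (by positivity)
  refine ⟨N, fun k hk => ?_⟩
  have h1 := hN k hk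
  have h2 := hab k
  rw [Real.dist_eq] at *
  rw [abs_lt] at *
  rw [abs_le] at *
  constructor <;> linarith [h1.1, h1.2, h2.1, h2.2, hAB.1, hAB.2]

/-! ### The gradient measure and its convergence -/

section gradMeasure
variable {m : ℕ} {fk : ℕ → Rn (m + 1) → ℝ} {f : Rn (m + 1) → ℝ}

/-- The distributional gradient of `-f`, lifted to pairs of a point and a covector. -/
noncomputable def gradMeasure (f : Rn (m + 1) → ℝ) : Measure (Rn (m + 1) × Rn (m + 1)) :=
  (bulkMeasure f).map (fun x => (x, gradNegLog f x)) +
    (boundaryMeasure f).map fun x => (x, (gaussMap (supp f) x : Rn (m + 1)))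

theorem measurable_graph_gradNegLog (f : Rn (m + 1) → ℝ) :
    Measurable fun x => (x, gradNegLog f x) :=
  measurable_id.prodMk (measurable_gradNegLog f)

theorem measurable_coe_gaussMap (K : Set (Rn (m + 1))) :
    Measurable fun x => (gaussMap K x : Rn (m + 1)) :=
  measurable_subtype_coe.comp (measurable_gaussMap K)

theorem measurable_graph_gaussMap (K : Set (Rn (m + 1))) :
    Measurable fun x => (x, (gaussMap K x : Rn (m + 1))) :=
  measurable_id.prodMk (measurable_coe_gaussMap K)

theorem IsLogConc.isFiniteMeasure_gradMeasure (hf : IsLogConc f) :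
    IsFiniteMeasure (gradMeasure f) := by
  have := hf.isFiniteMeasure_bulk
  have := hf.isFiniteMeasure_boundary
  unfold gradMeasure
  infer_instance

theorem integrable_gradMeasure_iff {H : Rn (m + 1) × Rn (m + 1) → ℝ} (hH : Measurable H) :
    Integrable H (gradMeasure f) ↔ Integrable (fun x => H (x, gradNegLog f x)) (bulkMeasure f) ∧
      Integrable (fun x => H (x, (gaussMap (supp f) x : Rn (m + 1)))) (boundaryMeasure f) := by
  rw [gradMeasure, integrable_add_measure,
    integrable_map_measure hH.aestronglyMeasurable (measurable_graph_gradNegLog f).aemeasurable,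
    integrable_map_measure hH.aestronglyMeasurable (measurable_graph_gaussMap _).aemeasurable]
  rfl

theorem integral_gradMeasure {H : Rn (m + 1) × Rn (m + 1) → ℝ} (hH : Measurable H)
    (hint : Integrable H (gradMeasure f)) :
    ∫ p, H p ∂(gradMeasure f) = ∫ x, H (x, gradNegLog f x) ∂(bulkMeasure f) +
      ∫ x, H (x, (gaussMap (supp f) x : Rn (m + 1))) ∂(boundaryMeasure f) := by
  rw [gradMeasure, integrable_add_measure] at hint
  rw [gradMeasure, integral_add_measure hint.1 hint.2,
    integral_map (measurable_graph_gradNegLog f).aemeasurable hH.aestronglyMeasurable,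
    integral_map (measurable_graph_gaussMap _).aemeasurable hH.aestronglyMeasurable]

theorem IsLogConc.integrable_norm_gradMeasure (hf : IsLogConc f) :
    Integrable (fun p : Rn (m + 1) × Rn (m + 1) => ‖p.2‖) (gradMeasure f) := by
  have := hf.isFiniteMeasure_boundary
  rw [integrable_gradMeasure_iff (by fun_prop)]
  refine ⟨hf.integrable_norm_grad, ?_⟩
  simp

theorem IsLogConc.integrable_snd_gradMeasure (hf : IsLogConc f) :
    Integrable (fun p : Rn (m + 1) × Rn (m + 1) => p.2) (gradMeasure f) :=
  (integrable_norm_iff (by fun_prop)).1 hf.integrable_norm_gradMeasure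

theorem HypoTendsto.tendsto_integral_abs_inner (h : HypoTendsto fk f) (hf : IsLogConc f)
    (hfk : ∀ k, IsLogConc (fk k)) {u : Rn (m + 1)} (hu : ‖u‖ = 1) :
    Tendsto (fun k => ∫ p, |inner ℝ p.2 u| ∂(gradMeasure (fk k))) atTop
      (𝓝 (∫ p, |inner ℝ p.2 u| ∂(gradMeasure f))) := by
  obtain ⟨F, rfl⟩ := Frame.exists_e_eq hu
  have hmeas : Measurable fun p : Rn (m + 1) × Rn (m + 1) => |inner ℝ p.2 F.e| := by fun_prop
  have hi : ∀ {g : Rn (m + 1) → ℝ}, IsLogConc g →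
      Integrable (fun p : Rn (m + 1) × Rn (m + 1) => |inner ℝ p.2 F.e|) (gradMeasure g) := fun hg =>
    (hg.integrable_snd_gradMeasure.inner_const F.e).abs
  simp only [integral_gradMeasure hmeas (hi hf), fun k => integral_gradMeasure hmeas (hi (hfk k))]
  exact h.tendsto_integral_variation F hf hfk

theorem HypoTendsto.tendsto_mass (h : HypoTendsto fk f) (hf : IsLogConc f)
    (hfk : ∀ k, IsLogConc (fk k)) :
    Tendsto (fun k => ∫ p, ‖p.2‖ ∂(gradMeasure (fk k))) atTop
      (𝓝 (∫ p, ‖p.2‖ ∂(gradMeasure f))) := by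
  have := hf.isFiniteMeasure_gradMeasure
  have := fun k => (hfk k).isFiniteMeasure_gradMeasure
  refine tendsto_integral_norm_of_abs_inner measurable_snd
    (fun k => (hfk k).integrable_snd_gradMeasure) hf.integrable_snd_gradMeasure
    (fun u hu => h.tendsto_integral_abs_inner hf hfk hu) ?_
  have hs := tendsto_finsetSum Finset.univ fun (i : Fin (m + 1)) _ =>
    h.tendsto_integral_abs_inner hf hfk (u := EuclideanSpace.single i 1) (by simp)
  obtain ⟨B, hB⟩ := hs.bddAbove_range
  refine ⟨B, fun k => le_trans ?_ (hB ⟨k, rfl⟩)⟩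
  have hi : ∀ i : Fin (m + 1), Integrable (fun p : Rn (m + 1) × Rn (m + 1) =>
      |inner ℝ p.2 (EuclideanSpace.single i (1 : ℝ))|) (gradMeasure (fk k)) := fun i =>
    ((hfk k).integrable_snd_gradMeasure.inner_const _).abs
  beta_reduce
  rw [← integral_finsetSum _ fun i _ => hi i]
  exact integral_mono (hfk k).integrable_norm_gradMeasure (integrable_finsetSum _ fun i _ => hi i)
    fun p => Rn.norm_le_sum _

theorem HypoTendsto.exists_mass_le (h : HypoTendsto fk f) (hf : IsLogConc f)
    (hfk : ∀ k, IsLogConc (fk k)) :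
    ∃ B > 0, (∀ k, ∫ p, ‖p.2‖ ∂(gradMeasure (fk k)) ≤ B) ∧ ∫ p, ‖p.2‖ ∂(gradMeasure f) ≤ B := by
  obtain ⟨B, hB⟩ := (h.tendsto_mass hf hfk).bddAbove_range
  have hB' : ∀ k, ∫ p, ‖p.2‖ ∂(gradMeasure (fk k)) ≤ B := fun k => hB ⟨k, rfl⟩
  have hlim := le_of_tendsto' (h.tendsto_mass hf hfk) hB'
  exact ⟨max B 1, by positivity, fun k => (hB' k).trans (le_max_left _ _), hlim.trans (le_max_left _ _)⟩

theorem HypoTendsto.tendsto_integral_mul (h : HypoTendsto fk f) (hf : IsLogConc f)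
    (hfk : ∀ k, IsLogConc (fk k)) {g : Rn (m + 1) → ℝ} (hg : Continuous g)
    (hgc : HasCompactSupport g) :
    Tendsto (fun k => ∫ x, g x * fk k x) atTop (𝓝 (∫ x, g x * f x)) := by
  obtain ⟨C, hC, a, ha, hb⟩ := h.exists_exp_bound hf hfk
  obtain ⟨M, hM⟩ := hgc.exists_bound_of_continuous hg
  refine tendsto_integral_filter_of_dominated_convergence
    (fun x => M * (C * Real.exp (-(a * ‖x‖))))
    (Eventually.of_forall fun k => (hg.measurable.mul (hfk k).measurable).aestronglyMeasurable) ?_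
    (((integrable_exp_neg_mul_norm volume ha).const_mul C).const_mul M) ?_
  · filter_upwards [hb] with k hk
    refine ae_of_all _ fun x => ?_
    rw [norm_mul, Real.norm_of_nonneg ((hfk k).nonneg x)]
    exact mul_le_mul (hM x) (hk x) ((hfk k).nonneg x) ((norm_nonneg _).trans (hM x))
  · filter_upwards [h.ae_tendsto hf hfk] with x hx
    exact hx.const_mul _

theorem IsLogConc.integral_inner_gradMeasure (hf : IsLogConc f) (F : Frame m)
    {g : Rn (m + 1) → ℝ} (hg : ContDiff ℝ 1 g) (hgc : HasCompactSupport g) :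
    ∫ p, inner ℝ p.2 (g p.1 • F.e) ∂(gradMeasure f) = ∫ x, fderiv ℝ g x F.e * f x := by
  obtain ⟨M, hM⟩ := hgc.exists_bound_of_continuous hg.continuous
  have hgcont := hg.continuous
  rw [integral_gradMeasure (H := fun p => inner ℝ p.2 (g p.1 • F.e)) (by fun_prop)
    (integrable_inner_of_bounded (M := M) hf.integrable_norm_gradMeasure
      (G := fun x => g x • F.e) (by fun_prop) fun x => by
        rw [norm_smul, F.norm_e, mul_one]; exact hM x)]
  simp only [inner_smul_right]
  exact hf.integral_by_parts F hg hgc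

/-- Integration by parts in each coordinate leaves only integrals of the functions against fixed
continuous functions of compact support. -/
theorem HypoTendsto.tendsto_integral_inner_of_contDiff (h : HypoTendsto fk f) (hf : IsLogConc f)
    (hfk : ∀ k, IsLogConc (fk k)) {G : Rn (m + 1) → Rn (m + 1)} (hG : ContDiff ℝ 1 G)
    (hGc : HasCompactSupport G) :
    Tendsto (fun k => ∫ p, inner ℝ p.2 (G p.1) ∂(gradMeasure (fk k))) atTop
      (𝓝 (∫ p, inner ℝ p.2 (G p.1) ∂(gradMeasure f))) := by
  choose F hF using fun i : Fin (m + 1) =>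
    Frame.exists_e_eq (m := m) (e := EuclideanSpace.single i (1 : ℝ)) (by simp)
  have hgi : ∀ i, ContDiff ℝ 1 fun x => G x i := fun i => by fun_prop
  have hgci : ∀ i, HasCompactSupport fun x => G x i := fun i =>
    hGc.comp_left (g := fun v : Rn (m + 1) => v i) rfl
  have hsum : ∀ p : Rn (m + 1) × Rn (m + 1), inner ℝ p.2 (G p.1) =
      ∑ i, inner ℝ p.2 (G p.1 i • (F i).e) := by
    intro p
    rw [← inner_sum]
    congr 1
    simp only [hF]
    simpa using ((EuclideanSpace.basisFun (Fin (m + 1)) ℝ).sum_repr (G p.1)).symm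
  have hform : ∀ {g : Rn (m + 1) → ℝ}, IsLogConc g →
      ∫ p, inner ℝ p.2 (G p.1) ∂(gradMeasure g) =
        ∑ i, ∫ x, fderiv ℝ (fun x => G x i) x (F i).e * g x := by
    intro g hg
    simp only [hsum]
    rw [integral_finsetSum]
    · exact Finset.sum_congr rfl fun i _ => hg.integral_inner_gradMeasure (F i) (hgi i) (hgci i)
    · intro i _
      obtain ⟨M, hM⟩ := (hgci i).exists_bound_of_continuous (hgi i).continuous
      have := (hgi i).continuous
      exact integrable_inner_of_bounded (M := M) hg.integrable_norm_gradMeasure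
        (G := fun x => G x i • (F i).e) (by fun_prop) fun x => by
          rw [norm_smul, (F i).norm_e, mul_one]; exact hM x
  simp only [hform hf, fun k => hform (hfk k)]
  refine tendsto_finsetSum _ fun i _ => h.tendsto_integral_mul hf hfk ?_ ?_
  · exact ((hgi i).continuous_fderiv one_ne_zero).clm_apply continuous_const
  · exact ((hgci i).fderiv (𝕜 := ℝ)).comp_left (g := fun l : Rn (m + 1) →L[ℝ] ℝ => l (F i).e) (by simp)

theorem HypoTendsto.tendsto_integral_inner (h : HypoTendsto fk f) (hf : IsLogConc f)
    (hfk : ∀ k, IsLogConc (fk k)) {G : Rn (m + 1) → Rn (m + 1)} (hG : Continuous G)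
    (hGc : HasCompactSupport G) :
    Tendsto (fun k => ∫ p, inner ℝ p.2 (G p.1) ∂(gradMeasure (fk k))) atTop
      (𝓝 (∫ p, inner ℝ p.2 (G p.1) ∂(gradMeasure f))) := by
  obtain ⟨B, hB0, hBk, hB⟩ := h.exists_mass_le hf hfk
  refine tendsto_of_approx fun ε hε => ?_
  -- A uniform error ε/B in the field costs at most ε, because every total variation is at most B.
  obtain ⟨G', hG', hd, hs⟩ := hG.exists_contDiff_approx 1 (ε := fun _ => ε / B) continuous_const
    (fun _ => by positivity)
  have hG'1 : ContDiff ℝ 1 G' := hG'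
  have hG'c : HasCompactSupport G' := hGc.mono hs
  obtain ⟨M, hM⟩ := hGc.exists_bound_of_continuous hG
  obtain ⟨M', hM'⟩ := hG'c.exists_bound_of_continuous hG'.continuous
  have hest : ∀ {g : Rn (m + 1) → ℝ}, IsLogConc g → ∫ p, ‖p.2‖ ∂(gradMeasure g) ≤ B →
      |∫ p, inner ℝ p.2 (G p.1) ∂(gradMeasure g) - ∫ p, inner ℝ p.2 (G' p.1) ∂(gradMeasure g)| ≤ ε := by
    intro g hg hgB
    have hn := hg.integrable_norm_gradMeasure
    have i1 := integrable_inner_of_bounded hn hG hM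
    have i2 := integrable_inner_of_bounded hn hG'.continuous hM'
    rw [← integral_sub i1 i2]
    refine (abs_integral_le_integral_abs).trans ((integral_mono (i1.sub i2).abs
      (hn.const_mul (ε / B)) fun p => ?_).trans ?_)
    · show |inner ℝ p.2 (G p.1) - inner ℝ p.2 (G' p.1)| ≤ ε / B * ‖p.2‖
      rw [← inner_sub_right, mul_comm]
      refine (abs_real_inner_le_norm _ _).trans ?_
      gcongr
      rw [← dist_eq_norm, dist_comm]
      exact (hd p.1).le
    · rw [integral_const_mul]
      calc ε / B * ∫ p, ‖p.2‖ ∂(gradMeasure g) ≤ ε / B * B := by gcongr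
        _ = ε := div_mul_cancel₀ _ hB0.ne'
  exact ⟨_, _, h.tendsto_integral_inner_of_contDiff hf hfk hG'1 hG'c,
    fun k => hest (hfk k) (hBk k), hest hf hB⟩

/-- The bulk part lives on the interior of the support and the boundary part on its frontier. As
these are disjoint, the direction of the covector is a function of the position alone. -/
theorem IsLogConc.exists_polar (hf : IsLogConc f) : ∃ σ : Rn (m + 1) → Rn (m + 1), Measurable σ ∧
    (∀ x, ‖σ x‖ ≤ 1) ∧ ∀ᵐ p ∂(gradMeasure f), p.2 = ‖p.2‖ • σ p.1 := by
  classical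
  have hms : MeasurableSet (interior (supp f)) := isOpen_interior.measurableSet
  set σ : Rn (m + 1) → Rn (m + 1) := (interior (supp f)).piecewise
    (fun x => ‖gradNegLog f x‖⁻¹ • gradNegLog f x) (fun x => (gaussMap (supp f) x : Rn (m + 1))) with hσ
  have hσm : Measurable σ := Measurable.piecewise hms
    ((measurable_gradNegLog f).norm.inv.smul (measurable_gradNegLog f)) (measurable_coe_gaussMap _)
  refine ⟨σ, hσm, fun x => ?_, ?_⟩
  · by_cases hx : x ∈ interior (supp f)
    · rw [hσ, Set.piecewise_eq_of_mem _ _ _ hx, norm_smul, norm_inv, norm_norm]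
      exact inv_mul_le_one
    · rw [hσ, Set.piecewise_eq_of_notMem _ _ _ hx]
      simp
  · have hset : MeasurableSet {p : Rn (m + 1) × Rn (m + 1) | p.2 = ‖p.2‖ • σ p.1} :=
      measurableSet_eq_fun measurable_snd (measurable_snd.norm.smul (hσm.comp measurable_fst))
    rw [gradMeasure, ae_add_measure_iff]
    constructor
    · rw [ae_map_iff (measurable_graph_gradNegLog f).aemeasurable hset, bulkMeasure,
        ae_withDensity_iff hf.measurable.ennreal_ofReal]
      filter_upwards [measure_eq_zero_iff_ae_notMem.1 (hf.convex_supp.addHaar_frontier volume)]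
        with x hx hfx
      have hpos : 0 < f x := by simpa using hfx
      have hint : x ∈ interior (supp f) := by
        by_contra hcon
        exact hx ⟨subset_closure (subset_closure hpos), hcon⟩
      show gradNegLog f x = ‖gradNegLog f x‖ • σ x
      rw [hσ, Set.piecewise_eq_of_mem _ _ _ hint]
      by_cases h0 : gradNegLog f x = 0
      · simp [h0]
      · rw [smul_inv_smul₀ (norm_ne_zero_iff.2 h0)]
    · rw [ae_map_iff (measurable_graph_gaussMap _).aemeasurable hset]
      refine (withDensity_absolutelyContinuous _ _).ae_le ?_
      filter_upwards [ae_restrict_mem (isClosed_frontier (s := supp f)).measurableSet] with x hx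
      show (gaussMap (supp f) x : Rn (m + 1)) = ‖(gaussMap (supp f) x : Rn (m + 1))‖ • σ x
      rw [hσ, Set.piecewise_eq_of_notMem _ _ _ hx.2]
      simp

theorem HypoTendsto.tendsto_integral_homogeneous (h : HypoTendsto fk f) (hf : IsLogConc f)
    (hfk : ∀ k, IsLogConc (fk k)) {g : Rn (m + 1) → ℝ} (hc : Continuous g)
    (hh : ∀ r : ℝ, 0 ≤ r → ∀ v, g (r • v) = r * g v) :
    Tendsto (fun k => ∫ p, g p.2 ∂(gradMeasure (fk k))) atTop (𝓝 (∫ p, g p.2 ∂(gradMeasure f))) := by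
  obtain ⟨σ, hσ, hσ1, hpolar⟩ := hf.exists_polar
  exact _root_.tendsto_integral_homogeneous (fun k => (hfk k).integrable_norm_gradMeasure)
    hf.integrable_norm_gradMeasure (h.tendsto_mass hf hfk)
    (fun G hG hGc => h.tendsto_integral_inner hf hfk hG hGc) hσ hσ1 hpolar hc hh

theorem IsLogConc.integrable_comp_gradNegLog (hf : IsLogConc f) {ζ : Rn (m + 1) → ℝ}
    (hζ : Continuous ζ) {A C : ℝ} (hA : ∀ y, |ζ y| ≤ A * ‖y‖ + C) :
    Integrable (fun x => ζ (gradNegLog f x)) (bulkMeasure f) := by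
  have := hf.isFiniteMeasure_bulk
  exact ((hf.integrable_norm_grad.const_mul A).add (integrable_const C)).mono'
    (hζ.measurable.comp (measurable_gradNegLog f)).aestronglyMeasurable (ae_of_all _ fun x => hA _)

/-- Inside the limiting support values and gradients converge almost everywhere; outside it the
densities tend to 0, so boundedness of ζ makes the behaviour of the gradients irrelevant there. -/
theorem HypoTendsto.tendsto_integral_bulk_of_bounded (h : HypoTendsto fk f) (hf : IsLogConc f)
    (hfk : ∀ k, IsLogConc (fk k)) {ζ : Rn (m + 1) → ℝ} (hζ : Continuous ζ) {M : ℝ}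
    (hM : ∀ y, |ζ y| ≤ M) :
    Tendsto (fun k => ∫ x, ζ (gradNegLog (fk k) x) ∂(bulkMeasure (fk k))) atTop
      (𝓝 (∫ x, ζ (gradNegLog f x) ∂(bulkMeasure f))) := by
  simp only [hf.integral_bulk, fun k => (hfk k).integral_bulk]
  obtain ⟨C, hC, a, ha, hb⟩ := h.exists_exp_bound hf hfk
  refine tendsto_integral_filter_of_dominated_convergence
    (fun x => C * Real.exp (-(a * ‖x‖)) * M) (Eventually.of_forall fun k =>
      ((hfk k).measurable.mul (hζ.measurable.comp (measurable_gradNegLog _))).aestronglyMeasurable) ?_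
    (((integrable_exp_neg_mul_norm volume ha).const_mul C).mul_const M) ?_
  · filter_upwards [hb] with k hk
    refine ae_of_all _ fun x => ?_
    rw [norm_mul, Real.norm_of_nonneg ((hfk k).nonneg x)]
    exact mul_le_mul (hk x) (hM _) (norm_nonneg _) (by positivity)
  · filter_upwards [h.ae_tendsto_gradient hf hfk,
      measure_eq_zero_iff_ae_notMem.1 (hf.convex_supp.addHaar_frontier volume)] with x hx hfr
    by_cases hxi : x ∈ interior (supp f)
    · exact (h.tendsto_of_mem_interior hf hfk hxi).mul ((hζ.tendsto _).comp (hx hxi))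
    · have hxn : x ∉ supp f := fun hK => hfr ⟨subset_closure hK, hxi⟩
      have h0 := h.tendsto_of_notMem hf hfk hxn
      rw [hf.eq_zero_of_notMem hxn] at h0 ⊢
      rw [zero_mul]
      refine squeeze_zero_norm (fun k => ?_) (by simpa using h0.mul_const M)
      rw [norm_mul, Real.norm_of_nonneg ((hfk k).nonneg x)]
      exact mul_le_mul_of_nonneg_left (hM _) ((hfk k).nonneg x)

theorem IsLogConc.integral_norm_grad_le (hf : IsLogConc f) :
    ∫ x, ‖gradNegLog f x‖ ∂(bulkMeasure f) ≤ ∫ p, ‖p.2‖ ∂(gradMeasure f) := by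
  rw [integral_gradMeasure (H := fun p => ‖p.2‖) (by fun_prop) hf.integrable_norm_gradMeasure]
  exact le_add_of_nonneg_right (integral_nonneg fun x => norm_nonneg _)

/-- Convergence of the bulk integrals of functions of sublinear growth. -/
theorem HypoTendsto.tendsto_integral_bulk_of_sublinear (h : HypoTendsto fk f) (hf : IsLogConc f)
    (hfk : ∀ k, IsLogConc (fk k)) {ζ : Rn (m + 1) → ℝ} (hζ : Continuous ζ)
    (hsub : ∀ ε > 0, ∃ C, ∀ y, |ζ y| ≤ ε * ‖y‖ + C) :
    Tendsto (fun k => ∫ x, ζ (gradNegLog (fk k) x) ∂(bulkMeasure (fk k))) atTop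
      (𝓝 (∫ x, ζ (gradNegLog f x) ∂(bulkMeasure f))) := by
  obtain ⟨B, hB0, hBk, hB⟩ := h.exists_mass_le hf hfk
  refine tendsto_of_approx fun ε hε => ?_
  obtain ⟨C, hC⟩ := hsub (ε / B) (by positivity)
  have hC0 : 0 ≤ C := (abs_nonneg _).trans (by simpa using hC 0)
  -- Truncation at height C changes ζ by at most (ε/B)‖y‖, hence each integral by at most ε.
  set ζ' : Rn (m + 1) → ℝ := fun y => max (-C) (min C (ζ y)) with hζ'
  have hζ'c : Continuous ζ' := by fun_prop
  have hζ'b : ∀ y, |ζ' y| ≤ C := fun y => abs_le.2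
    ⟨le_max_left _ _, max_le (by linarith) (min_le_left _ _)⟩
  have hdiff : ∀ y, |ζ y - ζ' y| ≤ ε / B * ‖y‖ := by
    intro y
    have h1 := abs_le.1 (hC y)
    have h2 : 0 ≤ ε / B * ‖y‖ := by positivity
    rw [abs_le]
    simp only [hζ']
    constructor
    · rcases le_total C (ζ y) with h3 | h3
      · rw [min_eq_left h3, max_eq_right (by linarith)]; linarith
      · rw [min_eq_right h3]
        rcases le_total (-C) (ζ y) with h4 | h4
        · rw [max_eq_right h4]; linarith
        · rw [max_eq_left h4]; linarith [h1.1]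
    · rcases le_total C (ζ y) with h3 | h3
      · rw [min_eq_left h3, max_eq_right (by linarith)]; linarith [h1.2]
      · rw [min_eq_right h3]
        linarith [le_max_right (-C) (ζ y)]
  have hest : ∀ {g : Rn (m + 1) → ℝ}, IsLogConc g → ∫ p, ‖p.2‖ ∂(gradMeasure g) ≤ B →
      |∫ x, ζ (gradNegLog g x) ∂(bulkMeasure g) - ∫ x, ζ' (gradNegLog g x) ∂(bulkMeasure g)| ≤ ε := by
    intro g hg hgB
    have i1 := hg.integrable_comp_gradNegLog hζ hC
    have i2 := hg.integrable_comp_gradNegLog hζ'c (A := 0) (C := C) (by simpa using hζ'b)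
    rw [← integral_sub i1 i2]
    refine (abs_integral_le_integral_abs).trans ((integral_mono (i1.sub i2).abs
      (hg.integrable_norm_grad.const_mul (ε / B)) fun x => hdiff _).trans ?_)
    rw [integral_const_mul]
    calc ε / B * ∫ x, ‖gradNegLog g x‖ ∂(bulkMeasure g) ≤ ε / B * B := by
          gcongr; exact hg.integral_norm_grad_le.trans hgB
      _ = ε := div_mul_cancel₀ _ hB0.ne'
  exact ⟨_, _, h.tendsto_integral_bulk_of_bounded hf hfk hζ'c hζ'b,
    fun k => hest (hfk k) (hBk k), hest hf hB⟩

end gradMeasure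

/-! ### Homogeneous extension of the horizon function -/

section horizon
variable {n : ℕ} {ξ : Rn n → ℝ} {ξbar : UnitSphere n → ℝ}

open Classical in
/-- The positively homogeneous extension of a function on the unit sphere. -/
noncomputable def homogeneousExtension (ξbar : UnitSphere n → ℝ) (y : Rn n) : ℝ :=
  if hy : y = 0 then 0 else ‖y‖ * ξbar ⟨‖y‖⁻¹ • y, by simp [norm_smul, hy]⟩

theorem homogeneousExtension_smul (r : ℝ) (hr : 0 ≤ r) (y : Rn n) :
    homogeneousExtension ξbar (r • y) = r * homogeneousExtension ξbar y := by
  rcases hr.eq_or_lt with rfl | hr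
  · simp [homogeneousExtension]
  by_cases hy : y = 0
  · simp [homogeneousExtension, hy]
  · have hry : r • y ≠ 0 := smul_ne_zero hr.ne' hy
    have hnorm : ‖r • y‖ = r * ‖y‖ := by rw [norm_smul, Real.norm_of_nonneg hr.le]
    have hdir : ‖r • y‖⁻¹ • r • y = ‖y‖⁻¹ • y := by
      rw [hnorm, smul_smul, mul_inv, mul_right_comm, inv_mul_cancel₀ hr.ne', one_mul]
    rw [homogeneousExtension, homogeneousExtension, dif_neg hry, dif_neg hy, ← mul_assoc, ← hnorm]
    simp only [hdir]

theorem homogeneousExtension_coe (θ : UnitSphere n) : homogeneousExtension ξbar θ = ξbar θ := by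
  have h1 : ‖(θ : Rn n)‖ = 1 := by simp
  have h0 : (θ : Rn n) ≠ 0 := fun h => by simp [h] at h1
  rw [homogeneousExtension, dif_neg h0]
  simp

theorem continuous_homogeneousExtension (hc : Continuous ξbar) :
    Continuous (homogeneousExtension ξbar) := by
  rw [continuous_iff_continuousAt]
  intro y
  by_cases hy : y = 0
  · obtain ⟨M, hM⟩ := isCompact_univ.exists_bound_of_continuousOn hc.continuousOn
    have hb : ∀ z, ‖homogeneousExtension ξbar z‖ ≤ ‖z‖ * M := by
      intro z
      by_cases hz : z = 0
      · simp [homogeneousExtension, hz]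
      · rw [homogeneousExtension, dif_neg hz, norm_mul, norm_norm]
        gcongr
        exact hM _ (Set.mem_univ _)
    have h0 : homogeneousExtension ξbar y = 0 := by simp [homogeneousExtension, hy]
    rw [ContinuousAt, h0]
    refine squeeze_zero_norm hb ?_
    have : Tendsto (fun z : Rn n => ‖z‖ * M) (𝓝 y) (𝓝 (‖y‖ * M)) :=
      (by fun_prop : Continuous fun z : Rn n => ‖z‖ * M).tendsto y
    simpa [hy] using this
  · have hopen : IsOpen {z : Rn n | z ≠ 0} := isOpen_ne
    refine ContinuousOn.continuousAt (s := {z : Rn n | z ≠ 0}) ?_ (hopen.mem_nhds hy)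
    rw [continuousOn_iff_continuous_domRestrict]
    have heq : Set.domRestrict {z : Rn n | z ≠ 0} (homogeneousExtension ξbar) = fun z : {z : Rn n | z ≠ 0} =>
        ‖(z : Rn n)‖ * ξbar ⟨‖(z : Rn n)‖⁻¹ • (z : Rn n), by
          have hz : (z : Rn n) ≠ 0 := z.2
          simp [norm_smul, hz]⟩ := by
      ext z
      exact dif_neg z.2
    rw [heq]
    refine continuous_subtype_val.norm.mul (hc.comp (Continuous.subtype_mk ?_ _))
    exact (continuous_subtype_val.norm.inv₀ fun z => norm_ne_zero_iff.2 z.2).smul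
      continuous_subtype_val

theorem CosmicallyContinuousWith.continuous_horizon (h : CosmicallyContinuousWith ξ ξbar) :
    Continuous ξbar := by
  refine h.2.continuous (Frequently.of_forall fun r => ?_)
  have := h.1
  fun_prop

/-- Uniform convergence to the horizon function makes the error at most ε‖y‖ outside a large ball;
inside it the difference is bounded by compactness. -/
theorem CosmicallyContinuousWith.sublinear (h : CosmicallyContinuousWith ξ ξbar) {ε : ℝ}
    (hε : 0 < ε) : ∃ C, ∀ y, |ξ y - homogeneousExtension ξbar y| ≤ ε * ‖y‖ + C := by
  obtain ⟨R, hR⟩ := eventually_atTop.1 (Metric.tendstoUniformly_iff.1 h.2 ε hε)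
  have hc : Continuous fun y => ξ y - homogeneousExtension ξbar y :=
    h.1.sub (continuous_homogeneousExtension h.continuous_horizon)
  obtain ⟨C, hC⟩ := (isCompact_closedBall (0 : Rn n) (max R 1)).exists_bound_of_continuousOn
    hc.continuousOn
  have hC0 : 0 ≤ C := (norm_nonneg _).trans (hC 0 (by simp))
  refine ⟨C, fun y => ?_⟩
  by_cases hy : ‖y‖ ≤ max R 1
  · refine (hC y (by simpa using hy)).trans (le_add_of_nonneg_left (by positivity))
  · rw [not_le, max_lt_iff] at hy
    have hn : 0 < ‖y‖ := one_pos.trans hy.2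
    have hy0 : y ≠ 0 := norm_pos_iff.1 hn
    have h1 := hR ‖y‖ hy.1.le ⟨‖y‖⁻¹ • y, by simp [norm_smul, hy0]⟩
    rw [Real.dist_eq, smul_inv_smul₀ hn.ne', abs_sub_comm] at h1
    have h2 : ξ y - homogeneousExtension ξbar y =
        ‖y‖ * (ξ y / ‖y‖ - ξbar ⟨‖y‖⁻¹ • y, by simp [norm_smul, hy0]⟩) := by
      rw [homogeneousExtension, dif_neg hy0, mul_sub, mul_div_cancel₀ _ hn.ne']
    rw [h2, abs_mul, abs_norm]
    have := mul_le_mul_of_nonneg_left h1.le hn.le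
    linarith

end horizon

/-! ### The cosmic pairing and the conclusion -/

section cosmic
variable {m : ℕ} {f : Rn (m + 1) → ℝ} {ξ : Rn (m + 1) → ℝ} {ξbar : UnitSphere (m + 1) → ℝ}

theorem IsLogConc.isFiniteMeasure_muMeasure (hf : IsLogConc f) : IsFiniteMeasure (muMeasure f) := by
  have := hf.isFiniteMeasure_bulk
  exact Measure.isFiniteMeasure_map (bulkMeasure f) (gradNegLog f)

theorem nuMeasure_eq_map (f : Rn (m + 1) → ℝ) :
    nuMeasure f = (boundaryMeasure f).map (gaussMap (supp f)) := rfl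

theorem muMeasure_eq_map (f : Rn (m + 1) → ℝ) :
    muMeasure f = (bulkMeasure f).map (gradNegLog f) := rfl

theorem IsLogConc.isFiniteMeasure_nuMeasure (hf : IsLogConc f) : IsFiniteMeasure (nuMeasure f) := by
  have := hf.isFiniteMeasure_boundary
  rw [nuMeasure_eq_map]
  infer_instance

theorem IsLogConc.integrable_muMeasure (hf : IsLogConc f) (h : CosmicallyContinuousWith ξ ξbar) :
    Integrable ξ (muMeasure f) := by
  rw [muMeasure_eq_map, integrable_map_measure h.1.aestronglyMeasurable
    (measurable_gradNegLog f).aemeasurable]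
  obtain ⟨C, hC⟩ := h.sublinear one_pos
  obtain ⟨H, -, hH⟩ := exists_abs_le_mul_norm_of_homogeneous
    (continuous_homogeneousExtension h.continuous_horizon) homogeneousExtension_smul
  refine hf.integrable_comp_gradNegLog h.1 (A := 1 + H) (C := C) fun y => ?_
  have h1 : ξ y = (ξ y - homogeneousExtension ξbar y) + homogeneousExtension ξbar y := by ring
  rw [h1]
  refine (abs_add_le _ _).trans ?_
  linarith [hC y, hH y]

theorem IsLogConc.integrable_nuMeasure (hf : IsLogConc f) (hc : Continuous ξbar) :
    Integrable ξbar (nuMeasure f) := by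
  have := hf.isFiniteMeasure_nuMeasure
  obtain ⟨M, hM⟩ := isCompact_univ.exists_bound_of_continuousOn hc.continuousOn
  exact (integrable_const M).mono' hc.aestronglyMeasurable
    (ae_of_all _ fun θ => hM θ (Set.mem_univ θ))

/-- The homogeneous extension is subtracted and added in the bulk. On unit normals it equals the
horizon function, so the added term and the boundary term combine into one integral over the
gradient measure. -/
theorem IsLogConc.integral_cosmic (hf : IsLogConc f) (h : CosmicallyContinuousWith ξ ξbar) :
    (∫ x, ξ x ∂(muMeasure f)) + ∫ θ, ξbar θ ∂(nuMeasure f) =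
      ∫ x, (ξ (gradNegLog f x) - homogeneousExtension ξbar (gradNegLog f x)) ∂(bulkMeasure f) +
        ∫ p, homogeneousExtension ξbar p.2 ∂(gradMeasure f) := by
  have hc := continuous_homogeneousExtension h.continuous_horizon
  have hi := hc.integrable_snd_of_homogeneous homogeneousExtension_smul hf.integrable_norm_gradMeasure
  have hm : Measurable fun p : Rn (m + 1) × Rn (m + 1) => homogeneousExtension ξbar p.2 :=
    hc.measurable.comp measurable_snd
  have hi' := (integrable_gradMeasure_iff hm).1 hi
  have hξ := hf.integrable_muMeasure h
  rw [muMeasure_eq_map, integrable_map_measure h.1.aestronglyMeasurable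
    (measurable_gradNegLog f).aemeasurable] at hξ
  rw [integral_gradMeasure hm hi, integral_sub (f := fun x => ξ (gradNegLog f x)) hξ hi'.1, muMeasure_eq_map, nuMeasure_eq_map,
    integral_map (measurable_gradNegLog f).aemeasurable h.1.aestronglyMeasurable,
    integral_map (measurable_gaussMap _).aemeasurable
      h.continuous_horizon.aestronglyMeasurable]
  simp only [homogeneousExtension_coe]
  ring

end cosmic

theorem mainTheorem2 (n : ℕ) [NeZero n] (fk : ℕ → Rn n → ℝ) (f : Rn n → ℝ)
    (hfk : ∀ k, fk k ∈ LC n) (hf : f ∈ LC n)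
    (hconv : EpiTendsto (fun k => negLog (fk k)) (negLog f)) :
    CosmicTendsto (fun k => muMeasure (fk k)) (fun k => nuMeasure (fk k))
      (muMeasure f) (nuMeasure f) := by
  obtain ⟨m, rfl⟩ := Nat.exists_eq_succ_of_ne_zero (NeZero.ne n)
  have hLf := isLogConc_of_mem_LC hf
  have hLk := fun k => isLogConc_of_mem_LC (hfk k)
  have h := hconv.hypoTendsto
  refine ⟨fun k => ⟨(hLk k).isFiniteMeasure_muMeasure, (hLk k).isFiniteMeasure_nuMeasure⟩,
    hLf.isFiniteMeasure_muMeasure, hLf.isFiniteMeasure_nuMeasure, fun ξ ξbar hξ =>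
    ⟨fun k => ⟨(hLk k).integrable_muMeasure hξ, (hLk k).integrable_nuMeasure hξ.continuous_horizon⟩,
      hLf.integrable_muMeasure hξ, hLf.integrable_nuMeasure hξ.continuous_horizon, ?_⟩⟩
  have hc := continuous_homogeneousExtension hξ.continuous_horizon
  have key := (h.tendsto_integral_bulk_of_sublinear hLf hLk (hξ.1.sub hc)
    fun ε hε => hξ.sublinear hε).add
    (h.tendsto_integral_homogeneous hLf hLk hc homogeneousExtension_smul)
  rw [hLf.integral_cosmic hξ]
  exact key.congr fun k => ((hLk k).integral_cosmic hξ).symm
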